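/- Consider the planar circular restricted three-body problem with primaries of masses $1-\mu$ at $(-\mu,0)$ and $\mu$ at $(1-\mu,0)$ in the rotating frame. Retrograde motions are described by the Delaunay variables $(L,G,l,g)$ with $L<G<0$ and angles $l,g$ modulo $2\pi$: $a=L^2$, $G^2=a(1-e^2)$, $l=E-e\sin E$, $r=a(1-e\cos E)$, $\cos\nu=\frac{\cos E-e}{1-e\cos E}$, $\sin\nu=\frac{\sqrt{1-e^2}\,\sin E}{1-e\cos E}$, $\theta=\nu+g$, $(x,y)=(r\cos\theta,r\sin\theta)$. The Hamiltonian is $$H=-\frac1{2L^2}-G-\Bigl(\frac{1-\mu}{\Delta_0}+\frac{\mu}{\Delta_1}-\frac1r\Bigr),$$ where $\Delta_0,\Delta_1$ are the distances from $(x,y)$ to the primaries of mass $1-\mu$ and $\mu$, and $\dot l=H_L$, $\dot g=H_G$, $\dot L=-H_l$, $\dot G=-H_g$. Let $p,q$ be relatively prime positive integers. (1) Let $0<e<1$ and $n_l,n_g\in\{0,1\}$, and suppose that the solution for $\mu=0$, namely $L=-(p/q)^{1/3}$, $G=-(p/q)^{1/3}(1-e^2)^{1/2}$, $l=n_l\pi-qt/p$,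 $g=n_g\pi-t$, satisfies $\Delta_1>0$ for all $t$. Then for all sufficiently small $\mu$ there is a periodic solution with initial conditions $L(0)=-(p/q)^{1/3}+O(\mu)$, $G(0)=-(p/q)^{1/3}(1-e^2)^{1/2}$, $l(0)=n_l\pi$, $g(0)=n_g\pi$ and period $2\pi p+O(\mu)$; the solution and the period depend analytically on $\mu$. There is only one such family: for $\mu$ near $0$ and $e'$ near $e$, there is at most one periodic solution with $G(0)=-(p/q)^{1/3}(1-e'^2)^{1/2}$, $l(0)=n_l\pi$, $g(0)=n_g\pi$, $L(0)$ near $-(p/q)^{1/3}$ and period near $2\pi p$. (2) For given $p,q,e$ the four choices of $(n_l,n_g)$ give rise to only two distinct families, represented by $n_g=0$, $n_l\in\{0,1\}$ if $p$ is odd and by $n_l=0$, $n_g\in\{0,1\}$ if $p$ is even. That is, after a shift of the origin of time that is analytic in $\mu$, every family in (1) satisfies the initial conditions of one of the two representatives (angles modulo $2\pi$), with $e$ replaced by an analytic function $\varepsilon(\mu)=e+O(\mu)$; and if two families belong to the two different representatives, with eccentricities $\varepsilon_0(\mu),\varepsilon_1(\mu)$ analytic at $\mu=0$ and $\varepsilon_0(0)=\varepsilon_1(0)=e$,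 then their orbits in phase space are disjoint for all sufficiently small $\mu$. (3) The characteristic multipliers (with multiplicity) of the solutions in (1) are $1,1$ and $1\pm\sqrt{C(e,p,q)\,\mu}+O(\mu)$ as $\mu\to0$, where $$C(e,p,q)=-6\pi p^2\int_0^{2\pi}\Bigl[\Bigl(\frac r{\Delta_1}\Bigr)_{\theta\theta}+\frac{\cos\theta}{r}\Bigr]dF,\qquad \Delta_1=(1+r^2-2r\cos\theta)^{1/2},$$ the partial derivatives with respect to $\theta$ are taken with $r$ fixed, and $r=(p/q)^{2/3}(1-e\cos E)$, $\theta=\nu+n_g\pi-t$, $E=qF$, $n_l\pi-qt/p=E-e\sin E$. (4) If $p/q\ne1$, then for each $(n_l,n_g)$ the function $e\mapsto C(e,p,q)$ is analytic at $e=0$ and $C(e,p,q)=O(e^{p+q})$ as $e\to0$, and the coefficients of $e^{p+q}$ in the power series about $e=0$ of $C(e,p,q)$ for the two representatives in (2) sum to zero. -/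

import Mathlib

open Filter Topology Asymptotics Set

noncomputable section

namespace R3BP

/-! Retrograde Delaunay variables of the planar circular restricted three-body problem.
A point of the (lifted) phase space is `z = ![L, G, l, g]`; `l` and `g` are angles, so points that
differ by integer multiples of `2π` in `l` and `g` represent the same state. -/

/-- The eccentric anomaly `E` as a function of the eccentricity `e` and the mean anomaly `l`,
i.e. the solution of Kepler's equation `l = E - e sin E`, which is unique for `0 ≤ e < 1`. -/
def eccAnomaly (e l : ℝ) : ℝ := Function.invFun (fun E : ℝ => E - e * Real.sin E) l

/-- The true anomaly `ν` (modulo `2π`) as a function of `e` and `E`. Since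
`(cos E - e)² + (1 - e²) sin² E = (1 - e cos E)²`, it satisfies
`cos ν = (cos E - e) / (1 - e cos E)` and `sin ν = √(1 - e²) sin E / (1 - e cos E)`. -/
def trueAnomaly (e E : ℝ) : ℝ :=
  Complex.arg ⟨Real.cos E - e, Real.sqrt (1 - e ^ 2) * Real.sin E⟩

/-- The eccentricity `e`, with `G² = a (1 - e²)` and `a = L²`. -/
def ecc (z : Fin 4 → ℝ) : ℝ := Real.sqrt (1 - (z 1) ^ 2 / (z 0) ^ 2)

/-- The distance `r = a (1 - e cos E)` from the origin, with `a = L²`. -/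
def radius (z : Fin 4 → ℝ) : ℝ :=
  (z 0) ^ 2 * (1 - ecc z * Real.cos (eccAnomaly (ecc z) (z 2)))

/-- The polar angle `θ = ν + g` in the rotating frame. -/
def polarAngle (z : Fin 4 → ℝ) : ℝ := trueAnomaly (ecc z) (eccAnomaly (ecc z) (z 2)) + z 3

/-- The Cartesian coordinate `x` in the rotating frame. -/
def posX (z : Fin 4 → ℝ) : ℝ := radius z * Real.cos (polarAngle z)

/-- The Cartesian coordinate `y` in the rotating frame. -/
def posY (z : Fin 4 → ℝ) : ℝ := radius z * Real.sin (polarAngle z)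

/-- Distance to the primary of mass `1 - μ`, located at `(-μ, 0)`. -/
def dist0 (μ : ℝ) (z : Fin 4 → ℝ) : ℝ := Real.sqrt ((posX z + μ) ^ 2 + posY z ^ 2)

/-- Distance to the primary of mass `μ`, located at `(1 - μ, 0)`. -/
def dist1 (μ : ℝ) (z : Fin 4 → ℝ) : ℝ := Real.sqrt ((posX z - 1 + μ) ^ 2 + posY z ^ 2)

/-- The Hamiltonian in the variables `(L, G, l, g)`: the Kepler part in the rotating frame is
`-1/(2L²) - G` (it contains the potential `-1/r`), and the remaining terms are the exact
difference `(1 - μ)/Δ₀ + μ/Δ₁ - 1/r` between the actual potential and the Kepler potential. -/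
def hamiltonian (μ : ℝ) (z : Fin 4 → ℝ) : ℝ :=
  -1 / (2 * (z 0) ^ 2) - z 1 - ((1 - μ) / dist0 μ z + μ / dist1 μ z - 1 / radius z)

/-- The region of the phase space where the variables are valid and represent retrograde motion
(`L < 0`, `G < 0`, `0 < e < 1`), away from collisions with the two primaries. -/
def domain (μ : ℝ) : Set (Fin 4 → ℝ) :=
  {z | z 0 < z 1 ∧ z 1 < 0 ∧ 0 < dist0 μ z ∧ 0 < dist1 μ z}

/-- Partial derivative of the Hamiltonian with respect to the `i`-th variable. -/
def hamPartial (μ : ℝ) (i : Fin 4) (z : Fin 4 → ℝ) : ℝ :=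
  fderiv ℝ (hamiltonian μ) z (Pi.single i 1)

/-- The Hamiltonian vector field:
`L' = -∂H/∂l`, `G' = -∂H/∂g`, `l' = ∂H/∂L`, `g' = ∂H/∂G`. -/
def vectorField (μ : ℝ) (z : Fin 4 → ℝ) : Fin 4 → ℝ :=
  ![-hamPartial μ 2 z, -hamPartial μ 3 z, hamPartial μ 0 z, hamPartial μ 1 z]

/-- `z` is a solution of Hamilton's equations, defined for all times. -/
def IsSolution (μ : ℝ) (z : ℝ → Fin 4 → ℝ) : Prop :=
  ∀ t, z t ∈ domain μ ∧ HasDerivAt z (vectorField μ (z t)) t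

/-- The translation of the lifted phase space by `2πk` in `l` and `2πm` in `g`. -/
def angleShift (k m : ℤ) : Fin 4 → ℝ := ![0, 0, 2 * Real.pi * k, 2 * Real.pi * m]

/-- `z` is a solution of Hamilton's equations that is periodic with period `T`. -/
def IsPeriodicSolution (μ : ℝ) (z : ℝ → Fin 4 → ℝ) (T : ℝ) : Prop :=
  IsSolution μ z ∧ 0 < T ∧ ∃ k m : ℤ, ∀ t, z (t + T) = z t + angleShift k m

/-- The number `(p/q)^{1/3}`, the value of `|L|` at resonance. -/
def resL (p q : ℕ) : ℝ := ((p : ℝ) / q) ^ ((1 : ℝ) / 3)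

/-- The state with `G = -(p/q)^{1/3} (1 - e²)^{1/2}`, `l = n_l π`, `g = n_g π` and given `L`. -/
def initialState (p q : ℕ) (e : ℝ) (nl ng : Fin 2) (L : ℝ) : Fin 4 → ℝ :=
  ![L, -(resL p q * Real.sqrt (1 - e ^ 2)), (nl : ℕ) * Real.pi, (ng : ℕ) * Real.pi]

/-- The retrograde solution for `μ = 0` with `L = -(p/q)^{1/3}`,
`G = -(p/q)^{1/3} (1 - e²)^{1/2}`, `l = n_l π - q t / p`, `g = n_g π - t`. -/
def unperturbed (p q : ℕ) (e : ℝ) (nl ng : Fin 2) (t : ℝ) : Fin 4 → ℝ :=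
  ![-resL p q, -(resL p q * Real.sqrt (1 - e ^ 2)),
    (nl : ℕ) * Real.pi - q * t / p, (ng : ℕ) * Real.pi - t]

/-- The solution for `μ = 0` does not collide with the primary of mass `μ`. -/
def NonCollision (p q : ℕ) (e : ℝ) (nl ng : Fin 2) : Prop :=
  ∀ t, 0 < dist1 0 (unperturbed p q e nl ng t)

/-- `μ ↦ γ μ` is, for `μ` near `0`, a family of periodic solutions with period
`T μ = 2πp + O(μ)`, depending analytically on `μ`, and with initial conditions
`L(0) = -(p/q)^{1/3} + O(μ)`, `G(0) = -(p/q)^{1/3} (1 - ε(μ)²)^{1/2}`, `l(0) = n_l π`,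
`g(0) = n_g π`. The basic case is that of a constant function `ε`; functions `ε` with
`ε 0 = e` are needed to compare families whose initial points differ. -/
def IsPeriodicFamily (p q : ℕ) (ε : ℝ → ℝ) (nl ng : Fin 2)
    (γ : ℝ → ℝ → Fin 4 → ℝ) (T : ℝ → ℝ) : Prop :=
  ((fun μ => γ μ 0 0 - (-resL p q)) =O[𝓝 0] fun μ : ℝ => μ) ∧
  ((fun μ => T μ - 2 * Real.pi * p) =O[𝓝 0] fun μ : ℝ => μ) ∧
  ∃ δ > 0,
    AnalyticOnNhd ℝ ε (Ioo (-δ) δ) ∧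
    AnalyticOnNhd ℝ T (Ioo (-δ) δ) ∧
    (∀ t, AnalyticOnNhd ℝ (fun μ => γ μ t) (Ioo (-δ) δ)) ∧
    ∀ μ ∈ Ioo (-δ) δ, ε μ ∈ Ioo (0 : ℝ) 1 ∧
      IsPeriodicSolution μ (γ μ) (T μ) ∧
      γ μ 0 = initialState p q (ε μ) nl ng (γ μ 0 0)

/-- Uniqueness: for `μ` near `0` and an initial `G` given by an eccentricity `e'` near `e`, there
is at most one periodic solution with `L(0)` near `-(p/q)^{1/3}`, `l(0) = n_l π`, `g(0) = n_g π`
and period near `2πp`. -/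
def FamilyUnique (p q : ℕ) (e : ℝ) (nl ng : Fin 2) : Prop :=
  ∃ ρ > 0, ∀ μ e' : ℝ, |μ| < ρ → |e' - e| < ρ →
    ∀ (z₁ z₂ : ℝ → Fin 4 → ℝ) (T₁ T₂ : ℝ),
      IsPeriodicSolution μ z₁ T₁ → IsPeriodicSolution μ z₂ T₂ →
      z₁ 0 = initialState p q e' nl ng (z₁ 0 0) → z₂ 0 = initialState p q e' nl ng (z₂ 0 0) →
      |z₁ 0 0 - (-resL p q)| < ρ → |z₂ 0 0 - (-resL p q)| < ρ →
      |T₁ - 2 * Real.pi * p| < ρ → |T₂ - 2 * Real.pi * p| < ρ →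
      z₁ = z₂ ∧ T₁ = T₂

/-- The family `γ` with eccentricity `e` is also a family of the type given by `n_l, n_g`: after a
shift `s(μ)` of the time origin, its members satisfy the initial conditions for `n_l, n_g` (angles
modulo `2π`) and an eccentricity `ε(μ)` with `ε(0) = e`. -/
def BelongsTo (p q : ℕ) (e : ℝ) (γ : ℝ → ℝ → Fin 4 → ℝ) (T : ℝ → ℝ) (nl ng : Fin 2) : Prop :=
  ∃ (s ε : ℝ → ℝ) (k m : ℤ), AnalyticAt ℝ s 0 ∧ ε 0 = e ∧
    IsPeriodicFamily p q ε nl ng (fun μ t => γ μ (t + s μ) + angleShift k m) T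

/-- For all small `μ` the orbits of the two families in phase space have no point in common. -/
def DistinctFamilies (γ₁ γ₂ : ℝ → ℝ → Fin 4 → ℝ) : Prop :=
  ∀ᶠ μ in 𝓝 (0 : ℝ), ∀ (t₁ t₂ : ℝ) (k m : ℤ), γ₁ μ t₁ ≠ γ₂ μ t₂ + angleShift k m

/-- Representatives `(n_l, n_g)` of the families: `n_g = 0` and `n_l = i` if `p` is odd, and
`n_l = 0` and `n_g = i` if `p` is even. -/
def familyRep (p : ℕ) (i : Fin 2) : Fin 2 × Fin 2 := if Odd p then (i, 0) else (0, i)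

/-- `M` is the monodromy matrix along `z` over the time `T`: the value at `T` of the fundamental
solution of the variational equation `Z' = DX(z(t)) Z`, `Z(0) = 1`. -/
def IsMonodromy (μ : ℝ) (z : ℝ → Fin 4 → ℝ) (T : ℝ) (M : Matrix (Fin 4) (Fin 4) ℝ) : Prop :=
  ∃ Z : ℝ → Matrix (Fin 4) (Fin 4) ℝ, Z 0 = 1 ∧ Z T = M ∧
    ∀ t i j, HasDerivAt (fun s => Z s i j)
      ((LinearMap.toMatrix' (fderiv ℝ (vectorField μ) (z t)).toLinearMap * Z t) i j) t

/-- The complex eigenvalues of a real matrix, with algebraic multiplicities. -/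
def eigenvalueMultiset (M : Matrix (Fin 4) (Fin 4) ℝ) : Multiset ℂ :=
  (M.map (algebraMap ℝ ℂ)).charpoly.roots

/-- The characteristic multipliers (eigenvalues of the monodromy matrix over one period) of the
members of the family are `1, 1` and `1 ± √(Cμ) + O(μ)`. -/
def MultipliersAsymptotic (γ : ℝ → ℝ → Fin 4 → ℝ) (T : ℝ → ℝ) (C : ℝ) : Prop :=
  ∃ lam₁ lam₂ : ℝ → ℂ,
    (∀ᶠ μ in 𝓝 (0 : ℝ), ∃ M, IsMonodromy μ (γ μ) (T μ) M ∧
      eigenvalueMultiset M = {1, 1, lam₁ μ, lam₂ μ}) ∧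
    ((fun μ => lam₁ μ - (1 + ((C * μ : ℝ) : ℂ) ^ (1 / 2 : ℂ))) =O[𝓝 0] fun μ : ℝ => μ) ∧
    ((fun μ => lam₂ μ - (1 - ((C * μ : ℝ) : ℂ) ^ (1 / 2 : ℂ))) =O[𝓝 0] fun μ : ℝ => μ)

/-- `r / Δ₁` with `Δ₁ = (1 + r² - 2 r cos θ)^{1/2}`. -/
def rOverDelta1 (r θ : ℝ) : ℝ := r / Real.sqrt (1 + r ^ 2 - 2 * r * Real.cos θ)

/-- `r` along the unperturbed orbit as a function of the eccentric anomaly `E`. -/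
def orbitR (p q : ℕ) (e E : ℝ) : ℝ := ((p : ℝ) / q) ^ ((2 : ℝ) / 3) * (1 - e * Real.cos E)

/-- The time `t` along the unperturbed orbit as a function of the eccentric anomaly `E`,
from `n_l π - q t / p = l = E - e sin E`. -/
def orbitTime (p q : ℕ) (e : ℝ) (nl : Fin 2) (E : ℝ) : ℝ :=
  ((nl : ℕ) * Real.pi - (E - e * Real.sin E)) * (p / q)

/-- `θ = ν + g`, with `g = n_g π - t`, along the unperturbed orbit as a function of `E`. -/
def orbitTheta (p q : ℕ) (e : ℝ) (nl ng : Fin 2) (E : ℝ) : ℝ :=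
  trueAnomaly e E + ((ng : ℕ) * Real.pi - orbitTime p q e nl E)

/-- `C(e, p, q) = -6πp² ∫₀^{2π} ((r/Δ₁)_θθ + cos θ / r) dF`, where `E = qF`. -/
def Ccoef (p q : ℕ) (nl ng : Fin 2) (e : ℝ) : ℝ :=
  -6 * Real.pi * (p : ℝ) ^ 2 * ∫ F in (0 : ℝ)..(2 * Real.pi),
    (iteratedDeriv 2 (rOverDelta1 (orbitR p q e (q * F))) (orbitTheta p q e nl ng (q * F))
      + Real.cos (orbitTheta p q e nl ng (q * F)) / orbitR p q e (q * F))

/-- The coefficient of `e ^ n` in the power series of `f` about `e = 0`. -/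
def powerCoeff (f : ℝ → ℝ) (n : ℕ) : ℝ := iteratedDeriv n f 0 / n.factorial

end R3BP

end

open R3BP

/-!
The proof has four parts.

**Periodic solutions.** For `μ = 0` every solution is explicit, and the flow of the equations, with
the fundamental solution of the variational equation, depends analytically on time, initial state
and `μ` near the resonant Kepler orbit (`exists_isFlowOn`, `exists_isFlowNear`). Analyticity of
flows is derived from the analytic implicit function theorem in a space of continuous functions, in
which superposition with an analytic function is an analytic operator (`exists_local_flow`). The
reflection `(L, G, l, g) ↦ (L, G, -l, -g)` reverses time, so a solution that starts at `l ≡ g ≡ 0`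
modulo `π` is periodic if and only if it satisfies two equations after half a period
(`half_period_iff`). They can be solved uniquely for the period and `L(0)`, since the frequency
`1/L³` depends on `L` (`exists_half_period`). This gives existence and uniqueness
(`exists_isFlowFamily`, `familyUnique`).

**Types of families.** A shift of the time origin by half a period changes `(n_l, n_g)` by `(q, p)`
modulo `2` (`IsFlowFamily.belongsTo`). The angle `p l - q g` is almost constant along the solutions
for small `μ`, and it separates the two types (`distinctFamilies`).

**Multipliers.** The monodromy matrix is symplectic and fixes the vector field, so that its spectrum
is determined by its trace (`eigenvalueMultiset_of_symplectic`). The derivative of the trace in `μ`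
is an average of `∂²/∂l²` of the perturbation over the unperturbed orbit
(`IsFlowFamily.fderiv_trace`), and integration by parts in time turns it into an average of
`∂²/∂g²`, which is `C` (`integral_pertHess_two`, `Ccoef_eq`).

**The coefficient near `e = 0`.** The coefficient is `-6πp² K(e exp (iα))`, where `α` depends on
`n_l`, `n_g` and the function `K` is real analytic near `0` in the plane (`Ccoef_eventuallyEq`). It
is invariant under rotations by `2π/(p + q)` (`secularIntegral_rotate`) and has mean zero over
circles about `0` (`mean_secularIntegral`). The trapezoidal rule on a circle is exact for
trigonometric polynomials of low degree, so the sum of a function with mean zero over the vertices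
of a regular `M`-gon is of order `M` in the radius (`isBigO_sum_polygon`). With `M = p + q` this
yields the order of `C`. With `M = 2(p + q)` it shows that the sum of the coefficients of the two
types, whose phases differ by an odd multiple of `π/(p + q)`, is of order `2(p + q)`.
-/

noncomputable section

namespace R3BP

open scoped ContDiff

/-! ### Superposition operators -/

section CompOp

variable {X : Type*} [TopologicalSpace X] [CompactSpace X]
  {E : Type*} [NormedAddCommGroup E] [NormedSpace ℝ E]
  {F : Type*} [NormedAddCommGroup F] [NormedSpace ℝ F]

open Classical in
/-- The superposition operator `u ↦ f ∘ u` on continuous functions, with the junk value `0` where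
`f ∘ u` is not continuous. -/
def compOp {A B : Type*} [TopologicalSpace A] [TopologicalSpace B] [Zero B] (f : A → B)
    (u : C(X, A)) : C(X, B) :=
  if h : Continuous (f ∘ u) then ⟨f ∘ u, h⟩ else 0

omit [CompactSpace X] in
lemma compOp_apply {A B : Type*} [TopologicalSpace A] [TopologicalSpace B] [Zero B] {f : A → B}
    {u : C(X, A)} (h : Continuous (f ∘ u)) (x : X) : compOp f u x = f (u x) := by
  rw [compOp, dif_pos h]; rfl

/-- A continuous multilinear map acts pointwise on continuous functions. -/
def pointwiseMultilinear {n : ℕ} (p : E [×n]→L[ℝ] F) : C(X, E) [×n]→L[ℝ] C(X, F) :=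
  MultilinearMap.mkContinuous
    { toFun := fun h => ⟨fun s => p fun i => h i s, by fun_prop⟩
      map_update_add' := by
        intro _ m i x y
        ext s
        have key : ∀ z : C(X, E), (fun j => (Function.update m i z) j s)
            = Function.update (fun j => m j s) i (z s) := by
          intro z; funext j
          by_cases hj : j = i
          · subst hj; simp
          · simp [hj]
        simp [key]
      map_update_smul' := by
        intro _ m i c x
        ext s
        have key : ∀ z : C(X, E), (fun j => (Function.update m i z) j s)
            = Function.update (fun j => m j s) i (z s) := by
          intro z; funext j
          by_cases hj : j = i
          · subst hj; simp
          · simp [hj]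
        simp [key] }
    ‖p‖ (by
      intro m
      refine (ContinuousMap.norm_le _ (by positivity)).2 fun s => ?_
      refine (p.le_opNorm _).trans ?_
      gcongr with i
      exact (m i).norm_coe_le_norm s)

lemma norm_pointwiseMultilinear_le {n : ℕ} (p : E [×n]→L[ℝ] F) :
    ‖(pointwiseMultilinear p : C(X, E) [×n]→L[ℝ] C(X, F))‖ ≤ ‖p‖ :=
  MultilinearMap.mkContinuous_norm_le _ (norm_nonneg _) _

/-- The superposition operator of an analytic function is analytic at a constant function: its
Taylor series consists of the Taylor coefficients of `f`, acting pointwise. -/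
lemma analyticAt_compOp_const [CompleteSpace F] {f : E → F} {x₀ : E} (hf : AnalyticAt ℝ f x₀) :
    AnalyticAt ℝ (compOp f : C(X, E) → C(X, F)) (ContinuousMap.const X x₀) := by
  obtain ⟨p, r, hp⟩ := hf
  let q : FormalMultilinearSeries ℝ C(X, E) C(X, F) := fun n => pointwiseMultilinear (p n)
  have hq : p.radius ≤ q.radius :=
    FormalMultilinearSeries.radius_le_of_le fun n => norm_pointwiseMultilinear_le (p n)
  refine ⟨q, r, hp.r_le.trans hq, hp.r_pos, fun {y} hy => ?_⟩
  have hys : ∀ s, y s ∈ Metric.eball (0 : E) r := fun s => by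
    rw [mem_eball_zero_iff] at hy ⊢
    refine lt_of_le_of_lt ?_ hy
    rw [enorm_le_iff_norm_le]
    exact y.norm_coe_le_norm s
  have hcont : Continuous (f ∘ (ContinuousMap.const X x₀ + y : C(X, E))) := by
    rw [← continuousOn_univ]
    refine hp.continuousOn.comp (by fun_prop) fun s _ => ?_
    have := hys s
    simp only [ContinuousMap.add_apply, ContinuousMap.const_apply]
    rw [mem_eball_zero_iff] at this
    simpa [Metric.mem_eball, edist_eq_enorm_sub] using this
  have hsum : Summable fun n => q n fun _ => y :=
    q.summable (Metric.eball_subset_eball (hp.r_le.trans hq) hy)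
  have heq : ∑' n, (q n fun _ => y) = compOp f (ContinuousMap.const X x₀ + y) := by
    ext s
    have h1 : HasSum (fun n => (q n fun _ => y) s) ((∑' n, (q n fun _ => y)) s) :=
      ContinuousMap.hasSum_apply hsum.hasSum s
    rw [compOp_apply hcont]
    exact h1.unique (hp.hasSum (hys s))
  rw [← heq]
  exact hsum.hasSum

end CompOp

/-! ### Local flows of analytic vector fields -/

section LocalFlow

variable {E : Type*} [NormedAddCommGroup E] [NormedSpace ℝ E] [CompleteSpace E]

/-- The constant functions, as a continuous linear map. -/
def constCLM (E : Type*) [NormedAddCommGroup E] [NormedSpace ℝ E] :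
    E →L[ℝ] C(Icc (0 : ℝ) 1, E) :=
  LinearMap.mkContinuous
    { toFun := fun x => ContinuousMap.const _ x
      map_add' := fun _ _ => rfl
      map_smul' := fun _ _ => rfl } 1 (fun x => by
        rw [one_mul]
        exact (ContinuousMap.norm_le _ (norm_nonneg _)).2 fun s => le_rfl)

/-- The Volterra operator `w ↦ ∫₀ˢ w` on continuous functions on `[0, 1]`. -/
def volterra (E : Type*) [NormedAddCommGroup E] [NormedSpace ℝ E] :
    C(Icc (0 : ℝ) 1, E) →L[ℝ] C(Icc (0 : ℝ) 1, E) :=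
  LinearMap.mkContinuous
    { toFun := fun w => ⟨fun s => ∫ x in (0 : ℝ)..s, IccExtend zero_le_one w x, by
        have : Continuous fun t : ℝ => ∫ x in (0 : ℝ)..t, IccExtend zero_le_one w x :=
          intervalIntegral.continuous_primitive
            (fun a b => (w.continuous.Icc_extend' (h := zero_le_one)).intervalIntegrable a b) 0
        exact this.comp continuous_subtype_val⟩
      map_add' := fun u v => by
        ext s
        exact intervalIntegral.integral_add
          ((u.continuous.Icc_extend' (h := zero_le_one)).intervalIntegrable _ _)
          ((v.continuous.Icc_extend' (h := zero_le_one)).intervalIntegrable _ _)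
      map_smul' := fun c u => by
        ext s
        exact intervalIntegral.integral_smul c _ } 1 (fun w => by
        rw [one_mul]
        refine (ContinuousMap.norm_le _ (norm_nonneg _)).2 fun s => ?_
        refine (intervalIntegral.norm_integral_le_of_norm_le_const (C := ‖w‖) fun x _ =>
          w.norm_coe_le_norm _).trans ?_
        have h0 := s.2.1
        have h1 := s.2.2
        rw [sub_zero, abs_of_nonneg h0]
        exact mul_le_of_le_one_right (norm_nonneg _) h1)

lemma constCLM_apply {E : Type*} [NormedAddCommGroup E] [NormedSpace ℝ E] (x : E)
    (s : Icc (0 : ℝ) 1) : constCLM E x s = x := rfl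

/-- The local flow of an analytic vector field is analytic jointly in time and initial point. On
the time interval `[0, 1]`, the rescaled solution `u` solves `u = x + τ ∫ f ∘ u`; at `τ = 0` the
derivative of this equation in `u` is the identity, so the analytic implicit function theorem
applies. -/
lemma exists_local_flow {f : E → E} {x₀ : E} (hf : AnalyticAt ℝ f x₀) :
    ∃ Φ : ℝ × E → E, AnalyticAt ℝ Φ (0, x₀) ∧ Φ (0, x₀) = x₀ ∧
      ∃ r > 0, ∃ ε > 0, ∀ x ∈ Metric.ball x₀ r, Φ (0, x) = x ∧
        ∀ t ∈ Ioo (-ε) ε, HasDerivAt (fun t => Φ (t, x)) (f (Φ (t, x))) t := by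
  obtain ⟨ε, hε, a, r, L, K, hr, hpl⟩ :=
    IsPicardLindelof.of_contDiffAt_one (hf.contDiffAt (n := 1))
  obtain ⟨α, hα, hαc⟩ :=
    (hpl 0).exists_forall_mem_closedBall_eq_hasDerivWithinAt_continuousOn
  simp only [zero_sub, zero_add] at hα hαc
  have hr' : (0 : ℝ) < r := hr
  let c₀ : C(Icc (0 : ℝ) 1, E) := ContinuousMap.const (Icc (0 : ℝ) 1) x₀
  -- the integral equation
  let G : (ℝ × E) × C(Icc (0 : ℝ) 1, E) → C(Icc (0 : ℝ) 1, E) := fun v =>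
    v.2 - constCLM E v.1.2 - v.1.1 • volterra E (compOp f v.2)
  have hcomp : AnalyticAt ℝ (compOp f : C(Icc (0 : ℝ) 1, E) → C(Icc (0 : ℝ) 1, E)) c₀ := analyticAt_compOp_const hf
  have hG : AnalyticAt ℝ G ((0, x₀), c₀) := by
    have h1 : AnalyticAt ℝ (fun v : (ℝ × E) × C(Icc (0 : ℝ) 1, E) => compOp f v.2) ((0, x₀), c₀) :=
      AnalyticAt.fun_comp (f := fun v : (ℝ × E) × C(Icc (0 : ℝ) 1, E) => v.2) hcomp analyticAt_snd
    have h2 : AnalyticAt ℝ (fun v : (ℝ × E) × C(Icc (0 : ℝ) 1, E) => volterra E (compOp f v.2))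
        ((0, x₀), c₀) := ((volterra E).analyticAt _).fun_comp h1
    have h3 : AnalyticAt ℝ (fun v : (ℝ × E) × C(Icc (0 : ℝ) 1, E) => constCLM E v.1.2) ((0, x₀), c₀) :=
      ((constCLM E).analyticAt _).fun_comp (analyticAt_snd.fun_comp analyticAt_fst)
    exact (analyticAt_snd.sub h3).sub ((analyticAt_fst.fun_comp analyticAt_fst).smul h2)
  have hGω : ContDiffAt ℝ ω G ((0, x₀), c₀) := hG.contDiffAt
  have hinv : (fderiv ℝ G ((0, x₀), c₀) ∘L .inr ℝ (ℝ × E) C(Icc (0 : ℝ) 1, E)).IsInvertible := by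
    have h1 : HasFDerivAt (fun u : C(Icc (0 : ℝ) 1, E) => G ((0, x₀), u))
        (fderiv ℝ G ((0, x₀), c₀) ∘L .inr ℝ (ℝ × E) C(Icc (0 : ℝ) 1, E)) c₀ :=
      HasFDerivAt.comp (f := fun u : C(Icc (0 : ℝ) 1, E) => (((0 : ℝ), x₀), u)) c₀
        hG.differentiableAt.hasFDerivAt (hasFDerivAt_prodMk_right _ _)
    have h2 : HasFDerivAt (fun u : C(Icc (0 : ℝ) 1, E) => G ((0, x₀), u))
        (ContinuousLinearMap.id ℝ C(Icc (0 : ℝ) 1, E)) c₀ := by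
      have : (fun u : C(Icc (0 : ℝ) 1, E) => G ((0, x₀), u)) = fun u => u - constCLM E x₀ := by
        funext u; simp [G]
      rw [this]
      exact (hasFDerivAt_id c₀).sub_const _
    rw [h1.unique h2]
    exact ContinuousLinearMap.isInvertible_equiv (f := ContinuousLinearEquiv.refl ℝ C(Icc (0 : ℝ) 1, E))
  have hG0 : G ((0, x₀), c₀) = 0 := by
    ext s
    simp [G, c₀, constCLM_apply]
  -- the rescaled Picard-Lindelöf solutions solve it
  let u : ℝ × E → C(Icc (0 : ℝ) 1, E) := fun v => compOp (fun s : ℝ => α (v.2, v.1 * s)) ⟨(↑), by fun_prop⟩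
  have hmem : ∀ {τ : ℝ}, |τ| < ε → ∀ {s : ℝ}, s ∈ Icc (0 : ℝ) 1 → τ * s ∈ Ioo (-ε) ε := by
    intro τ hτ s hs
    rw [mem_Ioo, ← abs_lt, abs_mul, abs_of_nonneg hs.1]
    exact lt_of_le_of_lt (mul_le_of_le_one_right (abs_nonneg _) hs.2) hτ
  have hder : ∀ x ∈ Metric.closedBall x₀ r, ∀ t ∈ Ioo (-ε) ε,
      HasDerivAt (fun t => α (x, t)) (f (α (x, t))) t := fun x hx t ht =>
    ((hα x hx).2 t (Ioo_subset_Icc_self ht)).hasDerivAt (Icc_mem_nhds ht.1 ht.2)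
  have hus : ∀ v : ℝ × E, |v.1| < ε → v.2 ∈ Metric.closedBall x₀ r → ∀ s : Icc (0 : ℝ) 1,
      u v s = α (v.2, v.1 * s) := by
    intro v hv hx s
    refine compOp_apply (f := fun s : ℝ => α (v.2, v.1 * s)) ?_ s
    refine continuous_iff_continuousAt.2 fun s => ?_
    have h1 := (hder v.2 hx (v.1 * s) (hmem hv s.2)).continuousAt
    exact ContinuousAt.comp (g := fun t => α (v.2, t)) (f := fun s : Icc (0 : ℝ) 1 => v.1 * (s : ℝ)) h1
      (by fun_prop)
  have hα0 : ∀ x ∈ Metric.closedBall x₀ r, α (x, 0) = x := fun x hx => (hα x hx).1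
  have hx₀ : x₀ ∈ Metric.closedBall x₀ (r : ℝ) := Metric.mem_closedBall_self hr'.le
  have hcα : ContinuousAt α (x₀, 0) :=
    hαc.continuousAt (prod_mem_nhds (Metric.closedBall_mem_nhds _ hr')
      (Icc_mem_nhds (by linarith) hε))
  -- uniform closeness to the constant solution
  have hclose : ∀ η > 0, ∃ δ > 0, δ ≤ ε ∧ δ ≤ r ∧ ∀ x t, dist x x₀ < δ → |t| < δ →
      dist (α (x, t)) x₀ < η := by
    intro η hη
    have := Metric.continuousAt_iff.1 hcα η hη
    obtain ⟨δ, hδ, h⟩ := this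
    refine ⟨min δ (min ε r), by positivity, by simp, by simp, fun x t hx ht => ?_⟩
    have h' := h (x := (x, t)) (by
      rw [Prod.dist_eq, max_lt_iff]
      exact ⟨lt_of_lt_of_le hx (min_le_left _ _), by
        simpa using lt_of_lt_of_le ht (min_le_left _ _)⟩)
    rwa [hα0 x₀ hx₀] at h'
  have hutend : Tendsto (fun v : ℝ × E => (v, u v)) (𝓝 (0, x₀)) (𝓝 ((0, x₀), c₀)) := by
    refine Tendsto.prodMk_nhds tendsto_id ?_
    rw [Metric.tendsto_nhds]
    intro η hη
    obtain ⟨δ, hδ, hδε, hδr, h⟩ := hclose (η / 2) (by positivity)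
    filter_upwards [Metric.ball_mem_nhds ((0 : ℝ), x₀) hδ] with v hv
    rw [Metric.mem_ball, Prod.dist_eq, max_lt_iff] at hv
    have hv1 : |v.1| < δ := by simpa using hv.1
    refine lt_of_le_of_lt ((ContinuousMap.dist_le (by positivity)).2 fun s => ?_)
      (half_lt_self hη)
    rw [hus v (hv1.trans_le hδε) (Metric.mem_closedBall.2 (hv.2.le.trans hδr))]
    refine (h _ _ hv.2 ?_).le
    rw [abs_mul, abs_of_nonneg s.2.1]
    exact lt_of_le_of_lt (mul_le_of_le_one_right (abs_nonneg _) s.2.2) hv1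
  obtain ⟨δ₁, hδ₁, hδ₁ε, hδ₁r, h₁⟩ :
      ∃ δ > 0, δ ≤ ε ∧ δ ≤ r ∧ ∀ x t, dist x x₀ < δ → |t| < δ → AnalyticAt ℝ f (α (x, t)) := by
    obtain ⟨η, hη, hηa⟩ := Metric.eventually_nhds_iff.1 hf.eventually_analyticAt
    obtain ⟨δ, hδ, h2, h3, h⟩ := hclose η hη
    exact ⟨δ, hδ, h2, h3, fun x t hx ht => hηa (h x t hx ht)⟩
  have hGu : ∀ᶠ v in 𝓝 ((0 : ℝ), x₀), G (v, u v) = G ((0, x₀), c₀) := by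
    filter_upwards [Metric.ball_mem_nhds ((0 : ℝ), x₀) hδ₁] with v hv
    rw [Metric.mem_ball, Prod.dist_eq, max_lt_iff] at hv
    have hv1 : |v.1| < δ₁ := by simpa using hv.1
    have hv2 : v.2 ∈ Metric.closedBall x₀ r := Metric.mem_closedBall.2 (hv.2.le.trans hδ₁r)
    have hsmall : ∀ s ∈ Icc (0 : ℝ) 1, |v.1 * s| < δ₁ := fun s hs => by
      rw [abs_mul, abs_of_nonneg hs.1]
      exact lt_of_le_of_lt (mul_le_of_le_one_right (abs_nonneg _) hs.2) hv1
    have husv := hus v (hv1.trans_le hδ₁ε) hv2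
    have hfu : Continuous (f ∘ (u v)) := by
      refine continuous_iff_continuousAt.2 fun s => ?_
      refine ContinuousAt.comp ?_ (u v).continuous.continuousAt
      rw [husv]
      exact (h₁ _ _ hv.2 (hsmall s s.2)).continuousAt
    rw [hG0]
    ext s
    have hint : ∫ x in (0 : ℝ)..s, v.1 • IccExtend zero_le_one (compOp f (u v)) x
        = α (v.2, v.1 * s) - α (v.2, v.1 * 0) := by
      have hs01 : uIcc (0 : ℝ) s ⊆ Icc 0 1 := by
        rw [uIcc_of_le s.2.1]; exact Icc_subset_Icc_right s.2.2
      refine intervalIntegral.integral_eq_sub_of_hasDerivAt (f := fun x => α (v.2, v.1 * x)) (fun x hx => ?_) ?_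
      · have hx' := hs01 hx
        have hd := hder v.2 hv2 (v.1 * x) (hmem (hv1.trans_le hδ₁ε) hx')
        have := HasDerivAt.scomp (g₁ := fun t => α (v.2, t)) (h := fun x => v.1 * x) x hd
          ((hasDerivAt_id x).const_mul v.1)
        rw [IccExtend_of_mem _ _ hx', compOp_apply hfu, husv]
        simpa [Function.comp_def] using this
      · exact ((compOp f (u v)).continuous.Icc_extend'.const_smul v.1).intervalIntegrable _ _
    rw [intervalIntegral.integral_smul] at hint
    change u v s - _ - v.1 • (∫ x in (0 : ℝ)..s, IccExtend zero_le_one (compOp f (u v)) x) = 0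
    rw [hint, husv, mul_zero, hα0 _ hv2]
    simp [constCLM_apply]
  let one' : Icc (0 : ℝ) 1 := ⟨1, right_mem_Icc.2 zero_le_one⟩
  let ψ := hGω.implicitFunction (by simp) hinv
  have hψ : AnalyticAt ℝ ψ (0, x₀) :=
    (hGω.contDiffAt_implicitFunction (by simp) hinv).analyticAt
  have hψu : ∀ᶠ v in 𝓝 ((0 : ℝ), x₀), ψ v = u v := by
    have h := hutend.eventually (hGω.eventually_apply_eq_iff_implicitFunction (by simp) hinv)
    filter_upwards [h, hGu] with v h1 h2
    exact h1.1 h2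
  refine ⟨fun v => α (v.2, v.1), ?_, hα0 x₀ hx₀, r, hr', ε, hε, fun x hx => ⟨hα0 x ?_, fun t ht =>
    hder x ?_ t ht⟩⟩
  · have h1 : AnalyticAt ℝ (fun v => ContinuousMap.evalCLM ℝ one' (ψ v)) (0, x₀) :=
      (ContinuousLinearMap.analyticAt (ContinuousMap.evalCLM ℝ one') _).fun_comp hψ
    refine h1.congr ?_
    filter_upwards [hψu, Metric.ball_mem_nhds ((0 : ℝ), x₀) hδ₁] with v hv hv'
    rw [Metric.mem_ball, Prod.dist_eq, max_lt_iff] at hv'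
    have hv1 : |v.1| < δ₁ := by simpa using hv'.1
    rw [hv]
    have := hus v (hv1.trans_le hδ₁ε) (Metric.mem_closedBall.2 (hv'.2.le.trans hδ₁r)) one'
    simpa [one'] using this
  · exact Metric.ball_subset_closedBall hx
  · exact Metric.ball_subset_closedBall hx

end LocalFlow

/-! ### Analytic dependence on initial conditions and parameters -/

section Flow

variable {E : Type*} [NormedAddCommGroup E] [NormedSpace ℝ E]

lemma hasDerivAt_fst {F : Type*} [NormedAddCommGroup F] [NormedSpace ℝ F] {u : ℝ → E × F}
    {u' : E × F} {t : ℝ} (h : HasDerivAt u u' t) : HasDerivAt (fun t => (u t).1) u'.1 t :=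
  (hasFDerivAt_fst (𝕜 := ℝ) (p := u t)).comp_hasDerivAt t h

lemma hasDerivAt_snd {F : Type*} [NormedAddCommGroup F] [NormedSpace ℝ F] {u : ℝ → E × F}
    {u' : E × F} {t : ℝ} (h : HasDerivAt u u' t) : HasDerivAt (fun t => (u t).2) u'.2 t :=
  (hasFDerivAt_snd (𝕜 := ℝ) (p := u t)).comp_hasDerivAt t h

lemma eq_of_hasDerivAt_zero {u : ℝ → E} {a b : ℝ} (hu : ∀ t ∈ Ioo a b, HasDerivAt u 0 t)
    {s t : ℝ} (hs : s ∈ Ioo a b) (ht : t ∈ Ioo a b) : u s = u t :=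
  isOpen_Ioo.is_const_of_deriv_eq_zero isPreconnected_Ioo
    (fun x hx => (hu x hx).differentiableAt.differentiableWithinAt)
    (fun x hx => (hu x hx).deriv) hs ht

/-- `u` is a solution of `u' = f(u)` with values in `U` on the open interval `(a, b)`. -/
def SolvesOn (f : E → E) (U : Set E) (u : ℝ → E) (a b : ℝ) : Prop :=
  ∀ t ∈ Ioo a b, u t ∈ U ∧ HasDerivAt u (f (u t)) t

lemma SolvesOn.mono {f : E → E} {U : Set E} {u : ℝ → E} {a b a' b' : ℝ}
    (h : SolvesOn f U u a b) (ha : a ≤ a') (hb : b' ≤ b) : SolvesOn f U u a' b' :=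
  fun t ht => h t ⟨ha.trans_lt ht.1, ht.2.trans_le hb⟩

/-- Solutions of an autonomous `C¹` differential equation on an interval that agree at one time
agree. -/
lemma SolvesOn.eqOn {f : E → E} {U : Set E} (hf : ∀ x ∈ U, ContDiffAt ℝ 1 f x)
    {u v : ℝ → E} {a b t₀ : ℝ} (hu : SolvesOn f U u a b) (hv : SolvesOn f U v a b)
    (ht₀ : t₀ ∈ Ioo a b) (h : u t₀ = v t₀) : EqOn u v (Ioo a b) := by
  have key : ∀ t ∈ Ioo a b, u t = v t → u =ᶠ[𝓝 t] v := by
    intro t ht huv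
    obtain ⟨K, s, hs, hl⟩ := (hf _ (hu t ht).1).exists_lipschitzOnWith
    refine ODE_solution_unique_of_eventually (v := fun _ => f) (s := fun _ => s)
      (Eventually.of_forall fun _ => hl) ?_ ?_ huv
    · filter_upwards [isOpen_Ioo.mem_nhds ht, (hu t ht).2.continuousAt hs] with τ h1 h2
      exact ⟨(hu τ h1).2, h2⟩
    · rw [huv] at hs
      filter_upwards [isOpen_Ioo.mem_nhds ht, (hv t ht).2.continuousAt hs] with τ h1 h2
      exact ⟨(hv τ h1).2, h2⟩
  have hO : IsOpen {t | u =ᶠ[𝓝 t] v} := isOpen_setOfPred_eventually_nhds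
  have hsub : Ioo a b ⊆ {t | u =ᶠ[𝓝 t] v} := by
    refine isPreconnected_Ioo.subset_of_closure_inter_subset hO ⟨t₀, ht₀, key t₀ ht₀ h⟩ ?_
    rintro t ⟨htc, ht⟩
    refine key t ht ?_
    have hfr : ∃ᶠ τ in 𝓝 t, u τ = v τ := by
      rw [mem_closure_iff_frequently] at htc
      exact htc.mono fun τ hτ => Filter.EventuallyEq.eq_of_nhds hτ
    have hc : Tendsto (fun τ => u τ - v τ) (𝓝 t) (𝓝 (u t - v t)) :=
      (hu t ht).2.continuousAt.sub (hv t ht).2.continuousAt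
    by_contra hne
    have := hc.eventually_ne (sub_ne_zero.2 hne)
    obtain ⟨τ, h1, h2⟩ := (hfr.and_eventually this).exists
    exact h2 (sub_eq_zero.2 h1)
  exact fun t ht => Filter.EventuallyEq.eq_of_nhds (hsub ht)

/-- On the ball of radius `ε` about `x₀` and the time interval `(a, b)`, `Φ` is analytic jointly in
time and space, and its time lines solve `u' = f(u)` in `U`. -/
def IsFlowOn (f : E → E) (U : Set E) (Φ : ℝ × E → E) (x₀ : E) (ε a b : ℝ) : Prop :=
  ∀ x ∈ Metric.ball x₀ ε, SolvesOn f U (fun t => Φ (t, x)) a b ∧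
    ∀ t ∈ Ioo a b, AnalyticAt ℝ Φ (t, x)

lemma IsFlowOn.mono {f : E → E} {U : Set E} {Φ : ℝ × E → E} {x₀ : E} {ε a b ε' a' b' : ℝ}
    (h : IsFlowOn f U Φ x₀ ε a b) (hε : ε' ≤ ε) (ha : a ≤ a') (hb : b' ≤ b) :
    IsFlowOn f U Φ x₀ ε' a' b' := fun x hx =>
  have h' := h x (Metric.ball_subset_ball hε hx)
  ⟨h'.1.mono ha hb, fun t ht => h'.2 t ⟨ha.trans_lt ht.1, ht.2.trans_le hb⟩⟩

/-- Two flows that agree at a common time `c` can be glued. -/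
lemma IsFlowOn.glue {f : E → E} {U : Set E} (hf : ∀ x ∈ U, ContDiffAt ℝ 1 f x)
    {Φ₁ Φ₂ : ℝ × E → E} {x₀ : E} {ε a₁ b₁ a₂ b₂ c : ℝ}
    (h₁ : IsFlowOn f U Φ₁ x₀ ε a₁ b₁) (h₂ : IsFlowOn f U Φ₂ x₀ ε a₂ b₂)
    (hc₁ : c ∈ Ioo a₁ b₁) (hc₂ : c ∈ Ioo a₂ b₂)
    (hc : ∀ x ∈ Metric.ball x₀ ε, Φ₁ (c, x) = Φ₂ (c, x)) :
    ∃ Φ : ℝ × E → E, IsFlowOn f U Φ x₀ ε a₁ b₂ ∧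
      (∀ x ∈ Metric.ball x₀ ε, ∀ t ≤ c, Φ (t, x) = Φ₁ (t, x)) ∧
      ∀ x ∈ Metric.ball x₀ ε, ∀ t, c ≤ t → Φ (t, x) = Φ₂ (t, x) := by
  classical
  have hagree : ∀ x ∈ Metric.ball x₀ ε, ∀ t ∈ Ioo (max a₁ a₂) (min b₁ b₂),
      Φ₁ (t, x) = Φ₂ (t, x) := fun x hx =>
    ((h₁ x hx).1.mono (le_max_left _ _) (min_le_left _ _)).eqOn hf
      ((h₂ x hx).1.mono (le_max_right _ _) (min_le_right _ _))
      ⟨max_lt hc₁.1 hc₂.1, lt_min hc₁.2 hc₂.2⟩ (hc x hx)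
  let Φ : ℝ × E → E := fun v => if v.1 < c then Φ₁ v else Φ₂ v
  have hΦ₁ : ∀ x ∈ Metric.ball x₀ ε, ∀ t < min b₁ b₂, (t ≤ c ∨ max a₁ a₂ < t) →
      Φ (t, x) = Φ₁ (t, x) := by
    intro x hx t ht h
    by_cases htc : t < c
    · simp [Φ, htc]
    · have h' : t ∈ Ioo (max a₁ a₂) (min b₁ b₂) :=
        ⟨h.elim (fun h => by rw [le_antisymm h (not_lt.1 htc)]; exact max_lt hc₁.1 hc₂.1) id, ht⟩
      simp [Φ, htc, hagree x hx t h']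
  refine ⟨Φ, fun x hx => ?_, fun x hx t ht => hΦ₁ x hx t
    (ht.trans_lt (lt_min hc₁.2 hc₂.2)) (Or.inl ht), fun x hx t ht => by simp [Φ, not_lt.2 ht]⟩
  have main : ∀ t ∈ Ioo a₁ b₂, ∃ Ψ : ℝ × E → E, Φ =ᶠ[𝓝 (t, x)] Ψ ∧ AnalyticAt ℝ Ψ (t, x) ∧
      Ψ (t, x) ∈ U ∧ HasDerivAt (fun t => Ψ (t, x)) (f (Ψ (t, x))) t := by
    intro t ht
    have hball : ∀ᶠ v in 𝓝 (t, x), v.2 ∈ Metric.ball x₀ ε :=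
      continuousAt_snd (Metric.isOpen_ball.mem_nhds hx)
    rcases lt_or_ge t (min b₁ b₂) with h | h
    · by_cases h' : t ≤ c ∨ max a₁ a₂ < t
      · have ht' : t ∈ Ioo a₁ b₁ := ⟨ht.1, h.trans_le (min_le_left _ _)⟩
        refine ⟨Φ₁, ?_, (h₁ x hx).2 t ht', ((h₁ x hx).1 t ht').1, ((h₁ x hx).1 t ht').2⟩
        have hlt : ∀ᶠ v in 𝓝 (t, x), v.1 < min b₁ b₂ ∧ (v.1 ≤ c ∨ max a₁ a₂ < v.1) := by
          have e1 : ∀ᶠ s in 𝓝 t, s < min b₁ b₂ ∧ (s ≤ c ∨ max a₁ a₂ < s) := by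
            refine (eventually_lt_nhds h).and ?_
            rcases h' with h' | h'
            · rcases lt_or_eq_of_le h' with h'' | h''
              · exact (eventually_lt_nhds h'').mono fun s hs => Or.inl hs.le
              · have : max a₁ a₂ < t := h'' ▸ max_lt hc₁.1 hc₂.1
                exact (eventually_gt_nhds this).mono fun s hs => Or.inr hs
            · exact (eventually_gt_nhds h').mono fun s hs => Or.inr hs
          exact (continuousAt_fst (p := (t, x))).eventually e1
        filter_upwards [hball, hlt] with v hv1 hv2
        exact hΦ₁ v.2 hv1 v.1 hv2.1 hv2.2
      · push Not at h'
        exact absurd h'.2 (not_le.2 ((max_lt hc₁.1 hc₂.1).trans h'.1))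
    · have htc : c < t := (lt_min hc₁.2 hc₂.2).trans_le h
      have ht' : t ∈ Ioo a₂ b₂ := ⟨hc₂.1.trans htc, ht.2⟩
      refine ⟨Φ₂, ?_, (h₂ x hx).2 t ht', ((h₂ x hx).1 t ht').1, ((h₂ x hx).1 t ht').2⟩
      filter_upwards [continuousAt_fst.eventually (eventually_gt_nhds htc)] with v hv
      simp [Φ, not_lt.2 (le_of_lt hv)]
  refine ⟨fun t ht => ?_, fun t ht => ?_⟩
  · obtain ⟨Ψ, h1, h2, h3, h4⟩ := main t ht
    change Φ (t, x) ∈ U ∧ HasDerivAt (fun t => Φ (t, x)) (f (Φ (t, x))) t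
    rw [h1.eq_of_nhds]
    refine ⟨h3, h4.congr_of_eventuallyEq ?_⟩
    have hcont : ContinuousAt (fun s : ℝ => (s, x)) t := by fun_prop
    exact hcont.eventually h1
  · obtain ⟨Ψ, h1, h2, h3, h4⟩ := main t ht
    exact h2.congr h1.symm

variable [CompleteSpace E]

lemma exists_isFlowOn_local {f : E → E} {U : Set E} (hU : IsOpen U)
    (hf : ∀ x ∈ U, AnalyticAt ℝ f x) {x₀ : E} (hx₀ : x₀ ∈ U) :
    ∃ ε > 0, ∃ Φ : ℝ × E → E, IsFlowOn f U Φ x₀ ε (-ε) ε ∧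
      ∀ x ∈ Metric.ball x₀ ε, Φ (0, x) = x := by
  obtain ⟨Φ, hΦ, hΦ0, r, hr, ε, hε, h⟩ := exists_local_flow (hf x₀ hx₀)
  have hev : ∀ᶠ v in 𝓝 ((0 : ℝ), x₀), AnalyticAt ℝ Φ v ∧ Φ v ∈ U :=
    hΦ.eventually_analyticAt.and (hΦ.continuousAt (by rw [hΦ0]; exact hU.mem_nhds hx₀))
  obtain ⟨η, hη, hη'⟩ := Metric.eventually_nhds_iff.1 hev
  refine ⟨min η (min r ε), by positivity, Φ, fun x hx => ?_, fun x hx =>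
    (h x (Metric.ball_subset_ball (by simp) hx)).1⟩
  have hx' := h x (Metric.ball_subset_ball (by simp) hx)
  have hηt : ∀ t ∈ Ioo (-min η (min r ε)) (min η (min r ε)), AnalyticAt ℝ Φ (t, x) ∧
      Φ (t, x) ∈ U := by
    intro t ht
    refine hη' ?_
    rw [Prod.dist_eq, max_lt_iff]
    refine ⟨?_, lt_of_lt_of_le hx (min_le_left _ _)⟩
    have ht := abs_lt.2 ht
    simpa using lt_of_lt_of_le ht (min_le_left _ _)
  refine ⟨fun t ht => ⟨(hηt t ht).2, hx'.2 t ?_⟩, fun t ht => (hηt t ht).1⟩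
  have : min η (min r ε) ≤ ε := (min_le_right _ _).trans (min_le_right _ _)
  exact ⟨by linarith [ht.1], by linarith [ht.2]⟩

/-- The flow near a solution on `[0, b)` exists, and is analytic, up to any time `T < b`. -/
lemma exists_isFlowOn_forward {f : E → E} {U : Set E} (hU : IsOpen U)
    (hf : ∀ x ∈ U, AnalyticAt ℝ f x) {u : ℝ → E} {a b : ℝ} (ha : a < 0)
    (hu : SolvesOn f U u a b) {T : ℝ} (hT0 : 0 ≤ T) (hTb : T < b) :
    ∃ ε > 0, ∃ Φ : ℝ × E → E, IsFlowOn f U Φ (u 0) ε (-ε) (T + ε) ∧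
      ∀ x ∈ Metric.ball (u 0) ε, Φ (0, x) = x := by
  have hf1 : ∀ x ∈ U, ContDiffAt ℝ 1 f x := fun x hx => (hf x hx).contDiffAt
  let Good : ℝ → Prop := fun T => ∃ ε > 0, ∃ Φ : ℝ × E → E,
    IsFlowOn f U Φ (u 0) ε (-ε) (T + ε) ∧ ∀ x ∈ Metric.ball (u 0) ε, Φ (0, x) = x
  have hmono : ∀ T T', T' ≤ T → Good T → Good T' := by
    rintro T T' hTT ⟨ε, hε, Φ, h1, h2⟩
    exact ⟨ε, hε, Φ, h1.mono le_rfl le_rfl (by linarith), h2⟩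
  have hstep : ∀ T, 0 ≤ T → T < b → ∃ η > 0, ∀ T', T - η < T' → T' ≤ T → 0 ≤ T' →
      Good T' → Good (T + η) := by
    intro T hT0 hTb
    have hT : T ∈ Ioo a b := ⟨ha.trans_le hT0, hTb⟩
    obtain ⟨ε', hε', ψ, hψ, hψ0⟩ := exists_isFlowOn_local hU hf (hu T hT).1
    obtain ⟨η, hη, hηu⟩ := Metric.continuousAt_iff.1 (hu T hT).2.continuousAt ε' hε'
    refine ⟨min η (ε' / 4), by positivity, fun T' hT'1 hT'2 hT'0 hG => ?_⟩
    have hη1 : min η (ε' / 4) ≤ η := min_le_left _ _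
    have hη2 : min η (ε' / 4) ≤ ε' / 4 := min_le_right _ _
    obtain ⟨ε, hε, Φ, hΦ, hΦ0⟩ := hG
    have hu0 : u 0 ∈ Metric.ball (u 0) ε := Metric.mem_ball_self hε
    have hT'mem : T' ∈ Ioo (-ε) (T' + ε) := ⟨by linarith, by linarith⟩
    have hΦu : Φ (T', u 0) = u T' := by
      refine SolvesOn.eqOn hf1 (a := max (-ε) a) (b := min (T' + ε) b) (t₀ := 0)
        ((hΦ _ hu0).1.mono (le_max_left _ _) (min_le_left _ _))
        (hu.mono (le_max_right _ _) (min_le_right _ _))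
        ⟨max_lt (by linarith) ha, lt_min (by linarith) (by linarith)⟩ (hΦ0 _ hu0)
        ⟨max_lt (by linarith) (by linarith), lt_min (by linarith) (by linarith)⟩
    have hin : Φ (T', u 0) ∈ Metric.ball (u T) ε' := by
      rw [hΦu]
      refine hηu ?_
      rw [Real.dist_eq, abs_lt]
      constructor <;> linarith
    have hcont : ContinuousAt (fun x => Φ (T', x)) (u 0) :=
      ContinuousAt.comp (f := fun x => (T', x)) ((hΦ _ hu0).2 T' hT'mem).continuousAt
        (by fun_prop)
    obtain ⟨ε₂, hε₂, hball⟩ := Metric.eventually_nhds_iff.1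
      (hcont.eventually (Metric.isOpen_ball.mem_nhds hin))
    let ε₃ := min ε (min ε₂ (ε' / 4))
    have hε₃ : 0 < ε₃ := by positivity
    have hε₃1 : ε₃ ≤ ε := min_le_left _ _
    have hε₃2 : ε₃ ≤ ε₂ := (min_le_right _ _).trans (min_le_left _ _)
    have hε₃3 : ε₃ ≤ ε' / 4 := (min_le_right _ _).trans (min_le_right _ _)
    have h2 : IsFlowOn f U (fun v => ψ (v.1 - T', Φ (T', v.2))) (u 0) ε₃
        (T' - ε') (T' + ε') := by
      intro x hx
      have hx2 : Φ (T', x) ∈ Metric.ball (u T) ε' := hball (lt_of_lt_of_le hx hε₃2)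
      have hψx := hψ _ hx2
      refine ⟨fun t ht => ?_, fun t ht => ?_⟩
      · have ht' : t - T' ∈ Ioo (-ε') ε' := ⟨by linarith [ht.1], by linarith [ht.2]⟩
        exact ⟨(hψx.1 _ ht').1, HasDerivAt.comp_sub_const t T' (hψx.1 _ ht').2⟩
      · have ht' : t - T' ∈ Ioo (-ε') ε' := ⟨by linarith [ht.1], by linarith [ht.2]⟩
        have hΦa : AnalyticAt ℝ (fun v : ℝ × E => Φ (T', v.2)) (t, x) :=
          AnalyticAt.fun_comp (f := fun v : ℝ × E => (T', v.2))
            ((hΦ x (Metric.ball_subset_ball hε₃1 hx)).2 T' hT'mem)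
            (analyticAt_const.prod analyticAt_snd)
        exact AnalyticAt.fun_comp (f := fun v : ℝ × E => (v.1 - T', Φ (T', v.2)))
          (hψx.2 _ ht') ((analyticAt_fst.sub analyticAt_const).prod hΦa)
    obtain ⟨Ξ, hΞ, hΞ1, -⟩ := IsFlowOn.glue hf1 (c := T')
      (hΦ.mono hε₃1 le_rfl le_rfl) h2 hT'mem ⟨by linarith, by linarith⟩ (fun x hx => by
        have hx2 : Φ (T', x) ∈ Metric.ball (u T) ε' := hball (lt_of_lt_of_le hx hε₃2)
        simp [hψ0 _ hx2])
    refine ⟨ε₃, hε₃, Ξ, hΞ.mono le_rfl (by linarith) (by linarith), fun x hx => ?_⟩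
    rw [hΞ1 x hx 0 hT'0, hΦ0 x (Metric.ball_subset_ball hε₃1 hx)]
  have h0 : Good 0 := by
    obtain ⟨ε, hε, Φ, h1, h2⟩ := exists_isFlowOn_local hU hf (hu 0 ⟨ha, hT0.trans_lt hTb⟩).1
    exact ⟨ε, hε, Φ, by simpa using h1, h2⟩
  let S : Set ℝ := {t | t ∈ Icc 0 T ∧ Good t}
  have hS0 : (0 : ℝ) ∈ S := ⟨⟨le_rfl, hT0⟩, h0⟩
  have hSb : BddAbove S := ⟨T, fun t ht => ht.1.2⟩
  have hσ0 : 0 ≤ sSup S := le_csSup hSb hS0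
  have hσT : sSup S ≤ T := csSup_le ⟨0, hS0⟩ fun t ht => ht.1.2
  obtain ⟨η, hη, hst⟩ := hstep (sSup S) hσ0 (hσT.trans_lt hTb)
  obtain ⟨T', hT'S, hT'⟩ := exists_lt_of_lt_csSup ⟨0, hS0⟩ (show sSup S - η < sSup S by linarith)
  have hG := hst T' hT' (le_csSup hSb hT'S) hT'S.1.1 hT'S.2
  have hmin : min (sSup S + η) T ∈ S :=
    ⟨⟨le_min (by linarith) hT0, min_le_right _ _⟩, hmono _ _ (min_le_left _ _) hG⟩
  have := le_csSup hSb hmin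
  rcases min_le_iff.1 this with h | h
  · linarith
  · exact hmono _ _ (by linarith) hG

/-- **Analytic dependence on initial conditions.** Near a solution `u` on `(a, b) ∋ 0`, the flow
of an analytic vector field exists on any smaller compact interval, and is analytic jointly in time
and initial point. -/
theorem exists_isFlowOn {f : E → E} {U : Set E} (hU : IsOpen U)
    (hf : ∀ x ∈ U, AnalyticAt ℝ f x) {u : ℝ → E} {a b : ℝ}
    (hu : SolvesOn f U u a b) {a' b' : ℝ} (haa' : a < a') (ha' : a' ≤ 0) (hb' : 0 ≤ b')
    (hb'b : b' < b) :
    ∃ ε > 0, ∃ Φ : ℝ × E → E, IsFlowOn f U Φ (u 0) ε a' b' ∧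
      ∀ x ∈ Metric.ball (u 0) ε, Φ (0, x) = x := by
  have hf1 : ∀ x ∈ U, ContDiffAt ℝ 1 f x := fun x hx => (hf x hx).contDiffAt
  obtain ⟨ε₁, hε₁, Φ₁, h₁, h₁0⟩ :=
    exists_isFlowOn_forward hU hf (haa'.trans_le ha') hu hb' hb'b
  have hurev : SolvesOn (fun x => -f x) U (fun t => u (-t)) (-b) (-a) := fun t ht => by
    have ht' : -t ∈ Ioo a b := ⟨by linarith [ht.2], by linarith [ht.1]⟩
    refine ⟨(hu _ ht').1, ?_⟩
    have := HasDerivAt.scomp t (hu _ ht').2 (hasDerivAt_neg t)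
    simpa [Function.comp_def] using this
  obtain ⟨ε₂, hε₂, Φ₂, h₂, h₂0⟩ := exists_isFlowOn_forward (f := fun x => -f x)
    (u := fun t => u (-t)) hU (fun x hx => (hf x hx).neg) (show -b < 0 by linarith) hurev
    (show 0 ≤ -a' by linarith) (show -a' < -a by linarith)
  simp only [neg_zero] at h₂ h₂0
  let ε := min ε₁ ε₂
  have hε : 0 < ε := lt_min hε₁ hε₂
  have h₂' : IsFlowOn f U (fun v => Φ₂ (-v.1, v.2)) (u 0) ε (a' - ε) ε := by
    intro x hx
    have h := h₂ x (Metric.ball_subset_ball (min_le_right _ _) hx)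
    have hmem : ∀ t ∈ Ioo (a' - ε) ε, -t ∈ Ioo (-ε₂) (-a' + ε₂) := fun t ht => by
      have : ε ≤ ε₂ := min_le_right _ _
      exact ⟨by linarith [ht.2], by linarith [ht.1]⟩
    refine ⟨fun t ht => ⟨(h.1 _ (hmem t ht)).1, ?_⟩, fun t ht => ?_⟩
    · have := HasDerivAt.scomp t (h.1 _ (hmem t ht)).2 (hasDerivAt_neg t)
      simpa [Function.comp_def] using this
    · exact AnalyticAt.fun_comp (f := fun v : ℝ × E => (-v.1, v.2)) (h.2 _ (hmem t ht))
        (analyticAt_fst.neg.prod analyticAt_snd)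
  obtain ⟨Φ, hΦ, hΦ1, -⟩ := IsFlowOn.glue hf1 (c := 0) h₂'
    (h₁.mono (min_le_left _ _) le_rfl le_rfl) ⟨by linarith, hε⟩ ⟨by linarith, by linarith⟩
    (fun x hx => by
      simp [h₂0 x (Metric.ball_subset_ball (min_le_right _ _) hx),
        h₁0 x (Metric.ball_subset_ball (min_le_left _ _) hx)])
  refine ⟨ε, hε, Φ, hΦ.mono le_rfl (by linarith) (by linarith), fun x hx => ?_⟩
  rw [hΦ1 x hx 0 le_rfl, neg_zero, h₂0 x (Metric.ball_subset_ball (min_le_right _ _) hx)]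

/-- An integral depends analytically on a parameter in which the integrand is analytic. It is read
off from the flow of the system `v' = 0`, `s' = 1`, `y' = g(v, s)`. -/
theorem analyticAt_parametric_integral {F : Type*} [NormedAddCommGroup F] [NormedSpace ℝ F]
    [CompleteSpace F] {g : E × ℝ → F} {v₀ : E} (hg : ∀ s, AnalyticAt ℝ g (v₀, s)) {b : ℝ}
    (hb : 0 ≤ b) : AnalyticAt ℝ (fun v => ∫ s in (0 : ℝ)..b, g (v, s)) v₀ := by
  let f : E × (ℝ × F) → E × (ℝ × F) := fun p => (0, (1, g (p.1, p.2.1)))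
  have hproj : ∀ x : E × (ℝ × F), AnalyticAt ℝ (fun p : E × (ℝ × F) => (p.1, p.2.1)) x :=
    fun x => analyticAt_fst.prod (analyticAt_fst.fun_comp analyticAt_snd)
  let U : Set (E × (ℝ × F)) := {p | AnalyticAt ℝ g (p.1, p.2.1)}
  have hU : IsOpen U := (isOpen_analyticAt ℝ g).preimage (by fun_prop)
  have hf : ∀ x ∈ U, AnalyticAt ℝ f x := fun x hx =>
    analyticAt_const.prod (analyticAt_const.prod (AnalyticAt.fun_comp
      (f := fun p : E × (ℝ × F) => (p.1, p.2.1)) hx (hproj x)))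
  have hgc : Continuous fun s => g (v₀, s) := continuous_iff_continuousAt.2 fun s =>
    ContinuousAt.comp (f := fun s => (v₀, s)) (hg s).continuousAt (by fun_prop)
  let u : ℝ → E × (ℝ × F) := fun t => (v₀, (t, ∫ s in (0 : ℝ)..t, g (v₀, s)))
  have hu : SolvesOn f U u (-2) (b + 2) := fun t _ => ⟨hg t, by
    refine (hasDerivAt_const t v₀).prodMk ((hasDerivAt_id t).prodMk ?_)
    exact intervalIntegral.integral_hasDerivAt_right (hgc.intervalIntegrable _ _)
      (hgc.stronglyMeasurableAtFilter _ _) hgc.continuousAt⟩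
  obtain ⟨ε, hε, Φ, hΦ, hΦ0⟩ := exists_isFlowOn hU hf hu (a' := -1) (b' := b + 1)
    (by norm_num) (by norm_num) (by linarith) (by linarith)
  have hu0 : u 0 = (v₀, (0, 0)) := by simp [u]
  rw [hu0] at hΦ hΦ0
  have hbm : b ∈ Ioo (-1 : ℝ) (b + 1) := ⟨by linarith, by linarith⟩
  have h0m : (0 : ℝ) ∈ Ioo (-1 : ℝ) (b + 1) := ⟨by linarith, by linarith⟩
  have hA : AnalyticAt ℝ (fun v : E => (Φ (b, (v, ((0 : ℝ), (0 : F))))).2.2) v₀ := by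
    have h1 : AnalyticAt ℝ (fun v : E => Φ (b, (v, ((0 : ℝ), (0 : F))))) v₀ :=
      AnalyticAt.fun_comp (f := fun v : E => (b, (v, ((0 : ℝ), (0 : F)))))
        ((hΦ _ (Metric.mem_ball_self hε)).2 b hbm)
        (analyticAt_const.prod (analyticAt_id.prod analyticAt_const))
    exact (analyticAt_snd.fun_comp analyticAt_snd).fun_comp h1
  refine hA.congr ?_
  filter_upwards [Metric.ball_mem_nhds v₀ hε] with v hv
  have hx : (v, ((0 : ℝ), (0 : F))) ∈ Metric.ball (v₀, ((0 : ℝ), (0 : F))) ε := by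
    simpa [Prod.dist_eq, hε] using hv
  set x : E × (ℝ × F) := (v, (0, 0)) with hxdef
  have hs := (hΦ x hx).1
  have hd1 : ∀ t ∈ Ioo (-1 : ℝ) (b + 1), HasDerivAt (fun t => (Φ (t, x)).1) 0 t := fun t ht =>
    hasDerivAt_fst (hs t ht).2
  have hd2 : ∀ t ∈ Ioo (-1 : ℝ) (b + 1), HasDerivAt (fun t => (Φ (t, x)).2) _ t := fun t ht =>
    hasDerivAt_snd (hs t ht).2
  have hd21 : ∀ t ∈ Ioo (-1 : ℝ) (b + 1), HasDerivAt (fun t => (Φ (t, x)).2.1 - t) 0 t :=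
    fun t ht => by
      have := (hasDerivAt_fst (hd2 t ht)).fun_sub (hasDerivAt_id' t)
      simpa [f] using this
  have hd22 : ∀ t ∈ Ioo (-1 : ℝ) (b + 1), HasDerivAt (fun t => (Φ (t, x)).2.2)
      (g ((Φ (t, x)).1, (Φ (t, x)).2.1)) t := fun t ht =>
    hasDerivAt_snd (hd2 t ht)
  have e1 : ∀ t ∈ Ioo (-1 : ℝ) (b + 1), (Φ (t, x)).1 = v := fun t ht => by
    rw [eq_of_hasDerivAt_zero hd1 ht h0m, hΦ0 x hx]
  have e2 : ∀ t ∈ Ioo (-1 : ℝ) (b + 1), (Φ (t, x)).2.1 = t := fun t ht => by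
    have := eq_of_hasDerivAt_zero hd21 ht h0m
    rw [hΦ0 x hx] at this
    simpa [hxdef, sub_eq_zero] using this
  have hsub : uIcc 0 b ⊆ Ioo (-1 : ℝ) (b + 1) := by
    rw [uIcc_of_le hb]
    exact fun t ht => ⟨by linarith [ht.1], by linarith [ht.2]⟩
  have hd22' : ∀ t ∈ uIcc 0 b, HasDerivAt (fun t => (Φ (t, x)).2.2) (g (v, t)) t :=
    fun t ht => by
      have := hd22 t (hsub ht)
      rwa [e1 t (hsub ht), e2 t (hsub ht)] at this
  have hcont : ContinuousOn (fun s => g (v, s)) (uIcc 0 b) := fun t ht => by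
    have h1 : AnalyticAt ℝ g ((Φ (t, x)).1, (Φ (t, x)).2.1) := (hs t (hsub ht)).1
    rw [e1 t (hsub ht), e2 t (hsub ht)] at h1
    exact (ContinuousAt.comp (f := fun s => (v, s)) h1.continuousAt
      (by fun_prop)).continuousWithinAt
  rw [intervalIntegral.integral_eq_sub_of_hasDerivAt hd22' hcont.intervalIntegrable, hΦ0 x hx]
  simp [hxdef]

end Flow

/-! ### Kepler's equation -/

section Kepler

lemma analyticAt_sqrt_comp {E : Type*} [NormedAddCommGroup E] [NormedSpace ℝ E] {f : E → ℝ}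
    {x : E} (hf : AnalyticAt ℝ f x) (hx : f x ≠ 0) : AnalyticAt ℝ (fun y => √(f y)) x :=
  ((hf.contDiffAt (n := ω)).sqrt hx).analyticAt

lemma one_sub_mul_cos_pos {e : ℝ} (he : |e| < 1) (E : ℝ) : 0 < 1 - e * Real.cos E := by
  have h1 : |e * Real.cos E| < 1 := by
    rw [abs_mul]
    exact lt_of_le_of_lt (mul_le_of_le_one_right (abs_nonneg _) (Real.abs_cos_le_one E)) he
  linarith [(abs_lt.1 h1).2]

lemma hasDerivAt_kepler (e E : ℝ) :
    HasDerivAt (fun E : ℝ => E - e * Real.sin E) (1 - e * Real.cos E) E :=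
  (hasDerivAt_id' E).sub ((Real.hasDerivAt_sin E).const_mul e)

lemma kepler_strictMono {e : ℝ} (he : |e| < 1) :
    StrictMono fun E : ℝ => E - e * Real.sin E :=
  strictMono_of_deriv_pos fun E => by
    rw [(hasDerivAt_kepler e E).deriv]
    exact one_sub_mul_cos_pos he E

lemma kepler_surjective {e : ℝ} (he : |e| < 1) :
    Function.Surjective fun E : ℝ => E - e * Real.sin E := by
  have hb : ∀ E : ℝ, |e * Real.sin E| ≤ 1 := fun E => by
    rw [abs_mul]
    exact mul_le_one₀ he.le (abs_nonneg _) (Real.abs_sin_le_one E)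
  refine Continuous.surjective (by fun_prop) ?_ ?_
  · exact tendsto_atTop_mono (fun E => by simp only [id]; linarith [(abs_le.1 (hb E)).2])
      (tendsto_atTop_add_const_right _ (-1 : ℝ) tendsto_id)
  · exact tendsto_atBot_mono (fun E => by simp only [id]; linarith [(abs_le.1 (hb E)).1])
      (tendsto_atBot_add_const_right _ (1 : ℝ) tendsto_id)

/-- The eccentric anomaly of the mean anomaly `E - e sin E` is `E`. -/
lemma eccAnomaly_kepler {e : ℝ} (he : |e| < 1) (E : ℝ) :
    eccAnomaly e (E - e * Real.sin E) = E :=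
  Function.leftInverse_invFun (kepler_strictMono he).injective E

lemma kepler_eccAnomaly {e : ℝ} (he : |e| < 1) (l : ℝ) :
    eccAnomaly e l - e * Real.sin (eccAnomaly e l) = l :=
  Function.rightInverse_invFun (kepler_surjective he) l

lemma eccAnomaly_eq_iff {e : ℝ} (he : |e| < 1) {l E : ℝ} :
    eccAnomaly e l = E ↔ E - e * Real.sin E = l :=
  ⟨fun h => h ▸ kepler_eccAnomaly he l, fun h => h ▸ eccAnomaly_kepler he E⟩

lemma eccAnomaly_add_two_pi {e : ℝ} (he : |e| < 1) (l : ℝ) (k : ℤ) :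
    eccAnomaly e (l + 2 * Real.pi * k) = eccAnomaly e l + 2 * Real.pi * k := by
  rw [eccAnomaly_eq_iff he, mul_comm (2 * Real.pi) (k : ℝ), Real.sin_add_int_mul_two_pi]
  linarith [kepler_eccAnomaly he l]

lemma eccAnomaly_neg {e : ℝ} (he : |e| < 1) (l : ℝ) :
    eccAnomaly e (-l) = -eccAnomaly e l := by
  rw [eccAnomaly_eq_iff he, Real.sin_neg]
  linarith [kepler_eccAnomaly he l]

lemma analyticAt_eccAnomaly {e l : ℝ} (he : |e| < 1) :
    AnalyticAt ℝ (fun v : ℝ × ℝ => eccAnomaly v.1 v.2) (e, l) := by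
  let G : (ℝ × ℝ) × ℝ → ℝ := fun v => v.2 - v.1.1 * Real.sin v.2 - v.1.2
  let E := eccAnomaly e l
  have hG : ContDiffAt ℝ ω G ((e, l), E) := by
    have : ContDiff ℝ ω G := by
      have hs : ContDiff ℝ ω fun v : (ℝ × ℝ) × ℝ => Real.sin v.2 :=
        Real.contDiff_sin.comp contDiff_snd
      have h1 : ContDiff ℝ ω fun v : (ℝ × ℝ) × ℝ => v.1.1 := contDiff_fst.comp contDiff_fst
      have h2 : ContDiff ℝ ω fun v : (ℝ × ℝ) × ℝ => v.1.2 := contDiff_snd.comp contDiff_fst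
      exact (contDiff_snd.sub (h1.mul hs)).sub h2
    exact this.contDiffAt
  have hpos := one_sub_mul_cos_pos he E
  have hinv : (fderiv ℝ G ((e, l), E) ∘L .inr ℝ (ℝ × ℝ) ℝ).IsInvertible := by
    have h1 : HasFDerivAt (fun u : ℝ => G ((e, l), u))
        (fderiv ℝ G ((e, l), E) ∘L .inr ℝ (ℝ × ℝ) ℝ) E :=
      HasFDerivAt.comp (f := fun u : ℝ => (((e, l) : ℝ × ℝ), u)) E
        (hG.differentiableAt (by simp)).hasFDerivAt (hasFDerivAt_prodMk_right _ _)
    have h2 : HasDerivAt (fun u : ℝ => G ((e, l), u)) (1 - e * Real.cos E) E :=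
      (hasDerivAt_kepler e E).sub_const l
    rw [h1.unique h2.hasFDerivAt]
    refine ContinuousLinearMap.IsInvertible.of_inverse
      (g := ContinuousLinearMap.toSpanSingleton ℝ (1 - e * Real.cos E)⁻¹) ?_ ?_ <;>
    · ext; simp [hpos.ne']
  have hψ := (hG.contDiffAt_implicitFunction (by simp) hinv).analyticAt
  refine hψ.congr ?_
  have hG0 : G ((e, l), E) = 0 := by
    simp only [G, E]; linarith [kepler_eccAnomaly he l]
  have hlt : ∀ᶠ v : ℝ × ℝ in 𝓝 (e, l), |v.1| < 1 :=
    (continuousAt_fst.abs (x := (e, l))).eventually (eventually_lt_nhds he)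
  filter_upwards [hG.eventually_apply_implicitFunction (by simp) hinv, hlt] with v hv hv1
  rw [hG0] at hv
  simp only [G] at hv
  symm
  rw [eccAnomaly_eq_iff hv1]
  linarith

lemma cos_sub_sq_add {e : ℝ} (he : |e| < 1) (E : ℝ) :
    (Real.cos E - e) ^ 2 + (√(1 - e ^ 2) * Real.sin E) ^ 2 = (1 - e * Real.cos E) ^ 2 := by
  have h1 : 0 ≤ 1 - e ^ 2 := by
    have := (sq_lt_one_iff_abs_lt_one e).2 he
    linarith
  rw [mul_pow, Real.sq_sqrt h1, Real.sin_sq]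
  ring

lemma norm_trueAnomaly_arg {e : ℝ} (he : |e| < 1) (E : ℝ) :
    ‖(⟨Real.cos E - e, √(1 - e ^ 2) * Real.sin E⟩ : ℂ)‖ = 1 - e * Real.cos E := by
  rw [Complex.norm_def, Complex.normSq_mk, ← sq, ← sq, cos_sub_sq_add he,
    Real.sqrt_sq (one_sub_mul_cos_pos he E).le]

lemma cos_trueAnomaly {e : ℝ} (he : |e| < 1) (E : ℝ) :
    Real.cos (trueAnomaly e E) = (Real.cos E - e) / (1 - e * Real.cos E) := by
  rw [trueAnomaly, Complex.cos_arg, norm_trueAnomaly_arg he]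
  rw [← norm_ne_zero_iff, norm_trueAnomaly_arg he]
  exact (one_sub_mul_cos_pos he E).ne'

lemma sin_trueAnomaly {e : ℝ} (he : |e| < 1) (E : ℝ) :
    Real.sin (trueAnomaly e E) = √(1 - e ^ 2) * Real.sin E / (1 - e * Real.cos E) := by
  rw [trueAnomaly, Complex.sin_arg, norm_trueAnomaly_arg he]

end Kepler

/-! ### Analyticity of the Hamiltonian -/

section Hamiltonian

/-- The states `z` with `L < G < 0`, that is, retrograde elliptic motions with `0 < e < 1`. -/
def retrograde : Set (Fin 4 → ℝ) := {z | z 0 < z 1 ∧ z 1 < 0}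

lemma isOpen_retrograde : IsOpen retrograde :=
  (isOpen_lt (continuous_apply 0) (continuous_apply 1)).inter
    (isOpen_lt (continuous_apply 1) continuous_const)

lemma ecc_sq {z : Fin 4 → ℝ} (hz : z ∈ retrograde) :
    0 < 1 - z 1 ^ 2 / z 0 ^ 2 ∧ 1 - z 1 ^ 2 / z 0 ^ 2 < 1 := by
  obtain ⟨h1, h2⟩ := hz
  have h0 : z 0 < 0 := h1.trans h2
  have h3 : 0 < z 0 ^ 2 := sq_pos_of_neg h0
  have h4 : 0 < z 1 ^ 2 := sq_pos_of_neg h2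
  refine ⟨?_, by linarith [div_pos h4 h3]⟩
  rw [sub_pos, div_lt_one h3]
  nlinarith

lemma ecc_mem {z : Fin 4 → ℝ} (hz : z ∈ retrograde) : ecc z ∈ Ioo (0 : ℝ) 1 := by
  have h := ecc_sq hz
  refine ⟨Real.sqrt_pos.2 h.1, ?_⟩
  rw [ecc, Real.sqrt_lt' one_pos]
  simpa using h.2

lemma abs_ecc_lt_one {z : Fin 4 → ℝ} (hz : z ∈ retrograde) : |ecc z| < 1 := by
  rw [abs_of_pos (ecc_mem hz).1]; exact (ecc_mem hz).2

lemma radius_pos {z : Fin 4 → ℝ} (hz : z ∈ retrograde) : 0 < radius z := by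
  have h0 : z 0 ≠ 0 := (hz.1.trans hz.2).ne
  have := one_sub_mul_cos_pos (abs_ecc_lt_one hz) (eccAnomaly (ecc z) (z 2))
  unfold radius
  positivity

lemma posX_eq {z : Fin 4 → ℝ} (hz : z ∈ retrograde) :
    posX z = z 0 ^ 2 * ((Real.cos (eccAnomaly (ecc z) (z 2)) - ecc z) * Real.cos (z 3)
      - √(1 - ecc z ^ 2) * Real.sin (eccAnomaly (ecc z) (z 2)) * Real.sin (z 3)) := by
  have h := (one_sub_mul_cos_pos (abs_ecc_lt_one hz) (eccAnomaly (ecc z) (z 2))).ne'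
  rw [posX, polarAngle, Real.cos_add, cos_trueAnomaly (abs_ecc_lt_one hz),
    sin_trueAnomaly (abs_ecc_lt_one hz), radius]
  field_simp

lemma posY_eq {z : Fin 4 → ℝ} (hz : z ∈ retrograde) :
    posY z = z 0 ^ 2 * (√(1 - ecc z ^ 2) * Real.sin (eccAnomaly (ecc z) (z 2)) * Real.cos (z 3)
      + (Real.cos (eccAnomaly (ecc z) (z 2)) - ecc z) * Real.sin (z 3)) := by
  have h := (one_sub_mul_cos_pos (abs_ecc_lt_one hz) (eccAnomaly (ecc z) (z 2))).ne'
  rw [posY, polarAngle, Real.sin_add, cos_trueAnomaly (abs_ecc_lt_one hz),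
    sin_trueAnomaly (abs_ecc_lt_one hz), radius]
  field_simp

lemma posX_sq_add_posY_sq (z : Fin 4 → ℝ) : posX z ^ 2 + posY z ^ 2 = radius z ^ 2 := by
  rw [posX, posY, mul_pow, mul_pow, ← mul_add, Real.cos_sq_add_sin_sq, mul_one]

lemma dist0_zero {z : Fin 4 → ℝ} (hz : z ∈ retrograde) : dist0 0 z = radius z := by
  rw [dist0, add_zero, posX_sq_add_posY_sq, Real.sqrt_sq (radius_pos hz).le]

lemma analyticAt_coord (i : Fin 4) (z : Fin 4 → ℝ) : AnalyticAt ℝ (fun z : Fin 4 → ℝ => z i) z :=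
  (ContinuousLinearMap.proj (R := ℝ) (φ := fun _ : Fin 4 => ℝ) i).analyticAt z

lemma analyticAt_ecc {z : Fin 4 → ℝ} (hz : z ∈ retrograde) : AnalyticAt ℝ ecc z := by
  refine analyticAt_sqrt_comp ?_ (ecc_sq hz).1.ne'
  have h0 : z 0 ^ 2 ≠ 0 := pow_ne_zero 2 (hz.1.trans hz.2).ne
  exact analyticAt_const.sub (((analyticAt_coord 1 z).pow 2).div ((analyticAt_coord 0 z).pow 2) h0)

lemma analyticAt_eccAnomaly_state {z : Fin 4 → ℝ} (hz : z ∈ retrograde) :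
    AnalyticAt ℝ (fun z => eccAnomaly (ecc z) (z 2)) z :=
  AnalyticAt.fun_comp (f := fun z : Fin 4 → ℝ => (ecc z, z 2))
    (analyticAt_eccAnomaly (abs_ecc_lt_one hz)) ((analyticAt_ecc hz).prod (analyticAt_coord 2 z))

lemma analyticAt_radius {z : Fin 4 → ℝ} (hz : z ∈ retrograde) : AnalyticAt ℝ radius z :=
  ((analyticAt_coord 0 z).pow 2).mul (analyticAt_const.sub ((analyticAt_ecc hz).mul
    (Real.analyticAt_cos.fun_comp (analyticAt_eccAnomaly_state hz))))

lemma analyticAt_sqrt_one_sub_ecc {z : Fin 4 → ℝ} (hz : z ∈ retrograde) :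
    AnalyticAt ℝ (fun z => √(1 - ecc z ^ 2)) z := by
  refine analyticAt_sqrt_comp (analyticAt_const.sub ((analyticAt_ecc hz).pow 2)) ?_
  have := (sq_lt_one_iff_abs_lt_one _).2 (abs_ecc_lt_one hz)
  linarith

lemma analyticAt_posX {z : Fin 4 → ℝ} (hz : z ∈ retrograde) : AnalyticAt ℝ posX z := by
  have hE := analyticAt_eccAnomaly_state hz
  have h : AnalyticAt ℝ (fun z : Fin 4 → ℝ => z 0 ^ 2 *
      ((Real.cos (eccAnomaly (ecc z) (z 2)) - ecc z) * Real.cos (z 3)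
      - √(1 - ecc z ^ 2) * Real.sin (eccAnomaly (ecc z) (z 2)) * Real.sin (z 3))) z :=
    ((analyticAt_coord 0 z).pow 2).mul
      ((((Real.analyticAt_cos.fun_comp hE).sub (analyticAt_ecc hz)).mul
        (Real.analyticAt_cos.fun_comp (analyticAt_coord 3 z))).sub
      (((analyticAt_sqrt_one_sub_ecc hz).mul (Real.analyticAt_sin.fun_comp hE)).mul
        (Real.analyticAt_sin.fun_comp (analyticAt_coord 3 z))))
  refine h.congr ?_
  filter_upwards [isOpen_retrograde.mem_nhds hz] with w hw
  exact (posX_eq hw).symm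

lemma analyticAt_posY {z : Fin 4 → ℝ} (hz : z ∈ retrograde) : AnalyticAt ℝ posY z := by
  have hE := analyticAt_eccAnomaly_state hz
  have h : AnalyticAt ℝ (fun z : Fin 4 → ℝ => z 0 ^ 2 *
      (√(1 - ecc z ^ 2) * Real.sin (eccAnomaly (ecc z) (z 2)) * Real.cos (z 3)
      + (Real.cos (eccAnomaly (ecc z) (z 2)) - ecc z) * Real.sin (z 3))) z :=
    ((analyticAt_coord 0 z).pow 2).mul
      ((((analyticAt_sqrt_one_sub_ecc hz).mul (Real.analyticAt_sin.fun_comp hE)).mul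
        (Real.analyticAt_cos.fun_comp (analyticAt_coord 3 z))).add
      (((Real.analyticAt_cos.fun_comp hE).sub (analyticAt_ecc hz)).mul
        (Real.analyticAt_sin.fun_comp (analyticAt_coord 3 z))))
  refine h.congr ?_
  filter_upwards [isOpen_retrograde.mem_nhds hz] with w hw
  exact (posY_eq hw).symm

/-- The pairs `(μ, z)` of a mass parameter and a state in the domain of the Hamiltonian. -/
def fullDomain : Set (ℝ × (Fin 4 → ℝ)) := {v | v.2 ∈ domain v.1}

lemma retrograde_of_mem_domain {μ : ℝ} {z : Fin 4 → ℝ} (hz : z ∈ domain μ) : z ∈ retrograde :=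
  ⟨hz.1, hz.2.1⟩

lemma analyticAt_dist0 {μ : ℝ} {z : Fin 4 → ℝ} (hz : z ∈ retrograde) (h : 0 < dist0 μ z) :
    AnalyticAt ℝ (fun v : ℝ × (Fin 4 → ℝ) => dist0 v.1 v.2) (μ, z) := by
  have hx : AnalyticAt ℝ (fun v : ℝ × (Fin 4 → ℝ) => posX v.2) (μ, z) :=
    AnalyticAt.fun_comp (f := fun v : ℝ × (Fin 4 → ℝ) => v.2) (analyticAt_posX hz) analyticAt_snd
  have hy : AnalyticAt ℝ (fun v : ℝ × (Fin 4 → ℝ) => posY v.2) (μ, z) :=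
    AnalyticAt.fun_comp (f := fun v : ℝ × (Fin 4 → ℝ) => v.2) (analyticAt_posY hz) analyticAt_snd
  exact analyticAt_sqrt_comp (((hx.add analyticAt_fst).pow 2).add (hy.pow 2))
    (Real.sqrt_pos.1 h).ne'

lemma analyticAt_dist1 {μ : ℝ} {z : Fin 4 → ℝ} (hz : z ∈ retrograde) (h : 0 < dist1 μ z) :
    AnalyticAt ℝ (fun v : ℝ × (Fin 4 → ℝ) => dist1 v.1 v.2) (μ, z) := by
  have hx : AnalyticAt ℝ (fun v : ℝ × (Fin 4 → ℝ) => posX v.2) (μ, z) :=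
    AnalyticAt.fun_comp (f := fun v : ℝ × (Fin 4 → ℝ) => v.2) (analyticAt_posX hz) analyticAt_snd
  have hy : AnalyticAt ℝ (fun v : ℝ × (Fin 4 → ℝ) => posY v.2) (μ, z) :=
    AnalyticAt.fun_comp (f := fun v : ℝ × (Fin 4 → ℝ) => v.2) (analyticAt_posY hz) analyticAt_snd
  exact analyticAt_sqrt_comp ((((hx.sub analyticAt_const).add analyticAt_fst).pow 2).add (hy.pow 2))
    (Real.sqrt_pos.1 h).ne'

lemma isOpen_fullDomain : IsOpen fullDomain := by
  rw [isOpen_iff_mem_nhds]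
  rintro ⟨μ, z⟩ hz
  have hr := retrograde_of_mem_domain hz
  filter_upwards [continuousAt_snd.preimage_mem_nhds (isOpen_retrograde.mem_nhds hr),
    (analyticAt_dist0 hr hz.2.2.1).continuousAt.eventually (eventually_gt_nhds hz.2.2.1),
    (analyticAt_dist1 hr hz.2.2.2).continuousAt.eventually (eventually_gt_nhds hz.2.2.2)]
    with v h1 h2 h3
  exact ⟨h1.1, h1.2, h2, h3⟩

lemma isOpen_domain (μ : ℝ) : IsOpen (domain μ) :=
  isOpen_fullDomain.preimage (f := fun z => (μ, z)) (by fun_prop)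

/-- The Hamiltonian as a function of the mass parameter and the state. -/
def jointHam (v : ℝ × (Fin 4 → ℝ)) : ℝ := hamiltonian v.1 v.2

lemma analyticAt_jointHam {v : ℝ × (Fin 4 → ℝ)} (hv : v ∈ fullDomain) :
    AnalyticAt ℝ jointHam v := by
  obtain ⟨μ, z⟩ := v
  have hr := retrograde_of_mem_domain hv
  have h0 : z 0 ≠ 0 := (hr.1.trans hr.2).ne
  have hc : ∀ i, AnalyticAt ℝ (fun v : ℝ × (Fin 4 → ℝ) => v.2 i) (μ, z) := fun i =>
    AnalyticAt.fun_comp (g := fun z : Fin 4 → ℝ => z i) (f := fun v : ℝ × (Fin 4 → ℝ) => v.2)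
      (analyticAt_coord i z) analyticAt_snd
  have hrad : AnalyticAt ℝ (fun v : ℝ × (Fin 4 → ℝ) => radius v.2) (μ, z) :=
    AnalyticAt.fun_comp (f := fun v : ℝ × (Fin 4 → ℝ) => v.2) (analyticAt_radius hr)
      analyticAt_snd
  exact ((analyticAt_const.div (analyticAt_const.mul ((hc 0).pow 2))
    (mul_ne_zero two_ne_zero (pow_ne_zero 2 h0))).sub (hc 1)).sub
    ((((analyticAt_const.sub analyticAt_fst).div (analyticAt_dist0 hr hv.2.2.1)
      hv.2.2.1.ne').add (analyticAt_fst.div (analyticAt_dist1 hr hv.2.2.2) hv.2.2.2.ne')).sub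
      (analyticAt_const.div hrad (radius_pos hr).ne'))

lemma hamPartial_eq {μ : ℝ} {z : Fin 4 → ℝ} (hz : z ∈ domain μ) (i : Fin 4) :
    hamPartial μ i z = fderiv ℝ jointHam (μ, z) (0, Pi.single i 1) := by
  have h : HasFDerivAt (hamiltonian μ)
      (fderiv ℝ jointHam (μ, z) ∘L .inr ℝ ℝ (Fin 4 → ℝ)) z :=
    HasFDerivAt.comp (f := fun z => (μ, z)) z
      (analyticAt_jointHam (v := (μ, z)) hz).differentiableAt.hasFDerivAt
      (hasFDerivAt_prodMk_right _ _)
  rw [hamPartial, h.fderiv]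
  rfl

/-- The Hamiltonian vector field as a function of the mass parameter and the state. -/
def jointField (v : ℝ × (Fin 4 → ℝ)) : Fin 4 → ℝ := vectorField v.1 v.2

lemma analyticAt_fderiv_apply {E F : Type*} [NormedAddCommGroup E] [NormedSpace ℝ E]
    [NormedAddCommGroup F] [NormedSpace ℝ F] [CompleteSpace F] {f : E → F} {x : E}
    (hf : AnalyticAt ℝ f x) (w : E) : AnalyticAt ℝ (fun y => fderiv ℝ f y w) x :=
  ((ContinuousLinearMap.apply ℝ F w).analyticAt _).fun_comp hf.fderiv

lemma analyticAt_hamPartial {v : ℝ × (Fin 4 → ℝ)} (hv : v ∈ fullDomain) (i : Fin 4) :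
    AnalyticAt ℝ (fun v : ℝ × (Fin 4 → ℝ) => hamPartial v.1 i v.2) v := by
  refine (analyticAt_fderiv_apply (analyticAt_jointHam hv) (0, Pi.single i 1)).congr ?_
  filter_upwards [isOpen_fullDomain.mem_nhds hv] with w hw
  exact (hamPartial_eq hw i).symm

lemma analyticAt_jointField {v : ℝ × (Fin 4 → ℝ)} (hv : v ∈ fullDomain) :
    AnalyticAt ℝ jointField v := by
  refine AnalyticAt.pi fun i => ?_
  fin_cases i
  · exact (analyticAt_hamPartial hv 2).neg
  · exact (analyticAt_hamPartial hv 3).neg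
  · exact analyticAt_hamPartial hv 0
  · exact analyticAt_hamPartial hv 1

lemma analyticAt_vectorField {μ : ℝ} {z : Fin 4 → ℝ} (hz : z ∈ domain μ) :
    AnalyticAt ℝ (vectorField μ) z :=
  AnalyticAt.fun_comp (f := fun z => (μ, z)) (g := jointField) (analyticAt_jointField hz)
    (analyticAt_const.prod analyticAt_id)

/-! ### Invariance under shifts of the angles -/

lemma angleShift_apply (k m : ℤ) : angleShift k m 0 = 0 ∧ angleShift k m 1 = 0 ∧
    angleShift k m 2 = 2 * Real.pi * k ∧ angleShift k m 3 = 2 * Real.pi * m :=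
  ⟨rfl, rfl, rfl, rfl⟩

lemma add_angleShift_mem_retrograde {z : Fin 4 → ℝ} (k m : ℤ) :
    z + angleShift k m ∈ retrograde ↔ z ∈ retrograde := by
  simp [retrograde, angleShift_apply]

lemma ecc_add_angleShift (z : Fin 4 → ℝ) (k m : ℤ) : ecc (z + angleShift k m) = ecc z := by
  simp [ecc, angleShift_apply]

lemma radius_add_angleShift {z : Fin 4 → ℝ} (hz : z ∈ retrograde) (k m : ℤ) :
    radius (z + angleShift k m) = radius z := by
  rw [radius, radius, ecc_add_angleShift]
  simp only [Pi.add_apply, angleShift_apply, add_zero]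
  rw [eccAnomaly_add_two_pi (abs_ecc_lt_one hz), mul_comm (2 * Real.pi) (k : ℝ),
    Real.cos_add_int_mul_two_pi]

lemma posX_add_angleShift {z : Fin 4 → ℝ} (hz : z ∈ retrograde) (k m : ℤ) :
    posX (z + angleShift k m) = posX z := by
  rw [posX_eq hz, posX_eq ((add_angleShift_mem_retrograde k m).2 hz), ecc_add_angleShift]
  simp only [Pi.add_apply, angleShift_apply, add_zero]
  rw [eccAnomaly_add_two_pi (abs_ecc_lt_one hz), mul_comm (2 * Real.pi) (k : ℝ),
    mul_comm (2 * Real.pi) (m : ℝ)]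
  simp only [Real.cos_add_int_mul_two_pi, Real.sin_add_int_mul_two_pi]

lemma posY_add_angleShift {z : Fin 4 → ℝ} (hz : z ∈ retrograde) (k m : ℤ) :
    posY (z + angleShift k m) = posY z := by
  rw [posY_eq hz, posY_eq ((add_angleShift_mem_retrograde k m).2 hz), ecc_add_angleShift]
  simp only [Pi.add_apply, angleShift_apply, add_zero]
  rw [eccAnomaly_add_two_pi (abs_ecc_lt_one hz), mul_comm (2 * Real.pi) (k : ℝ),
    mul_comm (2 * Real.pi) (m : ℝ)]
  simp only [Real.cos_add_int_mul_two_pi, Real.sin_add_int_mul_two_pi]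

lemma hamiltonian_add_angleShift (μ : ℝ) {z : Fin 4 → ℝ} (hz : z ∈ retrograde) (k m : ℤ) :
    hamiltonian μ (z + angleShift k m) = hamiltonian μ z := by
  rw [hamiltonian, hamiltonian, dist0, dist0, dist1, dist1, posX_add_angleShift hz,
    posY_add_angleShift hz, radius_add_angleShift hz]
  simp [angleShift_apply]

lemma add_angleShift_mem_domain {μ : ℝ} {z : Fin 4 → ℝ} (k m : ℤ) (hz : z ∈ domain μ) :
    z + angleShift k m ∈ domain μ := by
  have hr := retrograde_of_mem_domain hz
  have hr' := (add_angleShift_mem_retrograde k m).2 hr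
  refine ⟨hr'.1, hr'.2, ?_, ?_⟩
  · rw [dist0, posX_add_angleShift hr, posY_add_angleShift hr]
    exact hz.2.2.1
  · rw [dist1, posX_add_angleShift hr, posY_add_angleShift hr]
    exact hz.2.2.2

lemma vectorField_add_angleShift {μ : ℝ} {z : Fin 4 → ℝ} (hz : z ∈ retrograde) (k m : ℤ) :
    vectorField μ (z + angleShift k m) = vectorField μ z := by
  have h : ∀ i, hamPartial μ i (z + angleShift k m) = hamPartial μ i z := fun i => by
    rw [hamPartial, hamPartial, ← fderiv_comp_add_right]
    congr 1
    refine Filter.EventuallyEq.fderiv_eq ?_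
    filter_upwards [isOpen_retrograde.mem_nhds hz] with w hw
    exact hamiltonian_add_angleShift μ hw k m
  simp only [vectorField, h]

/-! ### The reversing symmetry -/

/-- The time-reversing reflection `(L, G, l, g) ↦ (L, G, -l, -g)`. -/
def reflect : (Fin 4 → ℝ) →L[ℝ] (Fin 4 → ℝ) :=
  ContinuousLinearMap.pi fun i =>
    (![1, 1, -1, -1] i : ℝ) • ContinuousLinearMap.proj (R := ℝ) (φ := fun _ : Fin 4 => ℝ) i

lemma reflect_apply (z : Fin 4 → ℝ) : reflect z = ![z 0, z 1, -z 2, -z 3] := by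
  funext i
  fin_cases i <;> simp [reflect]

lemma reflect_mem_retrograde {z : Fin 4 → ℝ} (hz : z ∈ retrograde) : reflect z ∈ retrograde := by
  rw [reflect_apply]; exact hz

lemma ecc_reflect (z : Fin 4 → ℝ) : ecc (reflect z) = ecc z := by
  rw [reflect_apply]; rfl

lemma eccAnomaly_reflect {z : Fin 4 → ℝ} (hz : z ∈ retrograde) :
    eccAnomaly (ecc (reflect z)) (reflect z 2) = -eccAnomaly (ecc z) (z 2) := by
  rw [ecc_reflect, reflect_apply]
  exact eccAnomaly_neg (abs_ecc_lt_one hz) _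

lemma radius_reflect {z : Fin 4 → ℝ} (hz : z ∈ retrograde) : radius (reflect z) = radius z := by
  rw [radius, radius, eccAnomaly_reflect hz, ecc_reflect, Real.cos_neg, reflect_apply]
  rfl

lemma posX_reflect {z : Fin 4 → ℝ} (hz : z ∈ retrograde) : posX (reflect z) = posX z := by
  rw [posX_eq hz, posX_eq (reflect_mem_retrograde hz), eccAnomaly_reflect hz, ecc_reflect,
    reflect_apply]
  simp

lemma posY_reflect {z : Fin 4 → ℝ} (hz : z ∈ retrograde) : posY (reflect z) = -posY z := by
  rw [posY_eq hz, posY_eq (reflect_mem_retrograde hz), eccAnomaly_reflect hz, ecc_reflect,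
    reflect_apply]
  simp
  ring

lemma dist0_reflect (μ : ℝ) {z : Fin 4 → ℝ} (hz : z ∈ retrograde) :
    dist0 μ (reflect z) = dist0 μ z := by
  rw [dist0, dist0, posX_reflect hz, posY_reflect hz, neg_sq]

lemma dist1_reflect (μ : ℝ) {z : Fin 4 → ℝ} (hz : z ∈ retrograde) :
    dist1 μ (reflect z) = dist1 μ z := by
  rw [dist1, dist1, posX_reflect hz, posY_reflect hz, neg_sq]

lemma hamiltonian_reflect (μ : ℝ) {z : Fin 4 → ℝ} (hz : z ∈ retrograde) :
    hamiltonian μ (reflect z) = hamiltonian μ z := by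
  rw [hamiltonian, hamiltonian, dist0_reflect μ hz, dist1_reflect μ hz, radius_reflect hz,
    reflect_apply]
  rfl

lemma reflect_mem_domain {μ : ℝ} {z : Fin 4 → ℝ} (hz : z ∈ domain μ) : reflect z ∈ domain μ := by
  have hr := retrograde_of_mem_domain hz
  have hr' := reflect_mem_retrograde hr
  exact ⟨hr'.1, hr'.2, by rw [dist0_reflect μ hr]; exact hz.2.2.1,
    by rw [dist1_reflect μ hr]; exact hz.2.2.2⟩

lemma vectorField_reflect {μ : ℝ} {z : Fin 4 → ℝ} (hz : z ∈ domain μ) :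
    vectorField μ (reflect z) = -reflect (vectorField μ z) := by
  have h1 : HasFDerivAt (hamiltonian μ)
      (fderiv ℝ jointHam (μ, reflect z) ∘L .inr ℝ ℝ (Fin 4 → ℝ)) (reflect z) :=
    HasFDerivAt.comp (f := fun z => (μ, z)) (reflect z) (analyticAt_jointHam (v := (μ, reflect z))
      (reflect_mem_domain hz)).differentiableAt.hasFDerivAt (hasFDerivAt_prodMk_right _ _)
  have h2 : HasFDerivAt (hamiltonian μ) (fderiv ℝ (hamiltonian μ) (reflect z) ∘L reflect) z := by
    refine (HasFDerivAt.comp (g := hamiltonian μ) z h1.differentiableAt.hasFDerivAt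
      reflect.hasFDerivAt).congr_of_eventuallyEq ?_
    filter_upwards [isOpen_retrograde.mem_nhds (retrograde_of_mem_domain hz)] with w hw
    exact (hamiltonian_reflect μ hw).symm
  have key : ∀ i, hamPartial μ i z
      = fderiv ℝ (hamiltonian μ) (reflect z) (reflect (Pi.single i 1)) := fun i => by
    rw [hamPartial, h2.fderiv]; rfl
  have e : ∀ i, reflect (Pi.single i 1) = (![1, 1, -1, -1] i : ℝ) • Pi.single i (1 : ℝ) := by
    intro i
    funext j
    rw [reflect_apply]
    fin_cases i <;> fin_cases j <;> simp
  simp only [vectorField, key, e, map_smul]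
  generalize reflect z = w
  rw [reflect_apply]
  funext j
  fin_cases j <;> simp [hamPartial]

/-! ### The Kepler problem -/

lemma hamiltonian_zero {z : Fin 4 → ℝ} (hz : z ∈ retrograde) :
    hamiltonian 0 z = -1 / (2 * z 0 ^ 2) - z 1 := by
  rw [hamiltonian, dist0_zero hz]
  simp

lemma hasFDerivAt_coord (i : Fin 4) (z : Fin 4 → ℝ) : HasFDerivAt (fun z : Fin 4 → ℝ => z i)
    (ContinuousLinearMap.proj (R := ℝ) (φ := fun _ : Fin 4 => ℝ) i) z :=
  (ContinuousLinearMap.proj (R := ℝ) (φ := fun _ : Fin 4 => ℝ) i).hasFDerivAt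

lemma hamPartial_zero {z : Fin 4 → ℝ} (hz : z ∈ retrograde) (i : Fin 4) :
    hamPartial 0 i z = ![1 / z 0 ^ 3, -1, 0, 0] i := by
  have h0 : z 0 ≠ 0 := (hz.1.trans hz.2).ne
  have h1 : HasDerivAt (fun L : ℝ => -1 / (2 * L ^ 2)) (1 / z 0 ^ 3) (z 0) := by
    have h := (((hasDerivAt_pow 2 (z 0)).const_mul 2).fun_inv
      (mul_ne_zero two_ne_zero (pow_ne_zero 2 h0))).const_mul (-1)
    simp only [div_eq_mul_inv]
    refine h.congr_deriv ?_
    push_cast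
    field_simp
  have h2 : HasFDerivAt (hamiltonian 0) ((1 / z 0 ^ 3) •
      ContinuousLinearMap.proj (R := ℝ) (φ := fun _ : Fin 4 => ℝ) 0 -
      ContinuousLinearMap.proj (R := ℝ) (φ := fun _ : Fin 4 => ℝ) 1) z := by
    refine ((h1.comp_hasFDerivAt z (hasFDerivAt_coord 0 z)).sub
      (hasFDerivAt_coord 1 z)).congr_of_eventuallyEq ?_
    filter_upwards [isOpen_retrograde.mem_nhds hz] with w hw
    exact hamiltonian_zero hw
  rw [hamPartial, h2.fderiv]
  fin_cases i <;> simp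

/-- For `μ = 0` the vector field is that of the Kepler problem in the rotating frame. -/
lemma vectorField_zero {z : Fin 4 → ℝ} (hz : z ∈ retrograde) :
    vectorField 0 z = ![0, 0, 1 / z 0 ^ 3, -1] := by
  simp only [vectorField, hamPartial_zero hz]
  funext i
  fin_cases i <;> simp

end Hamiltonian

/-! ### The unperturbed orbit -/

section Unperturbed

lemma resL_pos {p q : ℕ} (hp : 0 < p) (hq : 0 < q) : 0 < resL p q := by
  have : 0 < (p : ℝ) / q := by positivity
  exact Real.rpow_pos_of_pos this _

lemma resL_pow_three {p q : ℕ} : resL p q ^ 3 = (p : ℝ) / q := by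
  rw [resL, ← Real.rpow_natCast, ← Real.rpow_mul (by positivity)]
  norm_num

lemma one_div_neg_resL_pow_three {p q : ℕ} :
    1 / (-resL p q) ^ 3 = -((q : ℝ) / p) := by
  rw [Odd.neg_pow (by decide), resL_pow_three, one_div, inv_neg, inv_div]

lemma sqrt_one_sub_mem {e : ℝ} (he : e ∈ Ioo (0 : ℝ) 1) : √(1 - e ^ 2) ∈ Ioo (0 : ℝ) 1 := by
  have h1 : e ^ 2 < 1 := by nlinarith [he.1, he.2]
  have h2 : 0 < e ^ 2 := pow_pos he.1 2
  refine ⟨Real.sqrt_pos.2 (by linarith), ?_⟩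
  rw [Real.sqrt_lt' one_pos]
  linarith

lemma unperturbed_mem_retrograde {p q : ℕ} (hp : 0 < p) (hq : 0 < q) {e : ℝ}
    (he : e ∈ Ioo (0 : ℝ) 1) (nl ng : Fin 2) (t : ℝ) :
    unperturbed p q e nl ng t ∈ retrograde := by
  have hR := resL_pos hp hq
  have hs := sqrt_one_sub_mem he
  constructor
  · change -resL p q < -(resL p q * √(1 - e ^ 2))
    nlinarith [hs.2]
  · change -(resL p q * √(1 - e ^ 2)) < 0
    nlinarith [mul_pos hR hs.1]

lemma unperturbed_mem_domain {p q : ℕ} (hp : 0 < p) (hq : 0 < q) {e : ℝ}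
    (he : e ∈ Ioo (0 : ℝ) 1) {nl ng : Fin 2} (hnc : NonCollision p q e nl ng) (t : ℝ) :
    unperturbed p q e nl ng t ∈ domain 0 := by
  have hr := unperturbed_mem_retrograde hp hq he nl ng t
  exact ⟨hr.1, hr.2, by rw [dist0_zero hr]; exact radius_pos hr, hnc t⟩

lemma hasDerivAt_unperturbed {p q : ℕ} (hp : 0 < p) (hq : 0 < q) {e : ℝ}
    (he : e ∈ Ioo (0 : ℝ) 1) (nl ng : Fin 2) (t : ℝ) :
    HasDerivAt (unperturbed p q e nl ng) (vectorField 0 (unperturbed p q e nl ng t)) t := by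
  rw [vectorField_zero (unperturbed_mem_retrograde hp hq he nl ng t)]
  change HasDerivAt _ ![0, 0, 1 / (-resL p q) ^ 3, -1] t
  rw [one_div_neg_resL_pow_three]
  rw [hasDerivAt_pi]
  intro i
  fin_cases i
  · exact hasDerivAt_const t _
  · exact hasDerivAt_const t _
  · have h := ((hasDerivAt_id' t).const_mul ((q : ℝ) / p)).const_sub (((nl : ℕ) : ℝ) * Real.pi)
    rw [mul_one] at h
    refine h.congr_of_eventuallyEq (Eventually.of_forall fun s => ?_)
    change ((nl : ℕ) : ℝ) * Real.pi - q * s / p = _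
    ring
  · exact (hasDerivAt_id' t).const_sub _

lemma unperturbed_zero (p q : ℕ) (e : ℝ) (nl ng : Fin 2) :
    unperturbed p q e nl ng 0 = initialState p q e nl ng (-resL p q) := by
  simp [unperturbed, initialState]

/-- The solutions of Hamilton's equations for `μ = 0`. -/
lemma eq_of_solvesOn_zero {z : ℝ → Fin 4 → ℝ} {b : ℝ}
    (hz : SolvesOn (vectorField 0) (domain 0) z (-b) b) {t : ℝ} (ht : t ∈ Ioo (-b) b) :
    z t = ![z 0 0, z 0 1, z 0 2 + t / z 0 0 ^ 3, z 0 3 - t] := by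
  have h0 : (0 : ℝ) ∈ Ioo (-b) b := by
    have := ht.1.trans ht.2
    exact ⟨by linarith, by linarith⟩
  have hd : ∀ t ∈ Ioo (-b) b, ∀ i, HasDerivAt (fun t => z t i)
      ((![0, 0, 1 / z t 0 ^ 3, -1] : Fin 4 → ℝ) i) t := fun t ht i => by
    rw [← vectorField_zero (retrograde_of_mem_domain (hz t ht).1)]
    exact (hasDerivAt_pi.1 (hz t ht).2) i
  have e0 : ∀ t ∈ Ioo (-b) b, z t 0 = z 0 0 := fun t ht =>
    eq_of_hasDerivAt_zero (fun s hs => hd s hs 0) ht h0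
  have e1 : z t 1 = z 0 1 := eq_of_hasDerivAt_zero (fun s hs => hd s hs 1) ht h0
  have e2 : z t 2 - t * (1 / z 0 0 ^ 3) = z 0 2 - 0 * (1 / z 0 0 ^ 3) :=
    eq_of_hasDerivAt_zero (u := fun t => z t 2 - t * (1 / z 0 0 ^ 3)) (fun s hs => by
      have h := (hd s hs 2).fun_sub ((hasDerivAt_id' s).mul_const (1 / z 0 0 ^ 3))
      simpa [e0 s hs] using h) ht h0
  have e3 : z t 3 + t = z 0 3 + 0 :=
    eq_of_hasDerivAt_zero (u := fun t => z t 3 + t) (fun s hs => by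
      have h := (hd s hs 3).fun_add (hasDerivAt_id' s)
      simpa using h) ht h0
  funext i
  fin_cases i
  · exact e0 t ht
  · exact e1
  · change z t 2 = z 0 2 + t / z 0 0 ^ 3
    rw [div_eq_mul_one_div]
    linarith
  · change z t 3 = z 0 3 - t
    linarith

end Unperturbed

/-! ### The flow near the unperturbed orbit -/

section Variational

/-- The derivative of the vector field in the state, as a function of mass parameter and state. -/
def linField (v : ℝ × (Fin 4 → ℝ)) : (Fin 4 → ℝ) →L[ℝ] (Fin 4 → ℝ) :=
  (fderiv ℝ jointField v).comp (.inr ℝ ℝ (Fin 4 → ℝ))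

lemma linField_eq {μ : ℝ} {z : Fin 4 → ℝ} (hz : z ∈ domain μ) :
    linField (μ, z) = fderiv ℝ (vectorField μ) z := by
  have h : HasFDerivAt (vectorField μ) (linField (μ, z)) z :=
    HasFDerivAt.comp (f := fun z => (μ, z)) (g := jointField) z
      (analyticAt_jointField (v := (μ, z)) hz).differentiableAt.hasFDerivAt
      (hasFDerivAt_prodMk_right _ _)
  exact h.fderiv.symm

lemma analyticAt_linField {v : ℝ × (Fin 4 → ℝ)} (hv : v ∈ fullDomain) :
    AnalyticAt ℝ linField v :=
  ((ContinuousLinearMap.compL ℝ (Fin 4 → ℝ) (ℝ × (Fin 4 → ℝ)) (Fin 4 → ℝ)).flip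
    (.inr ℝ ℝ (Fin 4 → ℝ))).analyticAt _ |>.fun_comp (analyticAt_jointField hv).fderiv

/-- The shear `v ↦ (0, 0, c v₀, 0)`; with `c = -3 / L⁴` it is the derivative of the vector field
for `μ = 0`. -/
def shear (c : ℝ) : (Fin 4 → ℝ) →L[ℝ] (Fin 4 → ℝ) :=
  c • (ContinuousLinearMap.proj (R := ℝ) (φ := fun _ : Fin 4 => ℝ) 0).smulRight
    (Pi.single 2 (1 : ℝ))

lemma shear_apply (c : ℝ) (v : Fin 4 → ℝ) : shear c v = ![0, 0, c * v 0, 0] := by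
  funext i
  fin_cases i <;> simp [shear]

lemma shear_comp_shear (c d : ℝ) : (shear c).comp (shear d) = 0 := by
  ext v i
  rw [ContinuousLinearMap.comp_apply, shear_apply, shear_apply]
  fin_cases i <;> simp

lemma linField_zero {z : Fin 4 → ℝ} (hz : z ∈ domain 0) :
    linField (0, z) = shear (-3 / z 0 ^ 4) := by
  have hr := retrograde_of_mem_domain hz
  have h0 : z 0 ≠ 0 := (hr.1.trans hr.2).ne
  rw [linField_eq hz]
  have h1 : HasDerivAt (fun L : ℝ => 1 / L ^ 3) (-3 / z 0 ^ 4) (z 0) := by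
    have h := (hasDerivAt_pow 3 (z 0)).fun_inv (pow_ne_zero 3 h0)
    simp only [one_div]
    refine h.congr_deriv ?_
    push_cast
    field_simp
  have h2 : HasFDerivAt (vectorField 0) (shear (-3 / z 0 ^ 4)) z := by
    have h3 : HasFDerivAt (fun z : Fin 4 → ℝ => (![0, 0, 1 / z 0 ^ 3, -1] : Fin 4 → ℝ))
        (shear (-3 / z 0 ^ 4)) z := by
      rw [hasFDerivAt_pi']
      intro i
      fin_cases i
      · refine (hasFDerivAt_const (0 : ℝ) z).congr_fderiv ?_
        ext v; simp [shear_apply]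
      · refine (hasFDerivAt_const (0 : ℝ) z).congr_fderiv ?_
        ext v; simp [shear_apply]
      · refine (h1.comp_hasFDerivAt z (hasFDerivAt_coord 0 z)).congr_fderiv ?_
        ext v; simp [shear]
      · refine (hasFDerivAt_const (-1 : ℝ) z).congr_fderiv ?_
        ext v; simp [shear_apply]
    refine h3.congr_of_eventuallyEq ?_
    filter_upwards [isOpen_retrograde.mem_nhds hr] with w hw
    exact vectorField_zero hw
  exact h2.fderiv

/-- `ζ` is the flow of Hamilton's equations, and `Y` its fundamental solution of the variational
equation, for times in `(-b, b)` and mass parameters and initial states in a ball about `(0, x₀)`;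
both are analytic in all variables. -/
structure IsFlowNear (x₀ : Fin 4 → ℝ) (b ε : ℝ) (ζ : ℝ × (ℝ × (Fin 4 → ℝ)) → Fin 4 → ℝ)
    (Y : ℝ × (ℝ × (Fin 4 → ℝ)) → (Fin 4 → ℝ) →L[ℝ] (Fin 4 → ℝ)) : Prop where
  pos : 0 < ε
  solves : ∀ w ∈ Metric.ball ((0 : ℝ), x₀) ε,
    SolvesOn (vectorField w.1) (domain w.1) (fun t => ζ (t, w)) (-b) b
  zero : ∀ w ∈ Metric.ball ((0 : ℝ), x₀) ε, ζ (0, w) = w.2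
  analytic : ∀ w ∈ Metric.ball ((0 : ℝ), x₀) ε, ∀ t ∈ Ioo (-b) b, AnalyticAt ℝ ζ (t, w)
  fund_zero : ∀ w ∈ Metric.ball ((0 : ℝ), x₀) ε, Y (0, w) = ContinuousLinearMap.id ℝ _
  fund_analytic : ∀ w ∈ Metric.ball ((0 : ℝ), x₀) ε, ∀ t ∈ Ioo (-b) b, AnalyticAt ℝ Y (t, w)
  fund_deriv : ∀ w ∈ Metric.ball ((0 : ℝ), x₀) ε, ∀ t ∈ Ioo (-b) b,
    HasDerivAt (fun t => Y (t, w)) ((linField (w.1, ζ (t, w))).comp (Y (t, w))) t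

/-- The unperturbed orbit exists for all times, so that the flow of the extended system
`μ' = 0`, `z' = X(μ, z)`, `Y' = DX(μ, z) Y` is analytic near it on every bounded interval. -/
lemma exists_isFlowNear {p q : ℕ} (hp : 0 < p) (hq : 0 < q) {e : ℝ} (he : e ∈ Ioo (0 : ℝ) 1)
    {nl ng : Fin 2} (hnc : NonCollision p q e nl ng) {b : ℝ} (hb : 0 < b) :
    ∃ ε ζ Y, IsFlowNear (initialState p q e nl ng (-resL p q)) b ε ζ Y := by
  let V := Fin 4 → ℝ
  let f : ℝ × (V × (V →L[ℝ] V)) → ℝ × (V × (V →L[ℝ] V)) := fun s =>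
    (0, (jointField (s.1, s.2.1), (linField (s.1, s.2.1)).comp s.2.2))
  let U : Set (ℝ × (V × (V →L[ℝ] V))) := {s | (s.1, s.2.1) ∈ fullDomain}
  have hU : IsOpen U := isOpen_fullDomain.preimage (by fun_prop)
  have hf : ∀ s ∈ U, AnalyticAt ℝ f s := fun s hs => by
    have hpr : AnalyticAt ℝ (fun s : ℝ × (V × (V →L[ℝ] V)) => (s.1, s.2.1)) s :=
      analyticAt_fst.prod (analyticAt_fst.fun_comp analyticAt_snd)
    have h1 : AnalyticAt ℝ (fun s : ℝ × (V × (V →L[ℝ] V)) => jointField (s.1, s.2.1)) s :=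
      AnalyticAt.fun_comp (f := fun s : ℝ × (V × (V →L[ℝ] V)) => (s.1, s.2.1))
        (analyticAt_jointField hs) hpr
    have h2 : AnalyticAt ℝ (fun s : ℝ × (V × (V →L[ℝ] V)) => linField (s.1, s.2.1)) s :=
      AnalyticAt.fun_comp (f := fun s : ℝ × (V × (V →L[ℝ] V)) => (s.1, s.2.1))
        (analyticAt_linField hs) hpr
    have h3 : AnalyticAt ℝ (fun s : ℝ × (V × (V →L[ℝ] V)) => s.2.2) s :=
      analyticAt_snd.fun_comp analyticAt_snd
    have h4 : AnalyticAt ℝ (fun s : ℝ × (V × (V →L[ℝ] V)) =>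
        (linField (s.1, s.2.1)).comp s.2.2) s :=
      ((ContinuousLinearMap.compL ℝ V V V).analyticAt_bilinear _).fun_comp (h2.prod h3)
    exact analyticAt_const.prod (h1.prod h4)
  let c : ℝ := -3 / (-resL p q) ^ 4
  let u : ℝ → ℝ × (V × (V →L[ℝ] V)) := fun t =>
    (0, (unperturbed p q e nl ng t, ContinuousLinearMap.id ℝ V + t • shear c))
  have hu : SolvesOn f U u (-(b + 1)) (b + 1) := fun t _ => by
    have hd := unperturbed_mem_domain hp hq he hnc t
    refine ⟨hd, (hasDerivAt_const t (0 : ℝ)).prodMk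
      ((hasDerivAt_unperturbed hp hq he nl ng t).prodMk ?_)⟩
    have h1 : linField (0, unperturbed p q e nl ng t) = shear c := linField_zero hd
    change HasDerivAt _ ((linField (0, unperturbed p q e nl ng t)).comp
      (ContinuousLinearMap.id ℝ V + t • shear c)) t
    rw [h1]
    refine (((hasDerivAt_id' t).smul_const (shear c)).const_add
      (ContinuousLinearMap.id ℝ V)).congr_deriv ?_
    rw [ContinuousLinearMap.comp_add, ContinuousLinearMap.comp_smul, shear_comp_shear]
    simp
  obtain ⟨ε, hε, Φ, hΦ, hΦ0⟩ := exists_isFlowOn hU hf hu (a' := -b) (b' := b)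
    (by linarith) (by linarith) (by linarith) (by linarith)
  have hu0 : u 0 = (0, (initialState p q e nl ng (-resL p q), ContinuousLinearMap.id ℝ V)) := by
    simp [u, unperturbed_zero]
  rw [hu0] at hΦ hΦ0
  have h0 : (0 : ℝ) ∈ Ioo (-b) b := ⟨by linarith, hb⟩
  let J : ℝ × V → ℝ × (V × (V →L[ℝ] V)) := fun w => (w.1, (w.2, ContinuousLinearMap.id ℝ V))
  have hJ : ∀ w ∈ Metric.ball ((0 : ℝ), initialState p q e nl ng (-resL p q)) ε,
      J w ∈ Metric.ball (0, (initialState p q e nl ng (-resL p q),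
        ContinuousLinearMap.id ℝ V)) ε := fun w hw => by
    have : dist w (0, initialState p q e nl ng (-resL p q)) < ε := hw
    rw [Prod.dist_eq, max_lt_iff] at this
    rw [Metric.mem_ball, Prod.dist_eq, Prod.dist_eq]
    simp only [J, dist_self]
    exact max_lt this.1 (max_lt this.2 hε)
  have hJa : ∀ (t : ℝ) (w : ℝ × V), AnalyticAt ℝ (fun s : ℝ × (ℝ × V) => (s.1, J s.2)) (t, w) :=
    fun t w => analyticAt_fst.prod ((analyticAt_fst.fun_comp analyticAt_snd).prod
      ((analyticAt_snd.fun_comp analyticAt_snd).prod analyticAt_const))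
  have hΦa : ∀ w ∈ Metric.ball ((0 : ℝ), initialState p q e nl ng (-resL p q)) ε,
      ∀ t ∈ Ioo (-b) b, AnalyticAt ℝ (fun s : ℝ × (ℝ × V) => Φ (s.1, J s.2)) (t, w) :=
    fun w hw t ht => AnalyticAt.fun_comp (f := fun s : ℝ × (ℝ × V) => (s.1, J s.2))
      ((hΦ _ (hJ w hw)).2 t ht) (hJa t w)
  have hm : ∀ w ∈ Metric.ball ((0 : ℝ), initialState p q e nl ng (-resL p q)) ε,
      ∀ t ∈ Ioo (-b) b, (Φ (t, J w)).1 = w.1 := fun w hw t ht => by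
    rw [eq_of_hasDerivAt_zero (u := fun t => (Φ (t, J w)).1)
      (fun s hs => hasDerivAt_fst ((hΦ _ (hJ w hw)).1 s hs).2) ht h0, hΦ0 _ (hJ w hw)]
  refine ⟨ε, fun s => (Φ (s.1, J s.2)).2.1, fun s => (Φ (s.1, J s.2)).2.2, hε,
    fun w hw t ht => ?_, fun w hw => ?_, fun w hw t ht => ?_, fun w hw => ?_, fun w hw t ht => ?_,
    fun w hw t ht => ?_⟩
  · have h := (hΦ _ (hJ w hw)).1 t ht
    have h1 := hm w hw t ht
    constructor
    · have h2 : (Φ (t, J w)).2.1 ∈ domain (Φ (t, J w)).1 := h.1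
      rwa [h1] at h2
    · have h2 := hasDerivAt_fst (hasDerivAt_snd h.2)
      change HasDerivAt _ (vectorField (Φ (t, J w)).1 (Φ (t, J w)).2.1) t at h2
      rwa [h1] at h2
  · simp only [hΦ0 _ (hJ w hw)]
    rfl
  · exact (analyticAt_fst.fun_comp analyticAt_snd).fun_comp (hΦa w hw t ht)
  · simp only [hΦ0 _ (hJ w hw)]
    rfl
  · exact (analyticAt_snd.fun_comp analyticAt_snd).fun_comp (hΦa w hw t ht)
  · have h := (hΦ _ (hJ w hw)).1 t ht
    have h2 := hasDerivAt_snd (hasDerivAt_snd h.2)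
    change HasDerivAt _ ((linField ((Φ (t, J w)).1, (Φ (t, J w)).2.1)).comp
      (Φ (t, J w)).2.2) t at h2
    rwa [hm w hw t ht] at h2

end Variational

/-! ### Symmetric solutions -/

section Symmetry

lemma contDiffAt_vectorField {μ : ℝ} : ∀ x ∈ domain μ, ContDiffAt ℝ 1 (vectorField μ) x :=
  fun _ hx => (analyticAt_vectorField hx).contDiffAt

lemma SolvesOn.add_angleShift {μ : ℝ} {z : ℝ → Fin 4 → ℝ} {a b : ℝ}
    (hz : SolvesOn (vectorField μ) (domain μ) z a b) (k m : ℤ) :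
    SolvesOn (vectorField μ) (domain μ) (fun t => z t + angleShift k m) a b := fun t ht => by
  refine ⟨add_angleShift_mem_domain k m (hz t ht).1, ?_⟩
  rw [vectorField_add_angleShift (retrograde_of_mem_domain (hz t ht).1)]
  exact (hz t ht).2.add_const _

lemma SolvesOn.comp_add {μ : ℝ} {z : ℝ → Fin 4 → ℝ} {a b : ℝ}
    (hz : SolvesOn (vectorField μ) (domain μ) z a b) (s : ℝ) :
    SolvesOn (vectorField μ) (domain μ) (fun t => z (t + s)) (a - s) (b - s) := fun t ht => by
  have ht' : t + s ∈ Ioo a b := ⟨by linarith [ht.1], by linarith [ht.2]⟩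
  exact ⟨(hz _ ht').1, HasDerivAt.comp_add_const t s (hz _ ht').2⟩

lemma SolvesOn.reflect {μ : ℝ} {z : ℝ → Fin 4 → ℝ} {b : ℝ}
    (hz : SolvesOn (vectorField μ) (domain μ) z (-b) b) :
    SolvesOn (vectorField μ) (domain μ) (fun t => reflect (z (-t))) (-b) b := fun t ht => by
  have ht' : -t ∈ Ioo (-b) b := ⟨by linarith [ht.2], by linarith [ht.1]⟩
  refine ⟨reflect_mem_domain (hz _ ht').1, ?_⟩
  rw [vectorField_reflect (hz _ ht').1]
  have h := HasDerivAt.scomp t (hz _ ht').2 (hasDerivAt_neg t)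
  have h2 := R3BP.reflect.hasFDerivAt.comp_hasDerivAt t h
  simpa [Function.comp_def] using h2

lemma IsSolution.solvesOn {μ : ℝ} {z : ℝ → Fin 4 → ℝ} (hz : IsSolution μ z) (a b : ℝ) :
    SolvesOn (vectorField μ) (domain μ) z a b := fun t _ => hz t

lemma IsSolution.eq {μ : ℝ} {z w : ℝ → Fin 4 → ℝ} (hz : IsSolution μ z) (hw : IsSolution μ w)
    {t₀ : ℝ} (h : z t₀ = w t₀) : z = w := by
  funext t
  have h1 : t₀ ∈ Ioo (-(|t| + |t₀| + 1)) (|t| + |t₀| + 1) :=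
    abs_lt.1 (by linarith [abs_nonneg t])
  have h2 : t ∈ Ioo (-(|t| + |t₀| + 1)) (|t| + |t₀| + 1) :=
    abs_lt.1 (by linarith [abs_nonneg t₀])
  exact (hz.solvesOn _ _).eqOn contDiffAt_vectorField (hw.solvesOn _ _) h1 h h2

/-- A solution that starts on the fixed set `l ≡ 0`, `g ≡ 0 (mod π)` of the reversing reflection is
mapped to itself by it. -/
lemma SolvesOn.symmetric {μ : ℝ} {z : ℝ → Fin 4 → ℝ} {b : ℝ} (hb : 0 < b)
    (hz : SolvesOn (vectorField μ) (domain μ) z (-b) b) {p q : ℕ} {e L : ℝ} {nl ng : Fin 2}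
    (h0 : z 0 = initialState p q e nl ng L) {t : ℝ} (ht : t ∈ Ioo (-b) b) :
    z t = R3BP.reflect (z (-t)) + angleShift (nl : ℕ) (ng : ℕ) := by
  refine hz.eqOn contDiffAt_vectorField (hz.reflect.add_angleShift (nl : ℕ) (ng : ℕ))
    (t₀ := 0) ⟨by linarith, hb⟩ ?_ ht
  simp only [neg_zero, h0]
  rw [reflect_apply]
  funext i
  fin_cases i <;> simp [initialState, angleShift] <;> ring

/-- The half-period condition is equivalent to periodicity at the symmetric times `±T/2`. -/
lemma half_period_iff {μ : ℝ} {z : ℝ → Fin 4 → ℝ} {b : ℝ}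
    (hz : SolvesOn (vectorField μ) (domain μ) z (-b) b) {p q : ℕ} {e L : ℝ} {nl ng : Fin 2}
    (h0 : z 0 = initialState p q e nl ng L) {T : ℝ} (hT : 0 < T) (hTb : T < b) :
    (z (T / 2) 2 = (nl : ℕ) * Real.pi - q * Real.pi ∧
      z (T / 2) 3 = (ng : ℕ) * Real.pi - p * Real.pi) ↔
    z (T / 2) = z (-(T / 2)) + angleShift (-q) (-p) := by
  have h := hz.symmetric (hT.trans hTb) h0 (t := -(T / 2)) ⟨by linarith, by linarith⟩
  rw [neg_neg, reflect_apply] at h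
  have h2 : z (-(T / 2)) 2 = -z (T / 2) 2 + 2 * Real.pi * (nl : ℕ) := by
    rw [h]; simp [angleShift]
  have h3 : z (-(T / 2)) 3 = -z (T / 2) 3 + 2 * Real.pi * (ng : ℕ) := by
    rw [h]; simp [angleShift]
  constructor
  · rintro ⟨hl, hg⟩
    rw [h]
    funext i
    fin_cases i
    · simp [angleShift]
    · simp [angleShift]
    · simp [angleShift]; rw [hl]; ring
    · simp [angleShift]; rw [hg]; ring
  · intro hper
    have e2 := congrFun hper 2
    have e3 := congrFun hper 3
    rw [Pi.add_apply, h2, (angleShift_apply _ _).2.2.1] at e2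
    rw [Pi.add_apply, h3, (angleShift_apply _ _).2.2.2] at e3
    push_cast at e2 e3
    constructor <;> linarith

lemma SolvesOn.periodic {μ : ℝ} {z : ℝ → Fin 4 → ℝ} {b : ℝ}
    (hz : SolvesOn (vectorField μ) (domain μ) z (-b) b) {T : ℝ} (hT : 0 < T) (hTb : T < b)
    {k m : ℤ} (h : z (T / 2) = z (-(T / 2)) + angleShift k m) {t : ℝ}
    (ht : t ∈ Ioo (-b) b) (ht' : t + T ∈ Ioo (-b) b) : z (t + T) = z t + angleShift k m := by
  refine SolvesOn.eqOn contDiffAt_vectorField (a := -b) (b := b - T) (t₀ := -(T / 2))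
    ((hz.comp_add T).mono (by linarith) le_rfl) ((hz.mono le_rfl (by linarith)).add_angleShift k m)
    ⟨by linarith, by linarith⟩ ?_ ⟨ht.1, by linarith [ht'.2]⟩
  rw [← h]
  congr 1
  ring

/-- A function on `(-b, b)` that is equivariant under the shift by `T < b` extends to `ℝ`. -/
lemma exists_equivariant_extension {A : Type*} (σ : Equiv.Perm A) (u : ℝ → A) {T b : ℝ}
    (hT : 0 < T) (hTb : T < b)
    (h : ∀ t, t ∈ Ioo (-b) b → t + T ∈ Ioo (-b) b → u (t + T) = σ (u t)) :
    ∃ z : ℝ → A, (∀ t, z (t + T) = σ (z t)) ∧ ∀ t ∈ Ioo (-b) b, z t = u t := by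
  have hn : ∀ n : ℕ, ∀ s, s ∈ Ioo (-b) b → s + n * T ∈ Ioo (-b) b →
      u (s + n * T) = (σ ^ n) (u s) := by
    intro n
    induction n with
    | zero => intro s _ _; simp
    | succ n ih =>
      intro s hs hsn
      rw [Nat.cast_succ] at hsn ⊢
      have hpos : 0 ≤ (n : ℝ) * T := by positivity
      have hmid : s + n * T ∈ Ioo (-b) b := ⟨by linarith [hs.1], by linarith [hsn.2]⟩
      have e : s + (n + 1) * T = s + n * T + T := by ring
      rw [e] at hsn ⊢
      rw [h _ hmid hsn, ih s hs hmid, pow_succ']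
      rfl
  refine ⟨fun t => (σ ^ ⌊t / T⌋) (u (t - ⌊t / T⌋ * T)), fun t => ?_, fun t ht => ?_⟩
  · have e : ⌊(t + T) / T⌋ = ⌊t / T⌋ + 1 := by
      rw [add_div, div_self hT.ne', Int.floor_add_one]
    simp only [e]
    rw [add_comm ⌊t / T⌋ 1, zpow_add, zpow_one, Int.cast_add, Int.cast_one]
    have e2 : t + T - (1 + ⌊t / T⌋) * T = t - ⌊t / T⌋ * T := by ring
    rw [e2]
    rfl
  · have h1 : 0 ≤ t - ⌊t / T⌋ * T := by
      have := mul_le_mul_of_nonneg_right (Int.floor_le (t / T)) hT.le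
      rw [div_mul_cancel₀ _ hT.ne'] at this
      linarith
    have h2 : t - ⌊t / T⌋ * T < T := by
      have := mul_lt_mul_of_pos_right (Int.lt_floor_add_one (t / T)) hT
      rw [div_mul_cancel₀ _ hT.ne', add_mul] at this
      linarith
    have hs : t - ⌊t / T⌋ * T ∈ Ioo (-b) b := ⟨by linarith, by linarith⟩
    obtain ⟨n, hn' | hn'⟩ := Int.eq_nat_or_neg ⌊t / T⌋
    · simp only [hn'] at hs ⊢
      have := hn n _ hs (by rw [Int.cast_natCast, sub_add_cancel]; exact ht)
      rw [Int.cast_natCast, sub_add_cancel] at this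
      rw [zpow_natCast, Int.cast_natCast, ← this]
    · simp only [hn'] at hs ⊢
      have e : t - ((-(n : ℤ) : ℤ) : ℝ) * T = t + n * T := by push_cast; ring
      rw [e] at hs ⊢
      rw [hn n t ht hs, zpow_neg, zpow_natCast]
      simp

lemma add_nsmul_of_shift {A : Type*} [AddCommGroup A] {z : ℝ → A} {T : ℝ} {c : A}
    (h : ∀ t, z (t + T) = z t + c) (n : ℤ) (t : ℝ) : z (t + n * T) = z t + n • c := by
  induction n using Int.induction_on with
  | zero => simp
  | succ n ih =>
    have e : t + ((n + 1 : ℤ) : ℝ) * T = t + (n : ℤ) * T + T := by push_cast; ring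
    rw [e, h, ih, add_smul, one_smul, add_assoc]
  | pred n ih =>
    have e : t + ((-n - 1 : ℤ) : ℝ) * T + T = t + (-n : ℤ) * T := by push_cast; ring
    have := h (t + ((-n - 1 : ℤ) : ℝ) * T)
    rw [e, ih] at this
    rw [sub_smul, one_smul, ← add_sub_assoc, this, add_sub_cancel_right]

lemma exists_int_shift_mem {T b : ℝ} (hT : 0 < T) (hTb : T < b) (t : ℝ) :
    ∃ n : ℤ, t - n * T ∈ Ioo (-b) b := by
  refine ⟨⌊t / T⌋, ?_⟩
  have h1 := mul_le_mul_of_nonneg_right (Int.floor_le (t / T)) hT.le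
  have h2 := mul_lt_mul_of_pos_right (Int.lt_floor_add_one (t / T)) hT
  rw [div_mul_cancel₀ _ hT.ne'] at h1 h2
  rw [add_mul] at h2
  exact ⟨by linarith, by linarith⟩

lemma zsmul_angleShift (n k m : ℤ) : n • angleShift k m = angleShift (n * k) (n * m) := by
  funext i
  fin_cases i <;> simp [angleShift] <;> ring

/-- A solution on `(-b, b)` that is periodic up to a shift of the angles extends to a solution on
`ℝ`. -/
lemma SolvesOn.exists_extension {μ : ℝ} {u : ℝ → Fin 4 → ℝ} {T b : ℝ} (hT : 0 < T) (hTb : T < b)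
    (hu : SolvesOn (vectorField μ) (domain μ) u (-b) b) {k m : ℤ}
    (h : ∀ t, t ∈ Ioo (-b) b → t + T ∈ Ioo (-b) b → u (t + T) = u t + angleShift k m) :
    ∃ z, IsSolution μ z ∧ (∀ t, z (t + T) = z t + angleShift k m) ∧
      ∀ t ∈ Ioo (-b) b, z t = u t := by
  obtain ⟨z, hz, hzu⟩ := exists_equivariant_extension (Equiv.addRight (angleShift k m)) u hT hTb h
  replace hz : ∀ t, z (t + T) = z t + angleShift k m := hz
  refine ⟨z, fun t => ?_, hz, hzu⟩
  obtain ⟨n, hn⟩ := exists_int_shift_mem hT hTb t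
  have hzsol : SolvesOn (vectorField μ) (domain μ) z (-b) b := fun s hs => by
    rw [hzu s hs]
    refine ⟨(hu s hs).1, (hu s hs).2.congr_of_eventuallyEq ?_⟩
    filter_upwards [isOpen_Ioo.mem_nhds hs] with r hr
    exact hzu r hr
  have h1 := ((hzsol.comp_add (-(n * T))).add_angleShift (n * k) (n * m)) t
    ⟨by linarith [hn.1], by linarith [hn.2]⟩
  have h2 : (fun s => z (s + -(n * T)) + angleShift (n * k) (n * m)) = z := by
    funext s
    have := add_nsmul_of_shift hz n (s + -(n * T))
    rw [zsmul_angleShift] at this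
    rw [neg_add_cancel_right] at this
    exact this.symm
  rw [h2] at h1
  exact h1

end Symmetry

/-! ### The half-period equations -/

section HalfPeriod

variable {p q : ℕ} {e : ℝ} {nl ng : Fin 2}

lemma analyticAt_initialState {v : ℝ × ℝ} (hv : v.1 ∈ Ioo (0 : ℝ) 1) :
    AnalyticAt ℝ (fun v : ℝ × ℝ => initialState p q v.1 nl ng v.2) v := by
  have h : AnalyticAt ℝ (fun v : ℝ × ℝ => √(1 - v.1 ^ 2)) v :=
    analyticAt_sqrt_comp (analyticAt_const.sub (analyticAt_fst.pow 2)) (by nlinarith [hv.1, hv.2])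
  refine AnalyticAt.pi fun i => ?_
  fin_cases i
  · exact analyticAt_snd
  · exact (analyticAt_const.mul h).neg
  · exact analyticAt_const
  · exact analyticAt_const

/-- The values of the angles at time `T/2`, as a function of `((μ, e), (T, L))`. -/
def halfAngles (p q : ℕ) (nl ng : Fin 2) (ζ : ℝ × (ℝ × (Fin 4 → ℝ)) → Fin 4 → ℝ)
    (v : (ℝ × ℝ) × (ℝ × ℝ)) : ℝ × ℝ :=
  (ζ (v.2.1 / 2, (v.1.1, initialState p q v.1.2 nl ng v.2.2)) 2,
    ζ (v.2.1 / 2, (v.1.1, initialState p q v.1.2 nl ng v.2.2)) 3)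

/-- The values that the angles take after half a period. -/
def halfTarget (p q : ℕ) (nl ng : Fin 2) : ℝ × ℝ :=
  ((nl : ℕ) * Real.pi - q * Real.pi, (ng : ℕ) * Real.pi - p * Real.pi)

/-- The point `((0, e), (2πp, -(p/q)^{1/3}))` about which the half-period equations are solved. -/
def basePoint (p q : ℕ) (e : ℝ) : (ℝ × ℝ) × (ℝ × ℝ) := ((0, e), (2 * Real.pi * p, -resL p q))

variable {b ε : ℝ} {ζ : ℝ × (ℝ × (Fin 4 → ℝ)) → Fin 4 → ℝ}
  {Y : ℝ × (ℝ × (Fin 4 → ℝ)) → (Fin 4 → ℝ) →L[ℝ] (Fin 4 → ℝ)}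

lemma IsFlowNear.base_mem (hF : IsFlowNear (initialState p q e nl ng (-resL p q)) b ε ζ Y) :
    ((0 : ℝ), initialState p q e nl ng (-resL p q)) ∈
      Metric.ball ((0 : ℝ), initialState p q e nl ng (-resL p q)) ε := Metric.mem_ball_self hF.pos

lemma tendsto_initialState (he : e ∈ Ioo (0 : ℝ) 1) :
    Tendsto (fun v : (ℝ × ℝ) × (ℝ × ℝ) => (v.1.1, initialState p q v.1.2 nl ng v.2.2))
      (𝓝 (basePoint p q e)) (𝓝 (0, initialState p q e nl ng (-resL p q))) := by
  have h : ContinuousAt (fun v : (ℝ × ℝ) × (ℝ × ℝ) => initialState p q v.1.2 nl ng v.2.2)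
      (basePoint p q e) :=
    ContinuousAt.comp (f := fun v : (ℝ × ℝ) × (ℝ × ℝ) => (v.1.2, v.2.2))
      (g := fun v : ℝ × ℝ => initialState p q v.1 nl ng v.2)
      (analyticAt_initialState (v := (e, -resL p q)) he).continuousAt (by fun_prop)
  exact Tendsto.prodMk_nhds (Continuous.tendsto' (by fun_prop) _ _ rfl) h

lemma analyticAt_halfAngles (hF : IsFlowNear (initialState p q e nl ng (-resL p q)) b ε ζ Y)
    (he : e ∈ Ioo (0 : ℝ) 1) (hp : 0 < p) (hb : 2 * Real.pi * p < b) :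
    AnalyticAt ℝ (halfAngles p q nl ng ζ) (basePoint p q e) := by
  have hp' : 0 < 2 * Real.pi * p := by positivity
  have hin : AnalyticAt ℝ (fun v : (ℝ × ℝ) × (ℝ × ℝ) => initialState p q v.1.2 nl ng v.2.2)
      (basePoint p q e) :=
    AnalyticAt.fun_comp (f := fun v : (ℝ × ℝ) × (ℝ × ℝ) => (v.1.2, v.2.2))
      (g := fun v : ℝ × ℝ => initialState p q v.1 nl ng v.2)
      (x := (((0, e), (2 * Real.pi * p, -resL p q)) : (ℝ × ℝ) × (ℝ × ℝ)))
      (analyticAt_initialState (v := (e, -resL p q)) he)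
      ((analyticAt_snd.fun_comp analyticAt_fst).prod (analyticAt_snd.fun_comp analyticAt_snd))
  have h : AnalyticAt ℝ (fun v : (ℝ × ℝ) × (ℝ × ℝ) =>
      ζ (v.2.1 / 2, (v.1.1, initialState p q v.1.2 nl ng v.2.2))) (basePoint p q e) := by
    refine AnalyticAt.fun_comp (f := fun v : (ℝ × ℝ) × (ℝ × ℝ) =>
      (v.2.1 / 2, (v.1.1, initialState p q v.1.2 nl ng v.2.2)))
      (x := (((0, e), (2 * Real.pi * p, -resL p q)) : (ℝ × ℝ) × (ℝ × ℝ)))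
      (hF.analytic _ hF.base_mem (2 * Real.pi * p / 2) ⟨by linarith, by linarith⟩) ?_
    exact ((analyticAt_fst.fun_comp analyticAt_snd).div_const).prod
      ((analyticAt_fst.fun_comp analyticAt_fst).prod hin)
  exact (AnalyticAt.fun_comp (g := fun z : Fin 4 → ℝ => z 2) (analyticAt_coord 2 _) h).prod
    (AnalyticAt.fun_comp (g := fun z : Fin 4 → ℝ => z 3) (analyticAt_coord 3 _) h)

lemma halfAngles_zero (hF : IsFlowNear (initialState p q e nl ng (-resL p q)) b ε ζ Y)
    {T L : ℝ} (hT : T / 2 ∈ Ioo (-b) b) (hL : ((0 : ℝ), initialState p q e nl ng L) ∈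
      Metric.ball ((0 : ℝ), initialState p q e nl ng (-resL p q)) ε) :
    halfAngles p q nl ng ζ ((0, e), (T, L)) =
      ((nl : ℕ) * Real.pi + T / 2 / L ^ 3, (ng : ℕ) * Real.pi - T / 2) := by
  have hs : SolvesOn (vectorField 0) (domain 0)
      (fun t => ζ (t, ((0 : ℝ), initialState p q e nl ng L))) (-b) b :=
    hF.solves ((0 : ℝ), initialState p q e nl ng L) hL
  have h := eq_of_solvesOn_zero hs hT
  simp only [hF.zero _ hL] at h
  rw [halfAngles, h]
  rfl

/-- The half-period equations can be solved for `(T, L)` in terms of `(μ, e)`: their Jacobian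
determinant at `μ = 0` does not vanish because the Kepler frequency `1 / L³` depends on `L`. -/
lemma exists_half_period (hF : IsFlowNear (initialState p q e nl ng (-resL p q)) b ε ζ Y)
    (he : e ∈ Ioo (0 : ℝ) 1) (hp : 0 < p) (hq : 0 < q) (hb : 2 * Real.pi * p < b) :
    ∃ σ : ℝ × ℝ → ℝ × ℝ, AnalyticAt ℝ σ (0, e) ∧ σ (0, e) = (2 * Real.pi * p, -resL p q) ∧
      (∀ᶠ x in 𝓝 ((0 : ℝ), e), halfAngles p q nl ng ζ (x, σ x) = halfTarget p q nl ng) ∧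
      ∀ᶠ v in 𝓝 (basePoint p q e),
        halfAngles p q nl ng ζ v = halfTarget p q nl ng → σ v.1 = v.2 := by
  have hR := resL_pos hp hq
  have hp' : 0 < 2 * Real.pi * p := by positivity
  have hω : ContDiffAt ℝ ω (halfAngles p q nl ng ζ) (basePoint p q e) :=
    (analyticAt_halfAngles hF he hp hb).contDiffAt
  have hbase : halfAngles p q nl ng ζ (basePoint p q e) = halfTarget p q nl ng := by
    rw [basePoint, halfAngles_zero hF ⟨by linarith, by linarith⟩ hF.base_mem, halfTarget]
    have hp0 : (p : ℝ) ≠ 0 := by positivity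
    have e1 : (2 * Real.pi * p) / 2 / (-resL p q) ^ 3 = -(q * Real.pi) := by
      rw [div_eq_mul_one_div, one_div_neg_resL_pow_three]
      field_simp
    rw [e1]
    ext <;> simp <;> ring
  have hinv : (fderiv ℝ (halfAngles p q nl ng ζ) (basePoint p q e) ∘L
      .inr ℝ (ℝ × ℝ) (ℝ × ℝ)).IsInvertible := by
    have h1 : HasFDerivAt (fun w : ℝ × ℝ => halfAngles p q nl ng ζ ((0, e), w))
        (fderiv ℝ (halfAngles p q nl ng ζ) (basePoint p q e) ∘L .inr ℝ (ℝ × ℝ) (ℝ × ℝ))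
        (2 * Real.pi * p, -resL p q) :=
      HasFDerivAt.comp (f := fun w : ℝ × ℝ => (((0, e) : ℝ × ℝ), w)) _
        (hω.differentiableAt (by simp)).hasFDerivAt (hasFDerivAt_prodMk_right _ _)
    set A : ℝ := 1 / 2 / (-resL p q) ^ 3 with hA
    set B : ℝ := (2 * Real.pi * p) / 2 * (-3 / (-resL p q) ^ 4) with hB
    have hB0 : B ≠ 0 := by
      refine mul_ne_zero (by positivity) (div_ne_zero (by norm_num) (pow_ne_zero _ ?_))
      exact neg_ne_zero.2 hR.ne'
    let fstL := ContinuousLinearMap.fst ℝ ℝ ℝ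
    let sndL := ContinuousLinearMap.snd ℝ ℝ ℝ
    have h2 : HasFDerivAt (fun w : ℝ × ℝ => halfAngles p q nl ng ζ ((0, e), w))
        ((A • fstL + B • sndL).prod (-((1 / 2 : ℝ) • fstL))) (2 * Real.pi * p, -resL p q) := by
      have hL : HasDerivAt (fun L : ℝ => (L ^ 3)⁻¹) (-3 / (-resL p q) ^ 4) (-resL p q) := by
        have hR0 : -resL p q ≠ 0 := neg_ne_zero.2 hR.ne'
        refine ((hasDerivAt_pow 3 (-resL p q)).fun_inv (pow_ne_zero 3 hR0)).congr_deriv ?_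
        push_cast
        field_simp
      have hfst : HasFDerivAt (fun w : ℝ × ℝ => w.1 / 2) ((1 / 2 : ℝ) • fstL)
          (2 * Real.pi * p, -resL p q) := by
        have h := (hasFDerivAt_fst (𝕜 := ℝ) (E := ℝ) (F := ℝ)
          (p := (2 * Real.pi * p, -resL p q))).const_mul (1 / 2 : ℝ)
        refine h.congr_of_eventuallyEq (Eventually.of_forall fun w => ?_)
        simp only
        ring
      have hexp : HasFDerivAt (fun w : ℝ × ℝ => (((nl : ℕ) : ℝ) * Real.pi + w.1 / 2 * (w.2 ^ 3)⁻¹,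
          ((ng : ℕ) : ℝ) * Real.pi - w.1 / 2))
          ((A • fstL + B • sndL).prod (-((1 / 2 : ℝ) • fstL))) (2 * Real.pi * p, -resL p q) := by
        refine HasFDerivAt.prodMk ?_ (hfst.const_sub _)
        have h3 : HasFDerivAt (fun w : ℝ × ℝ => (w.2 ^ 3)⁻¹)
            ((-3 / (-resL p q) ^ 4) • sndL) (2 * Real.pi * p, -resL p q) :=
          HasDerivAt.comp_hasFDerivAt (h₂ := fun L : ℝ => (L ^ 3)⁻¹) (f := fun w : ℝ × ℝ => w.2)
            (2 * Real.pi * p, -resL p q) hL hasFDerivAt_snd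
        refine ((hfst.mul h3).const_add _).congr_fderiv ?_
        ext
        · simp [fstL, sndL, hA, hB]; ring
        · simp [fstL, sndL, hA, hB]
      refine hexp.congr_of_eventuallyEq ?_
      have hc1 : ∀ᶠ w : ℝ × ℝ in 𝓝 (2 * Real.pi * p, -resL p q), w.1 / 2 ∈ Ioo (-b) b :=
        ContinuousAt.preimage_mem_nhds (f := fun w : ℝ × ℝ => w.1 / 2) (by fun_prop)
          (isOpen_Ioo.mem_nhds ⟨by linarith, by linarith⟩)
      have hc2 : Tendsto (fun w : ℝ × ℝ => (((0, e) : ℝ × ℝ), w))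
          (𝓝 (2 * Real.pi * p, -resL p q)) (𝓝 (basePoint p q e)) :=
        Continuous.tendsto' (by fun_prop) _ _ rfl
      filter_upwards [hc1, hc2.eventually ((tendsto_initialState he).eventually
        (Metric.isOpen_ball.mem_nhds hF.base_mem))] with w hw1 hw2
      rw [show w = (w.1, w.2) from rfl, halfAngles_zero hF hw1 hw2]
      simp [div_eq_mul_inv]
    rw [h1.unique h2]
    refine ContinuousLinearMap.IsInvertible.of_inverse
      (g := ((-2 : ℝ) • sndL).prod ((1 / B) • fstL + (2 * A / B) • sndL)) ?_ ?_
    · ext <;> simp [fstL, sndL] <;> (field_simp; try ring)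
    · ext <;> simp [fstL, sndL] <;> (field_simp; try ring)
  refine ⟨hω.implicitFunction (by simp) hinv,
    (hω.contDiffAt_implicitFunction (by simp) hinv).analyticAt,
    hω.implicitFunction_apply_self (by simp) hinv, ?_, ?_⟩
  · filter_upwards [hω.eventually_apply_implicitFunction (by simp) hinv] with x hx
    rw [hx, hbase]
  · filter_upwards [hω.eventually_apply_eq_iff_implicitFunction (by simp) hinv] with v hv h
    exact hv.1 (by rw [h, hbase])

end HalfPeriod

/-! ### Families of periodic solutions -/

section Families

variable {p q : ℕ} {e : ℝ} {nl ng : Fin 2} {b ε : ℝ} {ζ : ℝ × (ℝ × (Fin 4 → ℝ)) → Fin 4 → ℝ}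
  {Y : ℝ × (ℝ × (Fin 4 → ℝ)) → (Fin 4 → ℝ) →L[ℝ] (Fin 4 → ℝ)}

lemma IsFlowNear.eq_unperturbed
    (hF : IsFlowNear (initialState p q e nl ng (-resL p q)) b ε ζ Y) {t : ℝ}
    (ht : t ∈ Ioo (-b) b) :
    ζ (t, ((0 : ℝ), initialState p q e nl ng (-resL p q))) = unperturbed p q e nl ng t := by
  have hs : SolvesOn (vectorField 0) (domain 0)
      (fun t => ζ (t, ((0 : ℝ), initialState p q e nl ng (-resL p q)))) (-b) b :=
    hF.solves ((0 : ℝ), initialState p q e nl ng (-resL p q)) hF.base_mem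
  have h := eq_of_solvesOn_zero hs ht
  simp only [hF.zero _ hF.base_mem] at h
  rw [h]
  have h3 : t / (-resL p q) ^ 3 = -(q * t / p) := by
    rw [div_eq_mul_one_div, one_div_neg_resL_pow_three]; ring
  funext i
  fin_cases i
  · rfl
  · rfl
  · change (nl : ℕ) * Real.pi + t / (-resL p q) ^ 3 = (nl : ℕ) * Real.pi - q * t / p
    rw [h3]; ring
  · rfl

/-- A solution agrees with the flow through its initial state. -/
lemma IsFlowNear.eq_of_isSolution {x₀ : Fin 4 → ℝ} (hF : IsFlowNear x₀ b ε ζ Y) {μ : ℝ}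
    {z : ℝ → Fin 4 → ℝ} (hz : IsSolution μ z) (hw : (μ, z 0) ∈ Metric.ball ((0 : ℝ), x₀) ε)
    {t : ℝ} (ht : t ∈ Ioo (-b) b) : z t = ζ (t, (μ, z 0)) := by
  refine (hz.solvesOn (-b) b).eqOn contDiffAt_vectorField (hF.solves (μ, z 0) hw) (t₀ := 0)
    ⟨by linarith [ht.1, ht.2], by linarith [ht.1, ht.2]⟩ ?_ ht
  rw [hF.zero _ hw]

lemma abs_two_pi_mul_int_lt {n : ℤ} (h : |2 * Real.pi * (n : ℝ)| < 2 * Real.pi) : n = 0 := by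
  rw [abs_mul, abs_of_pos Real.two_pi_pos] at h
  have h2 : |(n : ℝ)| < 1 := by
    by_contra hn
    nlinarith [Real.two_pi_pos, not_lt.1 hn]
  rw [← Int.cast_abs] at h2
  have : |n| < 1 := by exact_mod_cast h2
  exact Int.abs_lt_one_iff.1 this

lemma continuousAt_flow_initialState
    (hF : IsFlowNear (initialState p q e nl ng (-resL p q)) b ε ζ Y)
    (he : e ∈ Ioo (0 : ℝ) 1) (hp : 0 < p) (hb : 2 * Real.pi * p < b) :
    ContinuousAt (fun v : (ℝ × ℝ) × (ℝ × ℝ) =>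
      ζ (v.2.1, (v.1.1, initialState p q v.1.2 nl ng v.2.2))) (basePoint p q e) := by
  have hp' : 0 < 2 * Real.pi * p := by positivity
  refine ContinuousAt.comp (f := fun v : (ℝ × ℝ) × (ℝ × ℝ) =>
      (v.2.1, (v.1.1, initialState p q v.1.2 nl ng v.2.2)))
      (x := (((0, e), (2 * Real.pi * p, -resL p q)) : (ℝ × ℝ) × (ℝ × ℝ)))
      (hF.analytic _ hF.base_mem (2 * Real.pi * p) ⟨by linarith, by linarith⟩).continuousAt ?_
  exact ContinuousAt.prodMk (by fun_prop) (tendsto_initialState he)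

/-- Every periodic solution with symmetric initial state near the resonant one satisfies the
half-period equations. -/
lemma eventually_halfAngles_of_periodic
    (hF : IsFlowNear (initialState p q e nl ng (-resL p q)) b ε ζ Y)
    (he : e ∈ Ioo (0 : ℝ) 1) (hp : 0 < p) (hb : 2 * Real.pi * p < b) :
    ∀ᶠ v in 𝓝 (basePoint p q e), ∀ z, IsPeriodicSolution v.1.1 z v.2.1 →
      z 0 = initialState p q v.1.2 nl ng v.2.2 →
      halfAngles p q nl ng ζ v = halfTarget p q nl ng := by
  have hp' : 0 < 2 * Real.pi * p := by positivity
  have hc := continuousAt_flow_initialState hF he hp hb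
  have hval : ζ (2 * Real.pi * p, ((0 : ℝ), initialState p q e nl ng (-resL p q))) =
      unperturbed p q e nl ng (2 * Real.pi * p) :=
    hF.eq_unperturbed ⟨by linarith, by linarith⟩
  have hpr : ∀ i : Fin 4, ContinuousAt (fun v : (ℝ × ℝ) × (ℝ × ℝ) =>
      ζ (v.2.1, (v.1.1, initialState p q v.1.2 nl ng v.2.2)) i) (basePoint p q e) :=
    fun i => (continuous_apply i).continuousAt.comp hc
  have h2 := (hpr 2).eventually (Metric.ball_mem_nhds _ Real.two_pi_pos)
  have h3 := (hpr 3).eventually (Metric.ball_mem_nhds _ Real.two_pi_pos)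
  have hT : ∀ᶠ v in 𝓝 (basePoint p q e), v.2.1 ∈ Ioo 0 b :=
    ContinuousAt.preimage_mem_nhds (f := fun v : (ℝ × ℝ) × (ℝ × ℝ) => v.2.1) (by fun_prop)
      (isOpen_Ioo.mem_nhds ⟨hp', hb⟩)
  have hball := (tendsto_initialState (p := p) (q := q) (nl := nl) (ng := ng) he).eventually
    (Metric.isOpen_ball.mem_nhds hF.base_mem)
  filter_upwards [h2, h3, hT, hball] with v h2 h3 hT hball z hz hz0
  obtain ⟨hsol, hTpos, k, m, hper⟩ := hz
  have hw : (v.1.1, z 0) ∈ Metric.ball ((0 : ℝ), initialState p q e nl ng (-resL p q)) ε := by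
    rw [hz0]; exact hball
  have hzζ : ∀ t ∈ Ioo (-b) b, z t = ζ (t, (v.1.1, initialState p q v.1.2 nl ng v.2.2)) :=
    fun t ht => by rw [hF.eq_of_isSolution hsol hw ht, hz0]
  have hzT := hzζ v.2.1 ⟨by linarith [hT.1, hT.2], hT.2⟩
  have hsh := hper 0
  rw [zero_add, hzT, hz0] at hsh
  have hval' : ζ ((basePoint p q e).2.1, ((basePoint p q e).1.1,
      initialState p q (basePoint p q e).1.2 nl ng (basePoint p q e).2.2)) =
      unperturbed p q e nl ng (2 * Real.pi * p) := hval
  have hp0 : (p : ℝ) ≠ 0 := by positivity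
  have hk : k = -q := by
    have h2' : dist _ _ < _ := h2
    rw [hval', hsh, Real.dist_eq, Pi.add_apply, (angleShift_apply _ _).2.2.1] at h2'
    have : initialState p q v.1.2 nl ng v.2.2 2 + 2 * Real.pi * k -
        unperturbed p q e nl ng (2 * Real.pi * p) 2 = 2 * Real.pi * ((k + q : ℤ) : ℝ) := by
      simp only [initialState, unperturbed, Matrix.cons_val]
      push_cast
      field_simp
      ring
    rw [this] at h2'
    linarith [abs_two_pi_mul_int_lt h2']
  have hm : m = -p := by
    have h3' : dist _ _ < _ := h3
    rw [hval', hsh, Real.dist_eq, Pi.add_apply, (angleShift_apply _ _).2.2.2] at h3'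
    have : initialState p q v.1.2 nl ng v.2.2 3 + 2 * Real.pi * m -
        unperturbed p q e nl ng (2 * Real.pi * p) 3 = 2 * Real.pi * ((m + p : ℤ) : ℝ) := by
      simp only [initialState, unperturbed, Matrix.cons_val]
      push_cast
      ring
    rw [this] at h3'
    linarith [abs_two_pi_mul_int_lt h3']
  have hhalf := (half_period_iff (hsol.solvesOn (-b) b) hz0 hTpos hT.2).2 (by
    have := hper (-(v.2.1 / 2))
    rw [hk, hm] at this
    rw [← this]
    congr 1
    ring)
  rw [halfAngles, ← hzζ (v.2.1 / 2) ⟨by linarith [hT.1, hT.2], by linarith [hT.1, hT.2]⟩,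
    halfTarget, hhalf.1, hhalf.2]

/-- A periodic solution of the required kind solves the half-period equations, which determine
`T` and `L` near the unperturbed solution. -/
theorem familyUnique (hp : 0 < p) (hq : 0 < q) (he : e ∈ Ioo (0 : ℝ) 1)
    (hnc : NonCollision p q e nl ng) : FamilyUnique p q e nl ng := by
  have hp' : 0 < 2 * Real.pi * p := by positivity
  have hb : 2 * Real.pi * p < 4 * Real.pi * p := by linarith
  obtain ⟨ε, ζ, Y, hF⟩ := exists_isFlowNear hp hq he hnc (b := 4 * Real.pi * p) (by linarith)
  obtain ⟨σ, -, -, -, hσ⟩ := exists_half_period hF he hp hq hb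
  obtain ⟨ρ, hρ, h⟩ := Metric.eventually_nhds_iff.1
    (hσ.and (eventually_halfAngles_of_periodic hF he hp hb))
  refine ⟨ρ, hρ, fun μ e' hμ he' z₁ z₂ T₁ T₂ h1 h2 hz1 hz2 hL1 hL2 hT1 hT2 => ?_⟩
  have hd : ∀ {T L : ℝ}, |L - (-resL p q)| < ρ → |T - 2 * Real.pi * p| < ρ →
      dist (((μ, e'), (T, L)) : (ℝ × ℝ) × (ℝ × ℝ)) (basePoint p q e) < ρ := fun hL hT => by
    simp only [basePoint, Prod.dist_eq, Real.dist_eq, sub_zero]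
    exact max_lt (max_lt hμ he') (max_lt hT hL)
  have a1 := h (hd hL1 hT1)
  have a2 := h (hd hL2 hT2)
  have b1 := a1.1 (a1.2 z₁ h1 hz1)
  have b2 := a2.1 (a2.2 z₂ h2 hz2)
  have h12 : (T₁, z₁ 0 0) = (T₂, z₂ 0 0) := b1.symm.trans b2
  rw [Prod.mk.injEq] at h12
  refine ⟨h1.1.eq h2.1 (t₀ := 0) ?_, h12.1⟩
  rw [hz1, hz2, h12.2]

/-- `γ` is a family of symmetric periodic solutions, with periods `T` and initial values `L` of the
first variable, that is obtained by extending the flow `ζ` periodically. -/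
structure IsFlowFamily (p q : ℕ) (e : ℝ) (nl ng : Fin 2) (b ε : ℝ)
    (ζ : ℝ × (ℝ × (Fin 4 → ℝ)) → Fin 4 → ℝ) (δ : ℝ) (γ : ℝ → ℝ → Fin 4 → ℝ)
    (T L : ℝ → ℝ) : Prop where
  pos : 0 < δ
  T_zero : T 0 = 2 * Real.pi * p
  L_zero : L 0 = -resL p q
  T_analytic : ∀ μ ∈ Ioo (-δ) δ, AnalyticAt ℝ T μ
  L_analytic : ∀ μ ∈ Ioo (-δ) δ, AnalyticAt ℝ L μ
  T_mem : ∀ μ ∈ Ioo (-δ) δ, T μ ∈ Ioo 0 b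
  mem_ball : ∀ μ ∈ Ioo (-δ) δ, (μ, initialState p q e nl ng (L μ)) ∈
    Metric.ball ((0 : ℝ), initialState p q e nl ng (-resL p q)) ε
  solution : ∀ μ ∈ Ioo (-δ) δ, IsSolution μ (γ μ)
  periodic : ∀ μ ∈ Ioo (-δ) δ, ∀ t, γ μ (t + T μ) = γ μ t + angleShift (-q) (-p)
  eq_flow : ∀ μ ∈ Ioo (-δ) δ, ∀ t ∈ Ioo (-b) b,
    γ μ t = ζ (t, (μ, initialState p q e nl ng (L μ)))
  half : ∀ μ ∈ Ioo (-δ) δ, γ μ (T μ / 2) 2 = (nl : ℕ) * Real.pi - q * Real.pi ∧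
    γ μ (T μ / 2) 3 = (ng : ℕ) * Real.pi - p * Real.pi

/-- The solutions of the half-period equations give symmetric periodic solutions. -/
lemma exists_isFlowFamily (hF : IsFlowNear (initialState p q e nl ng (-resL p q)) b ε ζ Y)
    (hp : 0 < p) (hq : 0 < q) (he : e ∈ Ioo (0 : ℝ) 1) (hb : 2 * Real.pi * p < b) :
    ∃ δ γ T L, IsFlowFamily p q e nl ng b ε ζ δ γ T L := by
  have hp' : 0 < 2 * Real.pi * p := by positivity
  obtain ⟨σ, hσa, hσ0, hσ, -⟩ := exists_half_period hF he hp hq hb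
  have hin : Tendsto (fun μ : ℝ => (μ, e)) (𝓝 0) (𝓝 (0, e)) :=
    Continuous.tendsto' (by fun_prop) _ _ rfl
  have hbase : Tendsto (fun μ : ℝ => (((μ, e), σ (μ, e)) : (ℝ × ℝ) × (ℝ × ℝ))) (𝓝 0)
      (𝓝 (basePoint p q e)) := by
    rw [basePoint, ← hσ0]
    exact hin.prodMk_nhds (hσa.continuousAt.tendsto.comp hin)
  have hball := hbase.eventually ((tendsto_initialState (nl := nl) (ng := ng) he).eventually
    (Metric.isOpen_ball.mem_nhds hF.base_mem))
  have hT : ∀ᶠ μ in 𝓝 (0 : ℝ), (σ (μ, e)).1 ∈ Ioo 0 b := by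
    refine hbase.eventually (p := fun v => v.2.1 ∈ Ioo 0 b) ?_
    exact ContinuousAt.preimage_mem_nhds (f := fun v : (ℝ × ℝ) × (ℝ × ℝ) => v.2.1) (by fun_prop)
      (isOpen_Ioo.mem_nhds ⟨hp', hb⟩)
  obtain ⟨δ, hδ, h⟩ := Metric.eventually_nhds_iff.1
    ((hin.eventually hσa.eventually_analyticAt).and ((hin.eventually hσ).and (hball.and hT)))
  have h' : ∀ μ ∈ Ioo (-δ) δ, _ := fun μ hμ => h (y := μ) (by
    rw [Real.dist_eq, sub_zero]; exact abs_lt.2 hμ)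
  have hex : ∀ μ ∈ Ioo (-δ) δ, ∃ z, IsSolution μ z ∧
      (∀ t, z (t + (σ (μ, e)).1) = z t + angleShift (-q) (-p)) ∧
      ∀ t ∈ Ioo (-b) b, z t = ζ (t, (μ, initialState p q e nl ng (σ (μ, e)).2)) := by
    intro μ hμ
    obtain ⟨-, hhalf, hmem, hTm⟩ := h' μ hμ
    have hs : SolvesOn (vectorField μ) (domain μ)
      (fun t => ζ (t, (μ, initialState p q e nl ng (σ (μ, e)).2))) (-b) b :=
      hF.solves (μ, initialState p q e nl ng (σ (μ, e)).2) hmem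
    refine hs.exists_extension hTm.1 hTm.2 fun t ht ht' => ?_
    refine hs.periodic hTm.1 hTm.2 ?_ ht ht'
    refine (half_period_iff hs (hF.zero _ hmem) hTm.1 hTm.2).1 ?_
    rw [halfAngles, halfTarget, Prod.mk.injEq] at hhalf
    exact hhalf
  choose! γ hγ using hex
  have hL : ∀ μ ∈ Ioo (-δ) δ, AnalyticAt ℝ (fun μ => σ (μ, e)) μ := fun μ hμ =>
    AnalyticAt.fun_comp (f := fun μ : ℝ => (μ, e)) (h' μ hμ).1 (analyticAt_id.prod analyticAt_const)
  refine ⟨δ, γ, fun μ => (σ (μ, e)).1, fun μ => (σ (μ, e)).2, hδ, by simp only [hσ0],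
    by simp only [hσ0], fun μ hμ => analyticAt_fst.fun_comp (hL μ hμ),
    fun μ hμ => analyticAt_snd.fun_comp (hL μ hμ), fun μ hμ => (h' μ hμ).2.2.2,
    fun μ hμ => (h' μ hμ).2.2.1, fun μ hμ => (hγ μ hμ).1, fun μ hμ => (hγ μ hμ).2.1,
    fun μ hμ => (hγ μ hμ).2.2, fun μ hμ => ?_⟩
  have hTm := (h' μ hμ).2.2.2
  have hhalf := (h' μ hμ).2.1
  rw [halfAngles, halfTarget, Prod.mk.injEq] at hhalf
  rw [(hγ μ hμ).2.2 _ ⟨by linarith [hTm.1, hTm.2], by linarith [hTm.1, hTm.2]⟩]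
  exact hhalf

namespace IsFlowFamily

variable {δ : ℝ} {γ : ℝ → ℝ → Fin 4 → ℝ} {T L : ℝ → ℝ}

lemma zero_mem (hG : IsFlowFamily p q e nl ng b ε ζ δ γ T L) : (0 : ℝ) ∈ Ioo (-δ) δ :=
  ⟨neg_lt_zero.2 hG.pos, hG.pos⟩

lemma init (hG : IsFlowFamily p q e nl ng b ε ζ δ γ T L)
    (hF : IsFlowNear (initialState p q e nl ng (-resL p q)) b ε ζ Y) (hb : 0 < b) {μ : ℝ}
    (hμ : μ ∈ Ioo (-δ) δ) : γ μ 0 = initialState p q e nl ng (L μ) := by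
  rw [hG.eq_flow μ hμ 0 ⟨neg_lt_zero.2 hb, hb⟩, hF.zero _ (hG.mem_ball μ hμ)]

lemma analyticAt_initialState (hG : IsFlowFamily p q e nl ng b ε ζ δ γ T L)
    (he : e ∈ Ioo (0 : ℝ) 1) {μ : ℝ} (hμ : μ ∈ Ioo (-δ) δ) :
    AnalyticAt ℝ (fun μ => initialState p q e nl ng (L μ)) μ :=
  AnalyticAt.fun_comp (f := fun μ => (e, L μ)) (g := fun v : ℝ × ℝ => initialState p q v.1 nl ng v.2)
    (R3BP.analyticAt_initialState (v := (e, L μ)) he) (analyticAt_const.prod (hG.L_analytic μ hμ))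

/-- The position at a time that depends analytically on `μ` is analytic in `μ`. -/
lemma analyticAt_apply (hG : IsFlowFamily p q e nl ng b ε ζ δ γ T L)
    (hF : IsFlowNear (initialState p q e nl ng (-resL p q)) b ε ζ Y) (he : e ∈ Ioo (0 : ℝ) 1)
    {a : ℝ → ℝ} {μ : ℝ} (hμ : μ ∈ Ioo (-δ) δ) (ha : AnalyticAt ℝ a μ) :
    AnalyticAt ℝ (fun μ => γ μ (a μ)) μ := by
  obtain ⟨n, hn⟩ := exists_int_shift_mem (hG.T_mem μ hμ).1 (hG.T_mem μ hμ).2 (a μ)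
  have hT := hG.T_analytic μ hμ
  have hτ : AnalyticAt ℝ (fun μ => a μ - n * T μ) μ := ha.sub (analyticAt_const.mul hT)
  have h1 : AnalyticAt ℝ (fun μ => ζ (a μ - n * T μ, (μ, initialState p q e nl ng (L μ)))) μ :=
    AnalyticAt.fun_comp (f := fun μ => (a μ - n * T μ, (μ, initialState p q e nl ng (L μ))))
      (hF.analytic _ (hG.mem_ball μ hμ) _ hn)
      (hτ.prod (analyticAt_id.prod (hG.analyticAt_initialState he hμ)))
  refine (h1.add (analyticAt_const (v := n • angleShift (-q) (-p)))).congr ?_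
  filter_upwards [isOpen_Ioo.mem_nhds hμ,
    hτ.continuousAt.preimage_mem_nhds (isOpen_Ioo.mem_nhds hn)] with ν hν hν2
  have h := add_nsmul_of_shift (hG.periodic ν hν) n (a ν - n * T ν)
  rw [sub_add_cancel, hG.eq_flow ν hν _ hν2] at h
  exact h.symm

lemma eq_unperturbed (hG : IsFlowFamily p q e nl ng b ε ζ δ γ T L)
    (hF : IsFlowNear (initialState p q e nl ng (-resL p q)) b ε ζ Y) {t : ℝ}
    (ht : t ∈ Ioo (-b) b) : γ 0 t = unperturbed p q e nl ng t := by
  rw [hG.eq_flow 0 hG.zero_mem t ht, hG.L_zero, hF.eq_unperturbed ht]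

lemma isPeriodicFamily (hG : IsFlowFamily p q e nl ng b ε ζ δ γ T L)
    (hF : IsFlowNear (initialState p q e nl ng (-resL p q)) b ε ζ Y) (he : e ∈ Ioo (0 : ℝ) 1) :
    IsPeriodicFamily p q (fun _ => e) nl ng γ T := by
  have hb : 0 < b := (hG.T_mem 0 hG.zero_mem).1.trans (hG.T_mem 0 hG.zero_mem).2
  refine ⟨?_, ?_, δ, hG.pos, fun _ _ => analyticAt_const, hG.T_analytic,
    fun t μ hμ => hG.analyticAt_apply hF he hμ analyticAt_const, fun μ hμ => ⟨he,
      ⟨hG.solution μ hμ, (hG.T_mem μ hμ).1, -q, -p, hG.periodic μ hμ⟩, ?_⟩⟩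
  · have h := (hG.L_analytic 0 hG.zero_mem).differentiableAt.isBigO_sub
    simp only [hG.L_zero, sub_zero] at h
    refine h.congr' ?_ EventuallyEq.rfl
    filter_upwards [isOpen_Ioo.mem_nhds hG.zero_mem] with μ hμ
    rw [hG.init hF hb hμ]
    rfl
  · have h := (hG.T_analytic 0 hG.zero_mem).differentiableAt.isBigO_sub
    simpa only [hG.T_zero, sub_zero] using h
  · rw [hG.init hF hb hμ]
    rfl

/-- Shifting the time by `j / 2` periods gives a symmetric family with angles changed by
`-j q π` and `-j p π`. -/
lemma isPeriodicFamily_shift (hG : IsFlowFamily p q e nl ng b ε ζ δ γ T L)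
    (hF : IsFlowNear (initialState p q e nl ng (-resL p q)) b ε ζ Y) (hp : 0 < p) (hq : 0 < q)
    (he : e ∈ Ioo (0 : ℝ) 1) (j nl' ng' : Fin 2) (k m : ℤ)
    (hk : ((nl' : ℕ) : ℤ) = (nl : ℕ) - (j : ℕ) * q + 2 * k)
    (hm : ((ng' : ℕ) : ℤ) = (ng : ℕ) - (j : ℕ) * p + 2 * m) :
    ∃ s E : ℝ → ℝ, AnalyticAt ℝ s 0 ∧ E 0 = e ∧
      IsPeriodicFamily p q E nl' ng' (fun μ t => γ μ (t + s μ) + angleShift k m) T := by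
  have hR := resL_pos hp hq
  have hTb0 := hG.T_mem 0 hG.zero_mem
  have hb : 0 < b := hTb0.1.trans hTb0.2
  have hj : (0 : ℝ) ≤ (j : ℕ) ∧ ((j : ℕ) : ℝ) ≤ 1 := by
    constructor
    · positivity
    · have := j.is_le; exact_mod_cast this
  let s : ℝ → ℝ := fun μ => (j : ℕ) * (T μ / 2)
  have hs : ∀ μ ∈ Ioo (-δ) δ, AnalyticAt ℝ s μ := fun μ hμ =>
    analyticAt_const.mul (hG.T_analytic μ hμ).div_const
  have hsb : ∀ μ ∈ Ioo (-δ) δ, s μ ∈ Ioo (-b) b := fun μ hμ => by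
    have h := hG.T_mem μ hμ
    constructor <;> simp only [s] <;> nlinarith [h.1, h.2]
  let x : ℝ → Fin 4 → ℝ := fun μ => γ μ (s μ)
  have hx : ∀ μ ∈ Ioo (-δ) δ, AnalyticAt ℝ x μ := fun μ hμ => hG.analyticAt_apply hF he hμ (hs μ hμ)
  have hx0 : x 0 = unperturbed p q e nl ng (s 0) := hG.eq_unperturbed hF (hsb 0 hG.zero_mem)
  have hxang : ∀ μ ∈ Ioo (-δ) δ, x μ 2 = (nl : ℕ) * Real.pi - (j : ℕ) * (q * Real.pi) ∧
      x μ 3 = (ng : ℕ) * Real.pi - (j : ℕ) * (p * Real.pi) := fun μ hμ => by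
    have h1 := hG.half μ hμ
    have h0 := hG.init hF hb hμ
    simp only [x, s]
    fin_cases j
    · simp [h0, initialState]
    · simp [h1]
  -- the eccentricity is determined by `G` and `(p/q)^{1/3}`, not by `L(0)`
  let Q : ℝ → ℝ := fun μ => 1 - x μ 1 ^ 2 / resL p q ^ 2
  have hxi : ∀ i, ∀ μ ∈ Ioo (-δ) δ, AnalyticAt ℝ (fun μ => x μ i) μ := fun i μ hμ =>
    AnalyticAt.fun_comp (g := fun z : Fin 4 → ℝ => z i) (analyticAt_coord i _) (hx μ hμ)
  have hQ : ∀ μ ∈ Ioo (-δ) δ, AnalyticAt ℝ Q μ := fun μ hμ =>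
    analyticAt_const.sub (((hxi 1 μ hμ).pow 2).div_const)
  have he2 : 0 < 1 - e ^ 2 := by nlinarith [he.1, he.2]
  have hQ0 : Q 0 = e ^ 2 := by
    simp only [Q, hx0]
    change 1 - (-(resL p q * √(1 - e ^ 2))) ^ 2 / resL p q ^ 2 = e ^ 2
    rw [neg_sq, mul_pow, Real.sq_sqrt he2.le]
    field_simp
    ring
  let E : ℝ → ℝ := fun μ => √(Q μ)
  have hE0 : E 0 = e := by simp only [E, hQ0, Real.sqrt_sq he.1.le]
  have hQpos : ∀ᶠ μ in 𝓝 (0 : ℝ), 0 < Q μ ∧ Q μ < 1 := by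
    refine (hQ 0 hG.zero_mem).continuousAt.eventually (p := fun y => 0 < y ∧ y < 1) ?_
    exact isOpen_Ioo.mem_nhds (hQ0 ▸ ⟨pow_pos he.1 2, by linarith⟩)
  obtain ⟨δ', hδ', hδ''⟩ := Metric.eventually_nhds_iff.1
    (hQpos.and (isOpen_Ioo.mem_nhds hG.zero_mem))
  replace hδ'' : ∀ μ ∈ Ioo (-δ') δ', (0 < Q μ ∧ Q μ < 1) ∧ μ ∈ Ioo (-δ) δ := fun μ hμ =>
    hδ'' (y := μ) (by rw [Real.dist_eq, sub_zero]; exact abs_lt.2 hμ)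
  have hstate : ∀ μ ∈ Ioo (-δ') δ', x μ + angleShift k m =
      initialState p q (E μ) nl' ng' (x μ 0) := fun μ hμ => by
    obtain ⟨hq1, hμ'⟩ := hδ'' μ hμ
    have hneg : x μ 1 < 0 := (hG.solution μ hμ' (s μ)).1.2.1
    have hk' : (((nl' : ℕ) : ℤ) : ℝ) = (((nl : ℕ) - (j : ℕ) * q + 2 * k : ℤ) : ℝ) := by rw [hk]
    have hm' : (((ng' : ℕ) : ℤ) : ℝ) = (((ng : ℕ) - (j : ℕ) * p + 2 * m : ℤ) : ℝ) := by rw [hm]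
    push_cast at hk' hm'
    funext i
    fin_cases i
    · simp [angleShift, initialState]
    · have h1 : 1 - E μ ^ 2 = (-x μ 1 / resL p q) ^ 2 := by
        simp only [E, Real.sq_sqrt hq1.1.le, Q]
        ring
      have h2 : √(1 - E μ ^ 2) = -x μ 1 / resL p q := by
        rw [h1, Real.sqrt_sq (div_nonneg (by linarith) hR.le)]
      change x μ 1 + angleShift k m 1 = -(resL p q * √(1 - E μ ^ 2))
      rw [h2, (angleShift_apply _ _).2.1]
      field_simp
      ring
    · change x μ 2 + angleShift k m 2 = (nl' : ℕ) * Real.pi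
      rw [(hxang μ hμ').1, hk', (angleShift_apply _ _).2.2.1]
      ring
    · change x μ 3 + angleShift k m 3 = (ng' : ℕ) * Real.pi
      rw [(hxang μ hμ').2, hm', (angleShift_apply _ _).2.2.2]
      ring
  refine ⟨s, E, hs 0 hG.zero_mem, hE0, ?_, ?_, δ', hδ',
    fun μ hμ => analyticAt_sqrt_comp (hQ μ (hδ'' μ hμ).2) (hδ'' μ hμ).1.1.ne',
    fun μ hμ => hG.T_analytic μ (hδ'' μ hμ).2, fun t μ hμ => ?_, fun μ hμ => ⟨?_, ⟨?_, ?_, ?_⟩, ?_⟩⟩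
  · have h := (hxi 0 0 hG.zero_mem).differentiableAt.isBigO_sub
    have hL0 : x 0 0 = -resL p q := by rw [hx0]; rfl
    simp only [hL0, sub_zero] at h
    refine h.congr_left fun μ => ?_
    simp [(angleShift_apply _ _).1, x]
  · have h := (hG.T_analytic 0 hG.zero_mem).differentiableAt.isBigO_sub
    simpa only [hG.T_zero, sub_zero] using h
  · exact (hG.analyticAt_apply hF he (hδ'' μ hμ).2
      (analyticAt_const.add (hs μ (hδ'' μ hμ).2))).add analyticAt_const
  · have h := (hδ'' μ hμ).1
    exact ⟨Real.sqrt_pos.2 h.1, by rw [Real.sqrt_lt' one_pos]; simpa using h.2⟩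
  · intro t
    have h := ((((hG.solution μ (hδ'' μ hμ).2).solvesOn (t + s μ - 1) (t + s μ + 1)).comp_add
      (s μ)).add_angleShift k m) t ⟨by linarith, by linarith⟩
    exact h
  · exact (hG.T_mem μ (hδ'' μ hμ).2).1
  · refine ⟨-q, -p, fun t => ?_⟩
    have h := hG.periodic μ (hδ'' μ hμ).2 (t + s μ)
    change γ μ (t + T μ + s μ) + angleShift k m = γ μ (t + s μ) + angleShift k m + _
    rw [show t + T μ + s μ = t + s μ + T μ by ring, h]
    abel
  · simp only [zero_add]
    have := hstate μ hμ
    simp only [x] at this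
    rw [this]
    simp [initialState]

/-- A shift of the time origin by half a period changes `(n_l, n_g)` by `(q, p)` modulo `2`, and
`p` and `q` are not both even. -/
lemma belongsTo (hG : IsFlowFamily p q e nl ng b ε ζ δ γ T L)
    (hF : IsFlowNear (initialState p q e nl ng (-resL p q)) b ε ζ Y) (hp : 0 < p) (hq : 0 < q)
    (hpq : Nat.Coprime p q) (he : e ∈ Ioo (0 : ℝ) 1) :
    ∃ i : Fin 2, BelongsTo p q e γ T (familyRep p i).1 (familyRep p i).2 := by
  have key : ∀ (j nl' ng' : Fin 2), (2 : ℤ) ∣ (nl' : ℕ) - ((nl : ℕ) - (j : ℕ) * q) →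
      (2 : ℤ) ∣ (ng' : ℕ) - ((ng : ℕ) - (j : ℕ) * p) → BelongsTo p q e γ T nl' ng' := by
    rintro j nl' ng' ⟨k, hk⟩ ⟨m, hm⟩
    obtain ⟨s, E, hs, hE, h⟩ := hG.isPeriodicFamily_shift hF hp hq he j nl' ng' k m
      (by linarith) (by linarith)
    exact ⟨s, E, k, m, hs, hE, h⟩
  by_cases hodd : Odd p
  · obtain ⟨a, ha⟩ := hodd
    have hrep : ∀ i, familyRep p i = (i, 0) := fun i => if_pos ⟨a, ha⟩
    simp only [hrep]
    obtain ⟨c, hc⟩ | ⟨c, hc⟩ := Nat.even_or_odd q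
    · refine ⟨nl, key ng _ _ ?_ ?_⟩ <;> fin_cases nl <;> fin_cases ng <;> simp [ha, hc] <;> omega
    · refine ⟨nl + ng, key ng _ _ ?_ ?_⟩ <;> fin_cases nl <;> fin_cases ng <;>
        simp [ha, hc] <;> omega
  · have hqo : Odd q := by
      by_contra hq'
      rw [Nat.not_odd_iff_even] at hodd hq'
      exact Nat.not_coprime_of_dvd_of_dvd (by norm_num) hodd.two_dvd hq'.two_dvd hpq
    have hrep : ∀ i, familyRep p i = (0, i) := fun i => if_neg hodd
    simp only [hrep]
    obtain ⟨a, ha⟩ := Nat.not_odd_iff_even.1 hodd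
    obtain ⟨c, hc⟩ := hqo
    refine ⟨ng, key nl _ _ ?_ ?_⟩ <;> fin_cases nl <;> fin_cases ng <;> simp [ha, hc] <;> omega

end IsFlowFamily

/-- Along every member of a family the angle `p l - q g` stays close to its initial value. -/
lemma IsPeriodicFamily.eventually_resonant_angle {E : ℝ → ℝ} {γ : ℝ → ℝ → Fin 4 → ℝ} {T : ℝ → ℝ}
    (h : IsPeriodicFamily p q E nl ng γ T) (hp : 0 < p) (hq : 0 < q) (he : e ∈ Ioo (0 : ℝ) 1)
    (hE : E 0 = e) :
    ∀ᶠ μ in 𝓝 (0 : ℝ), ∀ t,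
      |p * γ μ t 2 - q * γ μ t 3 - (p * (nl : ℕ) - q * (ng : ℕ)) * Real.pi| < Real.pi / 4 := by
  have hp' : 0 < 2 * Real.pi * p := by positivity
  have hp0 : (p : ℝ) ≠ 0 := by positivity
  obtain ⟨hL, hT, δ, hδ, -, hTa, hγa, hall⟩ := h
  have h0 : (0 : ℝ) ∈ Ioo (-δ) δ := ⟨neg_lt_zero.2 hδ, hδ⟩
  have hzero : ∀ f : ℝ → ℝ, f =O[𝓝 0] (fun μ : ℝ => μ) → f 0 = 0 := fun f hf => by
    obtain ⟨c, hc⟩ := hf.bound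
    simpa using hc.self_of_nhds
  have hL0 : γ 0 0 0 = -resL p q := by linarith [hzero _ hL]
  have hT0 : T 0 = 2 * Real.pi * p := by linarith [hzero _ hT]
  obtain ⟨-, ⟨hsol, -, -⟩, hinit⟩ := hall 0 h0
  rw [hE, hL0] at hinit
  have hunp : γ 0 = unperturbed p q e nl ng := by
    funext t
    have ht : t ∈ Ioo (-(|t| + 1)) (|t| + 1) := abs_lt.1 (by linarith)
    rw [eq_of_solvesOn_zero (hsol.solvesOn (-(|t| + 1)) (|t| + 1)) ht, hinit]
    have h3 : t / (-resL p q) ^ 3 = -(q * t / p) := by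
      rw [div_eq_mul_one_div, one_div_neg_resL_pow_three]; ring
    funext i
    fin_cases i
    · rfl
    · rfl
    · change (nl : ℕ) * Real.pi + t / (-resL p q) ^ 3 = (nl : ℕ) * Real.pi - q * t / p
      rw [h3]; ring
    · rfl
  have hnc : NonCollision p q e nl ng := fun t => hunp ▸ (hsol t).1.2.2.2
  obtain ⟨ε, ζ, Y, hF⟩ := exists_isFlowNear hp hq he hnc (b := 6 * Real.pi * p) (by linarith)
  have hx : ContinuousAt (fun μ => γ μ 0) 0 := (hγa 0 0 h0).continuousAt
  have hball : ∀ᶠ μ in 𝓝 (0 : ℝ), (μ, γ μ 0) ∈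
      Metric.ball ((0 : ℝ), initialState p q e nl ng (-resL p q)) ε := by
    have : ContinuousAt (fun μ => (μ, γ μ 0)) 0 := continuousAt_id.prodMk hx
    refine this.preimage_mem_nhds (Metric.isOpen_ball.mem_nhds ?_)
    rw [hinit]
    exact hF.base_mem
  have hTm : ∀ᶠ μ in 𝓝 (0 : ℝ), T μ ∈ Ioo 0 (4 * Real.pi * p) :=
    (hTa 0 h0).continuousAt.preimage_mem_nhds
      (isOpen_Ioo.mem_nhds ⟨by rw [hT0]; exact hp', by rw [hT0]; linarith⟩)
  -- the angle stays close to its initial value over one period, by compactness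
  have htube : ∀ᶠ μ in 𝓝 (0 : ℝ), ∀ t ∈ Icc 0 (4 * Real.pi * p),
      |p * ζ (t, (μ, γ μ 0)) 2 - q * ζ (t, (μ, γ μ 0)) 3 -
        (p * (nl : ℕ) - q * (ng : ℕ)) * Real.pi| < Real.pi / 4 := by
    refine isCompact_Icc.eventually_forall_of_forall_eventually fun t ht => ?_
    have htb : t ∈ Ioo (-(6 * Real.pi * p)) (6 * Real.pi * p) :=
      ⟨by linarith [ht.1], by linarith [ht.2]⟩
    have hcont : ContinuousAt (fun v : ℝ × ℝ => ζ (v.2, (v.1, γ v.1 0))) (0, t) := by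
      refine ContinuousAt.comp (f := fun v : ℝ × ℝ => (v.2, (v.1, γ v.1 0))) (g := ζ)
        (x := ((0 : ℝ), t)) ?_ ?_
      · rw [hinit]
        exact (hF.analytic _ hF.base_mem t htb).continuousAt
      · exact continuousAt_snd.prodMk (continuousAt_fst.prodMk
          (ContinuousAt.comp (f := fun v : ℝ × ℝ => v.1) (g := fun μ => γ μ 0) (x := ((0 : ℝ), t))
            hx continuousAt_fst))
    have hcoord : ∀ i : Fin 4, ContinuousAt (fun v : ℝ × ℝ => ζ (v.2, (v.1, γ v.1 0)) i) (0, t) :=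
      fun i => (continuous_apply i).continuousAt.comp hcont
    have hF' : ContinuousAt (fun v : ℝ × ℝ => |p * ζ (v.2, (v.1, γ v.1 0)) 2 -
        q * ζ (v.2, (v.1, γ v.1 0)) 3 - (p * (nl : ℕ) - q * (ng : ℕ)) * Real.pi|) (0, t) :=
      (((continuousAt_const.mul (hcoord 2)).sub (continuousAt_const.mul (hcoord 3))).sub
        continuousAt_const).abs
    refine hF'.eventually (p := fun y => y < Real.pi / 4) (isOpen_Iio.mem_nhds ?_)
    simp only [mem_Iio]
    rw [hinit, hF.eq_unperturbed htb]
    have : (p : ℝ) * unperturbed p q e nl ng t 2 - q * unperturbed p q e nl ng t 3 -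
        (p * (nl : ℕ) - q * (ng : ℕ)) * Real.pi = 0 := by
      simp only [unperturbed, Matrix.cons_val]
      field_simp
      ring
    rw [this, abs_zero]
    positivity
  filter_upwards [hball, hTm, htube, isOpen_Ioo.mem_nhds h0] with μ hb hTμ htube hμ t
  obtain ⟨-, ⟨hsolμ, -, k, m, hper⟩, -⟩ := hall μ hμ
  have hon : ∀ t ∈ Icc 0 (4 * Real.pi * p), |p * γ μ t 2 - q * γ μ t 3 -
      (p * (nl : ℕ) - q * (ng : ℕ)) * Real.pi| < Real.pi / 4 := fun t ht => by
    rw [hF.eq_of_isSolution hsolμ hb ⟨by linarith [ht.1], by linarith [ht.2]⟩]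
    exact htube t ht
  -- over one period the angle changes by `2π(pk - qm)`, which is too small not to vanish
  have hres : p * k - q * m = 0 := by
    have h1 := hon 0 ⟨le_rfl, by linarith⟩
    have h2 := hon (T μ) ⟨hTμ.1.le, hTμ.2.le⟩
    have h3 := hper 0
    rw [zero_add] at h3
    rw [h3, Pi.add_apply, Pi.add_apply, (angleShift_apply _ _).2.2.1,
      (angleShift_apply _ _).2.2.2] at h2
    refine abs_two_pi_mul_int_lt ?_
    rw [abs_lt] at h1 h2 ⊢
    push_cast
    constructor <;> nlinarith [Real.pi_pos, h1.1, h1.2, h2.1, h2.2]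
  have hn0 : 0 ≤ t - ⌊t / T μ⌋ * T μ := by
    have := mul_le_mul_of_nonneg_right (Int.floor_le (t / T μ)) hTμ.1.le
    rw [div_mul_cancel₀ _ hTμ.1.ne'] at this
    linarith
  have hn1 : t - ⌊t / T μ⌋ * T μ ≤ 4 * Real.pi * p := by
    have := mul_lt_mul_of_pos_right (Int.lt_floor_add_one (t / T μ)) hTμ.1
    rw [div_mul_cancel₀ _ hTμ.1.ne', add_mul] at this
    linarith [hTμ.2]
  have hshift := add_nsmul_of_shift hper ⌊t / T μ⌋ (t - ⌊t / T μ⌋ * T μ)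
  rw [sub_add_cancel, zsmul_angleShift] at hshift
  have := hon _ ⟨hn0, hn1⟩
  rw [hshift, Pi.add_apply, Pi.add_apply, (angleShift_apply _ _).2.2.1,
    (angleShift_apply _ _).2.2.2]
  convert this using 2
  have hres' : (p : ℝ) * k - q * m = 0 := by exact_mod_cast hres
  push_cast
  linear_combination 2 * Real.pi * ⌊t / T μ⌋ * hres'

/-- The values of `p l - q g` near the two families differ by an odd multiple of `π`, up to a small
error, while shifts of the angles change them by multiples of `2π`. -/
theorem distinctFamilies (hp : 0 < p) (hq : 0 < q) (hpq : Nat.Coprime p q)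
    (he : e ∈ Ioo (0 : ℝ) 1) {ε₀ ε₁ : ℝ → ℝ} {γ₀ γ₁ : ℝ → ℝ → Fin 4 → ℝ} {T₀ T₁ : ℝ → ℝ}
    (hε₀ : ε₀ 0 = e) (hε₁ : ε₁ 0 = e)
    (h₀ : IsPeriodicFamily p q ε₀ (familyRep p 0).1 (familyRep p 0).2 γ₀ T₀)
    (h₁ : IsPeriodicFamily p q ε₁ (familyRep p 1).1 (familyRep p 1).2 γ₁ T₁) :
    DistinctFamilies γ₀ γ₁ := by
  have hodd : ∃ c : ℤ, Odd c ∧ (c : ℝ) =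
      (p * ((familyRep p 0).1 : ℕ) - q * ((familyRep p 0).2 : ℕ)) -
      (p * ((familyRep p 1).1 : ℕ) - q * ((familyRep p 1).2 : ℕ)) := by
    by_cases hodd : Odd p
    · refine ⟨-p, by simpa using hodd, ?_⟩
      simp [familyRep, hodd]
    · have hqo : Odd q := by
        by_contra hq'
        rw [Nat.not_odd_iff_even] at hodd hq'
        exact Nat.not_coprime_of_dvd_of_dvd (by norm_num) hodd.two_dvd hq'.two_dvd hpq
      refine ⟨q, by simpa using hqo, ?_⟩
      simp [familyRep, hodd]
  obtain ⟨c, hc, hc'⟩ := hodd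
  filter_upwards [h₀.eventually_resonant_angle hp hq he hε₀,
    h₁.eventually_resonant_angle hp hq he hε₁] with μ hμ₀ hμ₁ t₁ t₂ k m heq
  have a0 := hμ₀ t₁
  have a1 := hμ₁ t₂
  rw [heq, Pi.add_apply, Pi.add_apply, (angleShift_apply _ _).2.2.1,
    (angleShift_apply _ _).2.2.2] at a0
  have hlt : |(c - 2 * (p * k - q * m) : ℤ) * Real.pi| < Real.pi := by
    rw [abs_lt] at a0 a1 ⊢
    push_cast
    rw [hc']
    constructor <;> nlinarith [Real.pi_pos, a0.1, a0.2, a1.1, a1.2]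
  rw [abs_mul, abs_of_pos Real.pi_pos, mul_lt_iff_lt_one_left Real.pi_pos, ← Int.cast_abs] at hlt
  have h0 : c - 2 * (p * k - q * m) = 0 := Int.abs_lt_one_iff.1 (by exact_mod_cast hlt)
  obtain ⟨d, hd⟩ := hc
  omega

end Families

/-! ### Eigenvalues of symplectic matrices -/

section SymplecticSpectrum

open Polynomial in
/-- The characteristic polynomial of a symplectic `4 × 4` matrix with eigenvalue `1`. It is
self-reciprocal because `M⁻¹` is similar to `Mᵀ`, so that it is determined by the trace. -/
lemma charpoly_of_symplectic {M J : Matrix (Fin 4) (Fin 4) ℝ} (hJ : IsUnit J)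
    (h : M.transpose * J * M = J) (hdet : M.det = 1) {v : Fin 4 → ℝ} (hv : v ≠ 0)
    (hMv : M.mulVec v = v) :
    M.charpoly = (X - C 1) * (X - C 1) * (X ^ 2 - C (M.trace - 2) * X + C 1) := by
  have hM : IsUnit M := by
    rw [Matrix.isUnit_iff_isUnit_det, hdet]; exact isUnit_one
  have hJd : IsUnit J.det := (Matrix.isUnit_iff_isUnit_det _).1 hJ
  have hMd : IsUnit M.det := (Matrix.isUnit_iff_isUnit_det _).1 hM
  have hinv : M⁻¹ = J⁻¹ * M.transpose * J := by
    have h1 : J⁻¹ * M.transpose * J * M = 1 := by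
      rw [Matrix.mul_assoc, Matrix.mul_assoc, ← Matrix.mul_assoc M.transpose, h,
        Matrix.nonsing_inv_mul _ hJd]
    exact Matrix.inv_eq_left_inv h1
  have hrev : M.charpoly = M.charpolyRev := by
    have h1 := Matrix.charpoly_inv M hM
    have h2 : M⁻¹.charpoly = M.charpoly := by
      rw [hinv]
      have h3 := Matrix.charpoly_units_conj hJ.unit⁻¹ M.transpose
      rw [Matrix.charpoly_transpose] at h3
      rw [← h3, Matrix.coe_units_inv, Matrix.nonsing_inv_nonsing_inv _ (by simpa using hJd),
        IsUnit.unit_spec]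
    rw [← h2, h1, hdet]
    simp [Even.neg_one_pow (⟨2, rfl⟩ : Even 4)]
  have hnd : M.charpoly.natDegree = 4 := by rw [Matrix.charpoly_natDegree_eq_dim]; rfl
  have c4 : M.charpoly.coeff 4 = 1 := by
    have := (Matrix.charpoly_monic M).coeff_natDegree
    rwa [hnd] at this
  have c3 : M.charpoly.coeff 3 = -M.trace := by
    rw [Matrix.trace_eq_neg_charpoly_coeff, neg_neg]; rfl
  have c0 : M.charpoly.coeff 0 = 1 := by
    have := Matrix.det_eq_sign_charpoly_coeff M
    rw [hdet] at this
    simpa [Even.neg_one_pow (⟨2, rfl⟩ : Even 4)] using this.symm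
  have c1 : M.charpoly.coeff 1 = -M.trace := by
    rw [hrev, ← Matrix.reverse_charpoly, coeff_reverse, hnd, ← c3]
    rfl
  have hev : M.charpoly.eval 1 = 0 := by
    rw [Matrix.eval_charpoly]
    refine Matrix.exists_mulVec_eq_zero_iff.1 ⟨v, hv, ?_⟩
    rw [Matrix.sub_mulVec, hMv]
    simp
  have hsum := M.charpoly.as_sum_range' 5 (by rw [hnd]; norm_num)
  simp only [Finset.sum_range_succ, Finset.sum_range_zero, c4, c3, c1, c0,
    ← C_mul_X_pow_eq_monomial] at hsum
  rw [hsum] at hev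
  simp only [eval_add, eval_mul, eval_C, eval_pow, eval_X, eval_zero] at hev
  have c2 : M.charpoly.coeff 2 = 2 * M.trace - 2 := by linarith
  rw [hsum, c2]
  simp only [map_sub, map_mul, map_neg, map_one, C_ofNat]
  ring

open Polynomial in
lemma eigenvalueMultiset_of_symplectic {M J : Matrix (Fin 4) (Fin 4) ℝ} (hJ : IsUnit J)
    (h : M.transpose * J * M = J) (hdet : M.det = 1) {v : Fin 4 → ℝ} (hv : v ≠ 0)
    (hMv : M.mulVec v = v) {a b : ℂ} (hab : a + b = ((M.trace - 2 : ℝ) : ℂ)) (hab' : a * b = 1) :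
    eigenvalueMultiset M = {1, 1, a, b} := by
  have hfac : (X ^ 2 - C ((M.trace - 2 : ℝ) : ℂ) * X + C 1 : ℂ[X]) = (X - C a) * (X - C b) := by
    rw [← hab, ← hab']
    simp only [map_add, map_mul]
    ring
  have hcp : (M.map (algebraMap ℝ ℂ)).charpoly =
      (({1, 1, a, b} : Multiset ℂ).map fun a => X - C a).prod := by
    rw [Matrix.charpoly_map, charpoly_of_symplectic hJ h hdet hv hMv]
    simp only [Polynomial.map_mul, Polynomial.map_sub, Polynomial.map_add, Polynomial.map_pow,
      map_X, map_C, map_one, Polynomial.map_one, Complex.coe_algebraMap] at hfac ⊢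
    rw [hfac]
    simp
    ring
  rw [eigenvalueMultiset, hcp, roots_multiset_prod_X_sub_C]

/-- Square roots of real numbers are Hölder continuous of exponent `1/2`. -/
lemma norm_cpow_half_sub_sq_le (a b : ℝ) :
    ‖((a : ℂ)) ^ (1 / 2 : ℂ) - (b : ℂ) ^ (1 / 2 : ℂ)‖ ^ 2 ≤ |a - b| := by
  have hpos : ∀ a : ℝ, 0 ≤ a → (a : ℂ) ^ (1 / 2 : ℂ) = (√a : ℝ) := fun a ha => by
    rw [Real.sqrt_eq_rpow, Complex.ofReal_cpow ha]
    norm_num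
  have hneg : ∀ a : ℝ, a ≤ 0 → (a : ℂ) ^ (1 / 2 : ℂ) = (√(-a) : ℝ) * Complex.I := fun a ha => by
    rw [Complex.ofReal_cpow_of_nonpos ha, ← Complex.ofReal_neg, hpos (-a) (by linarith)]
    congr 1
    rw [show (Real.pi : ℂ) * Complex.I * (1 / 2) = Real.pi / 2 * Complex.I by ring,
      Complex.exp_pi_div_two_mul_I]
  have key : ∀ a b : ℝ, 0 ≤ a → 0 ≤ b → (√a - √b) ^ 2 ≤ |a - b| := fun a b ha hb => by
    have h1 := Real.sq_sqrt ha
    have h2 := Real.sq_sqrt hb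
    have h3 := Real.sqrt_nonneg a
    have h4 := Real.sqrt_nonneg b
    rcases le_total (√a) (√b) with h | h
    · rw [abs_sub_comm]; refine le_trans ?_ (le_abs_self _); nlinarith
    · refine le_trans ?_ (le_abs_self _); nlinarith
  rcases le_total 0 a with ha | ha <;> rcases le_total 0 b with hb | hb
  · rw [hpos a ha, hpos b hb, ← Complex.ofReal_sub, Complex.norm_real, Real.norm_eq_abs, sq_abs]
    exact key a b ha hb
  · rw [hpos a ha, hneg b hb, Complex.sq_norm, Complex.normSq_apply]
    simp only [Complex.sub_re, Complex.ofReal_re, Complex.mul_re, Complex.I_re, Complex.ofReal_im,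
      Complex.I_im, Complex.sub_im, Complex.mul_im]
    have h1 := Real.mul_self_sqrt ha
    have h2 := Real.mul_self_sqrt (neg_nonneg.2 hb)
    refine le_trans ?_ (le_abs_self _)
    nlinarith
  · rw [hneg a ha, hpos b hb, Complex.sq_norm, Complex.normSq_apply]
    simp only [Complex.sub_re, Complex.ofReal_re, Complex.mul_re, Complex.I_re, Complex.ofReal_im,
      Complex.I_im, Complex.sub_im, Complex.mul_im]
    have h1 := Real.mul_self_sqrt (neg_nonneg.2 ha)
    have h2 := Real.mul_self_sqrt hb
    rw [abs_sub_comm]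
    refine le_trans ?_ (le_abs_self _)
    nlinarith
  · rw [hneg a ha, hneg b hb, ← sub_mul, norm_mul, Complex.norm_I, mul_one, ← Complex.ofReal_sub,
      Complex.norm_real, Real.norm_eq_abs, sq_abs]
    refine (key (-a) (-b) (by linarith) (by linarith)).trans_eq ?_
    rw [abs_sub_comm]
    congr 1
    ring

/-- The solutions `h ± √(h² - 1)` of `λ² - 2hλ + 1 = 0` for `h = 1 + Cμ/2 + O(μ²)`. -/
lemma isBigO_quadratic_roots {h : ℝ → ℝ} {C : ℝ} (ha : AnalyticAt ℝ h 0) (h0 : h 0 = 1)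
    (h1 : HasDerivAt h (C / 2) 0) :
    ((fun μ => (((h μ : ℝ) : ℂ) + ((h μ ^ 2 - 1 : ℝ) : ℂ) ^ (1 / 2 : ℂ)) -
      (1 + ((C * μ : ℝ) : ℂ) ^ (1 / 2 : ℂ))) =O[𝓝 0] fun μ : ℝ => μ) ∧
    ((fun μ => (((h μ : ℝ) : ℂ) - ((h μ ^ 2 - 1 : ℝ) : ℂ) ^ (1 / 2 : ℂ)) -
      (1 - ((C * μ : ℝ) : ℂ) ^ (1 / 2 : ℂ))) =O[𝓝 0] fun μ : ℝ => μ) := by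
  have hlin : (fun μ => ((h μ - 1 : ℝ) : ℂ)) =O[𝓝 0] fun μ : ℝ => μ := by
    have := ha.differentiableAt.isBigO_sub
    simp only [h0, sub_zero] at this
    rw [← isBigO_norm_left] at this ⊢
    simpa only [Complex.norm_real] using this
  have hq : (fun μ => (h μ ^ 2 - 1) - C * μ) =O[𝓝 0] fun μ : ℝ => μ ^ 2 := by
    let k : ℝ → ℝ := fun μ => (h μ ^ 2 - 1) - C * μ
    have hk : AnalyticAt ℝ k 0 :=
      ((ha.pow 2).sub analyticAt_const).sub (analyticAt_const.mul analyticAt_id)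
    have hk0 : k 0 = 0 := by simp [k, h0]
    have hk1 : HasDerivAt k 0 0 := by
      refine (((h1.fun_pow 2).sub_const 1).fun_sub ((hasDerivAt_id' 0).const_mul C)).congr_deriv ?_
      rw [h0]
      ring
    have hord : (2 : ℕ) ≤ analyticOrderAt k 0 := by
      rw [natCast_le_analyticOrderAt_iff_iteratedDeriv_eq_zero hk]
      intro i hi
      interval_cases i
      · simpa using hk0
      · simpa using hk1.deriv
    obtain ⟨g, hg, hgk⟩ := (natCast_le_analyticOrderAt hk).1 hord
    have hgO : g =O[𝓝 0] (fun _ => (1 : ℝ)) := hg.continuousAt.isBigO_one ℝ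
    refine ((isBigO_refl (fun μ : ℝ => μ ^ 2) (𝓝 0)).mul hgO).congr' ?_ (by simp)
    filter_upwards [hgk] with μ hμ
    simp only [k, sub_zero, smul_eq_mul] at hμ
    exact hμ.symm
  have hroot : (fun μ => ((h μ ^ 2 - 1 : ℝ) : ℂ) ^ (1 / 2 : ℂ) -
      ((C * μ : ℝ) : ℂ) ^ (1 / 2 : ℂ)) =O[𝓝 0] fun μ : ℝ => μ := by
    have h2 : (fun μ => ‖((h μ ^ 2 - 1 : ℝ) : ℂ) ^ (1 / 2 : ℂ) -
        ((C * μ : ℝ) : ℂ) ^ (1 / 2 : ℂ)‖ ^ 2) =O[𝓝 0] fun μ : ℝ => μ ^ 2 := by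
      refine IsBigO.trans (IsBigO.of_bound 1 (Eventually.of_forall fun μ => ?_)) hq
      rw [one_mul, Real.norm_eq_abs, abs_of_nonneg (by positivity)]
      exact norm_cpow_half_sub_sq_le _ _
    rw [← isBigO_norm_left]
    exact IsBigO.of_pow two_ne_zero h2
  constructor
  · refine (hlin.add hroot).congr_left fun μ => ?_
    push_cast
    ring
  · refine (hlin.sub hroot).congr_left fun μ => ?_
    push_cast
    ring

end SymplecticSpectrum

/-! ### The symplectic structure -/

section Symplectic

lemma fderiv_apply_comm {E F : Type*} [NormedAddCommGroup E] [NormedSpace ℝ E]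
    [NormedAddCommGroup F] [NormedSpace ℝ F] [CompleteSpace F] {f : E → F} {x : E}
    (hf : AnalyticAt ℝ f x) (u v : E) :
    fderiv ℝ (fun y => fderiv ℝ f y v) x u = fderiv ℝ (fun y => fderiv ℝ f y u) x v := by
  have h : ∀ w : E, fderiv ℝ (fun y => fderiv ℝ f y w) x =
      (ContinuousLinearMap.apply ℝ F w).comp (fderiv ℝ (fderiv ℝ f) x) := fun w =>
    ((ContinuousLinearMap.apply ℝ F w).hasFDerivAt.comp x
      hf.fderiv.differentiableAt.hasFDerivAt).fderiv
  rw [h, h]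
  exact (ContDiffAt.isSymmSndFDerivAt (hf.contDiffAt (n := 2)) (by simp)).eq u v

/-- The second derivative of the Hamiltonian in the state. -/
def hess (v : ℝ × (Fin 4 → ℝ)) (u w : Fin 4 → ℝ) : ℝ :=
  fderiv ℝ (fun y => fderiv ℝ jointHam y (0, w)) v (0, u)

lemma hess_comm {v : ℝ × (Fin 4 → ℝ)} (hv : v ∈ fullDomain) (u w : Fin 4 → ℝ) :
    hess v u w = hess v w u :=
  fderiv_apply_comm (analyticAt_jointHam hv) _ _

lemma hess_eq_sum {v : ℝ × (Fin 4 → ℝ)} (hv : v ∈ fullDomain) (u w : Fin 4 → ℝ) :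
    hess v u w = ∑ i, w i * hess v u (Pi.single i 1) := by
  let B : (Fin 4 → ℝ) →ₗ[ℝ] ℝ :=
    ((fderiv ℝ (fun y => fderiv ℝ jointHam y (0, u)) v).comp (.inr ℝ ℝ (Fin 4 → ℝ))).toLinearMap
  have hB : ∀ w, hess v u w = B w := fun w => hess_comm hv u w
  rw [hB, LinearMap.pi_apply_eq_sum_univ B w]
  refine Finset.sum_congr rfl fun i _ => ?_
  rw [hB, smul_eq_mul]
  congr 2
  funext j
  simp [Pi.single_apply, eq_comm]

lemma hasFDerivAt_jointField {v : ℝ × (Fin 4 → ℝ)} (hv : v ∈ fullDomain) (w : ℝ × (Fin 4 → ℝ)) :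
    fderiv ℝ jointField v w =
      ![-fderiv ℝ (fun y => fderiv ℝ jointHam y (0, Pi.single 2 1)) v w,
        -fderiv ℝ (fun y => fderiv ℝ jointHam y (0, Pi.single 3 1)) v w,
        fderiv ℝ (fun y => fderiv ℝ jointHam y (0, Pi.single 0 1)) v w,
        fderiv ℝ (fun y => fderiv ℝ jointHam y (0, Pi.single 1 1)) v w] := by
  have hd : ∀ i : Fin 4, DifferentiableAt ℝ
      (fun y => fderiv ℝ jointHam y (0, Pi.single i 1)) v := fun i =>
    (analyticAt_fderiv_apply (analyticAt_jointHam hv) _).differentiableAt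
  have heq : ∀ i : Fin 4, (fun y : ℝ × (Fin 4 → ℝ) => hamPartial y.1 i y.2) =ᶠ[𝓝 v]
      (fun y => fderiv ℝ jointHam y (0, Pi.single i 1)) := fun i => by
    filter_upwards [isOpen_fullDomain.mem_nhds hv] with y hy
    exact hamPartial_eq hy i
  have hdf : HasFDerivAt jointField (fderiv ℝ jointField v) v :=
    (analyticAt_jointField hv).differentiableAt.hasFDerivAt
  have hcomp : ∀ i : Fin 4, HasFDerivAt (fun y => jointField y i)
      ((ContinuousLinearMap.proj (R := ℝ) (φ := fun _ : Fin 4 => ℝ) i).comp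
        (fderiv ℝ jointField v)) v := fun i => hasFDerivAt_pi'.1 hdf i
  have h : ∀ i j : Fin 4, ((fun y => jointField y j) = fun y => hamPartial y.1 i y.2) →
      fderiv ℝ jointField v w j =
        fderiv ℝ (fun y => fderiv ℝ jointHam y (0, Pi.single i 1)) v w := fun i j hj => by
    have h2 := hcomp j
    rw [hj] at h2
    rw [(h2.congr_of_eventuallyEq (heq i).symm).fderiv]
    rfl
  have hn : ∀ i j : Fin 4, ((fun y => jointField y j) = fun y => -hamPartial y.1 i y.2) →
      fderiv ℝ jointField v w j =
        -fderiv ℝ (fun y => fderiv ℝ jointHam y (0, Pi.single i 1)) v w := fun i j hj => by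
    have h2 := (hcomp j).neg
    have h3 : (-fun y => jointField y j) = fun y => hamPartial y.1 i y.2 := by
      rw [hj]; funext y; simp
    rw [h3] at h2
    rw [(h2.congr_of_eventuallyEq (heq i).symm).fderiv]
    simp
  funext j
  fin_cases j
  · exact hn 2 0 rfl
  · exact hn 3 1 rfl
  · exact h 0 2 rfl
  · exact h 1 3 rfl

lemma linField_apply {v : ℝ × (Fin 4 → ℝ)} (hv : v ∈ fullDomain) (u : Fin 4 → ℝ) :
    linField v u = ![-hess v u (Pi.single 2 1), -hess v u (Pi.single 3 1),
      hess v u (Pi.single 0 1), hess v u (Pi.single 1 1)] :=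
  hasFDerivAt_jointField hv (0, u)

/-- The matrix of the symplectic form `dL ∧ dl + dG ∧ dg`. -/
def symplecticJ : Matrix (Fin 4) (Fin 4) ℝ :=
  !![0, 0, 1, 0; 0, 0, 0, 1; -1, 0, 0, 0; 0, -1, 0, 0]

/-- The symplectic form `dL ∧ dl + dG ∧ dg`. -/
def sympl (u v : Fin 4 → ℝ) : ℝ := u 0 * v 2 - u 2 * v 0 + (u 1 * v 3 - u 3 * v 1)

lemma dotProduct_symplecticJ (u v : Fin 4 → ℝ) :
    u ⬝ᵥ (symplecticJ.mulVec v) = sympl u v := by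
  simp [symplecticJ, sympl, dotProduct, Matrix.mulVec, Fin.sum_univ_four]
  ring

lemma isUnit_symplecticJ : IsUnit symplecticJ := by
  have h : symplecticJ * (-symplecticJ) = 1 := by
    ext i j
    fin_cases i <;> fin_cases j <;>
      simp [symplecticJ, Matrix.mul_apply, Fin.sum_univ_four]
  exact IsUnit.of_mul_eq_one _ h

/-- Hamiltonian vector fields are infinitesimally symplectic. -/
lemma sympl_linField {v : ℝ × (Fin 4 → ℝ)} (hv : v ∈ fullDomain) (u w : Fin 4 → ℝ) :
    sympl (linField v u) w + sympl u (linField v w) = 0 := by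
  have h1 := hess_eq_sum hv u w
  have h2 := hess_eq_sum hv w u
  rw [← hess_comm hv u w, h1] at h2
  rw [Fin.sum_univ_four, Fin.sum_univ_four] at h2
  rw [linField_apply hv, linField_apply hv]
  simp only [sympl, Matrix.cons_val]
  linarith

end Symplectic

/-! ### The monodromy matrix -/

section Monodromy

variable {μ : ℝ} {z : ℝ → Fin 4 → ℝ} {b : ℝ}

/-- Uniqueness for the linear equations `W' = Λ(DX(z)) W` along a solution `z`. -/
lemma eqOn_of_variational {F : Type*} [NormedAddCommGroup F] [NormedSpace ℝ F] [CompleteSpace F]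
    (Λ : ((Fin 4 → ℝ) →L[ℝ] (Fin 4 → ℝ)) →L[ℝ] (F →L[ℝ] F)) {a b : ℝ}
    (hz : SolvesOn (vectorField μ) (domain μ) z a b) {W₁ W₂ : ℝ → F}
    (h₁ : ∀ t ∈ Ioo a b, HasDerivAt W₁ (Λ (linField (μ, z t)) (W₁ t)) t)
    (h₂ : ∀ t ∈ Ioo a b, HasDerivAt W₂ (Λ (linField (μ, z t)) (W₂ t)) t)
    {t₀ : ℝ} (ht₀ : t₀ ∈ Ioo a b) (h : W₁ t₀ = W₂ t₀) : EqOn W₁ W₂ (Ioo a b) := by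
  let f : (Fin 4 → ℝ) × F → (Fin 4 → ℝ) × F := fun x =>
    (vectorField μ x.1, Λ (linField (μ, x.1)) x.2)
  let U : Set ((Fin 4 → ℝ) × F) := {x | x.1 ∈ domain μ}
  have hf : ∀ x ∈ U, ContDiffAt ℝ 1 f x := fun x hx => by
    have h1 : AnalyticAt ℝ (fun x : (Fin 4 → ℝ) × F => linField (μ, x.1)) x :=
      AnalyticAt.fun_comp (f := fun x : (Fin 4 → ℝ) × F => (μ, x.1)) (analyticAt_linField hx)
        (analyticAt_const.prod analyticAt_fst)
    have h2 : ContDiffAt ℝ 1 (fun x : (Fin 4 → ℝ) × F => Λ (linField (μ, x.1))) x :=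
      Λ.contDiff.contDiffAt.comp x h1.contDiffAt
    have h3 : ContDiffAt ℝ 1 (fun x : (Fin 4 → ℝ) × F => vectorField μ x.1) x :=
      ContDiffAt.comp (f := fun x : (Fin 4 → ℝ) × F => x.1) x (contDiffAt_vectorField _ hx)
        contDiffAt_fst
    exact h3.prodMk (h2.clm_apply contDiffAt_snd)
  have hs : ∀ W : ℝ → F, (∀ t ∈ Ioo a b, HasDerivAt W (Λ (linField (μ, z t)) (W t)) t) →
      SolvesOn f U (fun t => (z t, W t)) a b := fun W hW t ht =>
    ⟨(hz t ht).1, (hz t ht).2.prodMk (hW t ht)⟩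
  intro t ht
  have := (hs W₁ h₁).eqOn hf (hs W₂ h₂) ht₀ (by simp only [h]) ht
  exact (Prod.mk.injEq _ _ _ _ ▸ this).2

/-- `W` is the fundamental solution of the variational equation along `z` on `(-b, b)`. -/
def IsFundamental (μ : ℝ) (z : ℝ → Fin 4 → ℝ) (b : ℝ)
    (W : ℝ → (Fin 4 → ℝ) →L[ℝ] (Fin 4 → ℝ)) : Prop :=
  W 0 = ContinuousLinearMap.id ℝ _ ∧
    ∀ t ∈ Ioo (-b) b, HasDerivAt W ((linField (μ, z t)).comp (W t)) t

variable {W : ℝ → (Fin 4 → ℝ) →L[ℝ] (Fin 4 → ℝ)}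

lemma hasDerivAt_clm_apply {W' : (Fin 4 → ℝ) →L[ℝ] (Fin 4 → ℝ)} {t : ℝ} (h : HasDerivAt W W' t)
    (u : Fin 4 → ℝ) : HasDerivAt (fun t => W t u) (W' u) t :=
  (ContinuousLinearMap.apply ℝ (Fin 4 → ℝ) u).hasFDerivAt.comp_hasDerivAt t h

lemma IsFundamental.sympl_eq (hz : SolvesOn (vectorField μ) (domain μ) z (-b) b)
    (hW : IsFundamental μ z b W) {t : ℝ} (ht : t ∈ Ioo (-b) b) (u v : Fin 4 → ℝ) :
    sympl (W t u) (W t v) = sympl u v := by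
  have h0 : (0 : ℝ) ∈ Ioo (-b) b := ⟨by linarith [ht.1, ht.2], by linarith [ht.1, ht.2]⟩
  have h := eq_of_hasDerivAt_zero (u := fun t => sympl (W t u) (W t v)) (fun s hs => by
    have hu := hasDerivAt_pi.1 (hasDerivAt_clm_apply (hW.2 s hs) u)
    have hv := hasDerivAt_pi.1 (hasDerivAt_clm_apply (hW.2 s hs) v)
    refine ((((hu 0).mul (hv 2)).sub ((hu 2).mul (hv 0))).add
      (((hu 1).mul (hv 3)).sub ((hu 3).mul (hv 1)))).congr_deriv ?_
    have := sympl_linField (v := (μ, z s)) (hz s hs).1 (W s u) (W s v)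
    simp only [sympl] at this
    simp only [ContinuousLinearMap.comp_apply]
    linarith) ht h0
  simpa [hW.1] using h

lemma IsFundamental.symplectic (hz : SolvesOn (vectorField μ) (domain μ) z (-b) b)
    (hW : IsFundamental μ z b W) {t : ℝ} (ht : t ∈ Ioo (-b) b) :
    (LinearMap.toMatrix' (W t).toLinearMap).transpose * symplecticJ *
      LinearMap.toMatrix' (W t).toLinearMap = symplecticJ := by
  set M := LinearMap.toMatrix' (W t).toLinearMap with hM
  have hMv : ∀ v, M.mulVec v = W t v := fun v => by
    rw [hM, LinearMap.toMatrix'_mulVec]; rfl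
  refine Matrix.ext_of_mulVec_single fun j => ?_
  refine dotProduct_eq _ _ fun u => ?_
  rw [dotProduct_comm, dotProduct_comm _ u, dotProduct_symplecticJ, ← Matrix.mulVec_mulVec, ← Matrix.mulVec_mulVec,
    Matrix.dotProduct_mulVec, Matrix.vecMul_transpose, dotProduct_symplecticJ, hMv, hMv,
    hW.sympl_eq hz ht]

lemma IsFundamental.det_eq_one (hz : SolvesOn (vectorField μ) (domain μ) z (-b) b)
    (hW : IsFundamental μ z b W) {t : ℝ} (ht : t ∈ Ioo (-b) b) :
    (LinearMap.toMatrix' (W t).toLinearMap).det = 1 := by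
  have h0 : (0 : ℝ) ∈ Ioo (-b) b := ⟨by linarith [ht.1, ht.2], by linarith [ht.1, ht.2]⟩
  have hJ : symplecticJ.det ≠ 0 :=
    ((Matrix.isUnit_iff_isUnit_det _).1 isUnit_symplecticJ).ne_zero
  have hsq : EqOn ((fun t => (LinearMap.toMatrix' (W t).toLinearMap).det) ^ 2) 1 (Ioo (-b) b) := by
    intro s hs
    have h := congrArg Matrix.det (hW.symplectic hz hs)
    rw [Matrix.det_mul, Matrix.det_mul, Matrix.det_transpose] at h
    refine mul_right_cancel₀ hJ ?_
    simp only [Pi.pow_apply, Pi.one_apply, one_mul]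
    linear_combination h
  have hc : ContinuousOn (fun t => (LinearMap.toMatrix' (W t).toLinearMap).det)
      (Ioo (-b) b) := by
    intro s hs
    refine ContinuousAt.continuousWithinAt ?_
    have hcont : ContinuousAt (fun t => LinearMap.toMatrix' (W t).toLinearMap) s := by
      refine continuousAt_pi.2 fun i => continuousAt_pi.2 fun j => ?_
      simp only [LinearMap.toMatrix'_apply]
      exact (hasDerivAt_pi.1 (hasDerivAt_clm_apply (hW.2 s hs) _) i).continuousAt
    exact (Continuous.matrix_det continuous_id).continuousAt.comp hcont
  rcases isPreconnected_Ioo.eq_one_or_eq_neg_one_of_sq_eq hc hsq with h | h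
  · exact h ht
  · have := h h0
    simp only [hW.1] at this
    norm_num at this

/-- The vector field along a solution satisfies the variational equation. -/
lemma IsFundamental.apply_vectorField (hz : SolvesOn (vectorField μ) (domain μ) z (-b) b)
    (hW : IsFundamental μ z b W) {t : ℝ} (ht : t ∈ Ioo (-b) b) :
    W t (vectorField μ (z 0)) = vectorField μ (z t) := by
  have h0 : (0 : ℝ) ∈ Ioo (-b) b := ⟨by linarith [ht.1, ht.2], by linarith [ht.1, ht.2]⟩
  refine eqOn_of_variational (ContinuousLinearMap.id ℝ _) hz
    (W₁ := fun t => W t (vectorField μ (z 0))) (W₂ := fun t => vectorField μ (z t))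
    (fun s hs => ?_) (fun s hs => ?_) h0 (by simp [hW.1]) ht
  · exact hasDerivAt_clm_apply (hW.2 s hs) _
  · have h := (analyticAt_vectorField (hz s hs).1).differentiableAt.hasFDerivAt.comp_hasDerivAt s
      (hz s hs).2
    rw [← linField_eq (hz s hs).1] at h
    exact h

lemma IsFundamental.add_period (hz : SolvesOn (vectorField μ) (domain μ) z (-b) b)
    (hW : IsFundamental μ z b W) {T : ℝ} (hT : T ∈ Ioo 0 b) {k m : ℤ}
    (hper : ∀ t, z (t + T) = z t + angleShift k m) {t : ℝ} (ht : t ∈ Ioo (-b) b)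
    (ht' : t + T ∈ Ioo (-b) b) : W (t + T) = (W t).comp (W T) := by
  refine eqOn_of_variational (ContinuousLinearMap.compL ℝ _ _ _)
    (hz.mono (le_refl (-b)) (by linarith [hT.1] : b - T ≤ b))
    (W₁ := fun t => W (t + T)) (W₂ := fun t => (W t).comp (W T))
    (fun s hs => ?_) (fun s hs => ?_) (t₀ := 0) ⟨by linarith [hT.1, hT.2], by linarith [hT.2]⟩ ?_
    ⟨ht.1, by linarith [ht'.2]⟩
  · have h := HasDerivAt.comp_add_const s T
      (hW.2 (s + T) ⟨by linarith [hs.1, hT.1], by linarith [hs.2]⟩)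
    have hs' : s ∈ Ioo (-b) b := ⟨hs.1, by linarith [hs.2, hT.1]⟩
    have hd := (hz s hs').1
    have hlin : linField (μ, z (s + T)) = linField (μ, z s) := by
      rw [hper, linField_eq hd, linField_eq (add_angleShift_mem_domain k m hd),
        ← fderiv_comp_add_right]
      refine Filter.EventuallyEq.fderiv_eq ?_
      filter_upwards [(isOpen_domain μ).mem_nhds hd] with y hy
      exact vectorField_add_angleShift (retrograde_of_mem_domain hy) k m
    rw [hlin] at h
    exact h
  · have hs' : s ∈ Ioo (-b) b := ⟨hs.1, by linarith [hs.2, hT.1]⟩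
    have h := (ContinuousLinearMap.compL ℝ (Fin 4 → ℝ) (Fin 4 → ℝ) (Fin 4 → ℝ)).flip
      (W T) |>.hasFDerivAt.comp_hasDerivAt s (hW.2 s hs')
    exact h
  · simp [hW.1]

/-- The fundamental solution over one period is the monodromy matrix. -/
lemma IsFundamental.isMonodromy (hz : IsSolution μ z)
    (hW : IsFundamental μ z b W) {T : ℝ} (hT : T ∈ Ioo 0 b) {k m : ℤ}
    (hper : ∀ t, z (t + T) = z t + angleShift k m) :
    IsMonodromy μ z T (LinearMap.toMatrix' (W T).toLinearMap) := by
  have hTb : T ∈ Ioo (-b) b := ⟨by linarith [hT.1, hT.2], hT.2⟩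
  have hb0 : (0 : ℝ) ∈ Ioo (-b) b := ⟨by linarith [hT.1, hT.2], by linarith [hT.1, hT.2]⟩
  set M := LinearMap.toMatrix' (W T).toLinearMap with hM
  have hMu : IsUnit M := by
    rw [Matrix.isUnit_iff_isUnit_det, hW.det_eq_one (hz.solvesOn (-b) b) hTb]
    exact isUnit_one
  obtain ⟨Z, hZT, hZ⟩ := exists_equivariant_extension (Units.mulRight hMu.unit)
    (fun t => LinearMap.toMatrix' (W t).toLinearMap) hT.1 hT.2 (fun t ht ht' => by
      rw [Units.mulRight_apply, IsUnit.unit_spec,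
        hW.add_period (hz.solvesOn (-b) b) hT hper ht ht', hM]
      exact LinearMap.toMatrix'_comp _ _)
  replace hZT : ∀ t, Z (t + T) = Z t * M := hZT
  have hlin : ∀ t, fderiv ℝ (vectorField μ) (z (t + T)) = fderiv ℝ (vectorField μ) (z t) := by
    intro t
    rw [hper, ← fderiv_comp_add_right]
    refine Filter.EventuallyEq.fderiv_eq ?_
    filter_upwards [(isOpen_domain μ).mem_nhds (hz t).1] with y hy
    exact vectorField_add_angleShift (retrograde_of_mem_domain hy) k m
  refine ⟨Z, ?_, hZ T hTb, ?_⟩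
  · rw [hZ 0 hb0, hW.1]
    exact LinearMap.toMatrix'_id
  let P : ℝ → Prop := fun t => ∀ i j, HasDerivAt (fun s => Z s i j)
      ((LinearMap.toMatrix' (fderiv ℝ (vectorField μ) (z t)).toLinearMap * Z t) i j) t
  have hmul : ∀ (t τ : ℝ) (N : Matrix (Fin 4) (Fin 4) ℝ), (∀ s, Z (s + τ) = Z s * N) →
      fderiv ℝ (vectorField μ) (z (t + τ)) = fderiv ℝ (vectorField μ) (z t) →
      P t → P (t + τ) := by
    intro t τ N hN hl h i j
    rw [hl, hN, ← Matrix.mul_assoc, Matrix.mul_apply]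
    have h2 := HasDerivAt.fun_sum (u := Finset.univ) fun x _ => (h i x).mul_const (N x j)
    have h3 : (fun s => ∑ x, Z s i x * N x j) = fun s => Z (s + τ) i j := by
      funext s
      rw [hN, Matrix.mul_apply]
    rw [h3] at h2
    have h4 := HasDerivAt.comp_add_const (t + τ) (-τ)
      (f := fun s => Z (s + τ) i j) (by rw [add_neg_cancel_right]; exact h2)
    simpa using h4
  have hP : Function.Periodic P T := fun t => propext ⟨fun h => by
    have h1 := hmul (t + T) (-T) M⁻¹ (fun s => by
      have := hZT (s + -T)
      rw [neg_add_cancel_right] at this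
      rw [this, Matrix.mul_nonsing_inv_cancel_right _ _ ((Matrix.isUnit_iff_isUnit_det _).1 hMu)])
      (by rw [add_neg_cancel_right, hlin]) h
    rwa [add_neg_cancel_right] at h1, hmul t T M hZT (hlin t)⟩
  have hloc : ∀ t ∈ Ioo (-b) b, P t := fun t ht i j => by
    have h1 := hasDerivAt_pi.1 (hasDerivAt_clm_apply (hW.2 t ht) (Pi.single j 1)) i
    have h2 : (fun s => Z s i j) =ᶠ[𝓝 t] fun s => W s (Pi.single j 1) i := by
      filter_upwards [isOpen_Ioo.mem_nhds ht] with s hs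
      rw [hZ s hs, LinearMap.toMatrix'_apply]
      rfl
    refine (h1.congr_of_eventuallyEq h2).congr_deriv ?_
    rw [hZ t ht, ← linField_eq (hz t).1, ← LinearMap.toMatrix'_comp, LinearMap.toMatrix'_apply]
    rfl
  intro t
  obtain ⟨n, hn⟩ := exists_int_shift_mem hT.1 hT.2 t
  have h1 := hP.int_mul n (t - n * T)
  rw [sub_add_cancel] at h1
  exact (eq_iff_iff.1 h1).2 (hloc _ hn)

end Monodromy

/-! ### The first-order perturbation -/

section FirstOrder

/-- The derivative `1/r + cos θ / r² - 1/Δ₁` of the Hamiltonian in the mass parameter at `μ = 0`. -/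
def pertHam (z : Fin 4 → ℝ) : ℝ :=
  1 / radius z + Real.cos (polarAngle z) / radius z ^ 2 - 1 / dist1 0 z

lemma fderiv_slice {F : Type*} [NormedAddCommGroup F] [NormedSpace ℝ F]
    {K : ℝ × (Fin 4 → ℝ) → F} {z : Fin 4 → ℝ} (hK : DifferentiableAt ℝ K (0, z)) (u : Fin 4 → ℝ) :
    fderiv ℝ (fun z => K (0, z)) z u = fderiv ℝ K (0, z) (0, u) := by
  have h : HasFDerivAt (fun z => K (0, z)) ((fderiv ℝ K (0, z)).comp (.inr ℝ ℝ (Fin 4 → ℝ))) z :=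
    HasFDerivAt.comp (f := fun z => ((0 : ℝ), z)) z hK.hasFDerivAt (hasFDerivAt_prodMk_right _ _)
  rw [h.fderiv]
  rfl

lemma fderiv_jointHam_mass {z : Fin 4 → ℝ} (hz : z ∈ domain 0) :
    fderiv ℝ jointHam (0, z) (1, 0) = pertHam z := by
  have hr := retrograde_of_mem_domain hz
  have hr0 := radius_pos hr
  have h1 : HasDerivAt (fun μ => jointHam (μ, z)) (fderiv ℝ jointHam (0, z) (1, 0)) 0 :=
    HasFDerivAt.comp_hasDerivAt (l := jointHam) (f := fun μ : ℝ => (μ, z)) (0 : ℝ)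
      (analyticAt_jointHam (v := (0, z)) hz).differentiableAt.hasFDerivAt
      ((hasDerivAt_id' (0 : ℝ)).prodMk (hasDerivAt_const (0 : ℝ) z))
  have hs : (posX z + 0) ^ 2 + posY z ^ 2 = radius z ^ 2 := by
    rw [add_zero, posX_sq_add_posY_sq]
  have h0 : HasDerivAt (fun μ => dist0 μ z) (posX z / radius z) 0 := by
    have h := ((((hasDerivAt_id' (0 : ℝ)).const_add (posX z)).fun_pow 2).add_const
      (posY z ^ 2)).sqrt (by rw [hs]; positivity)
    refine h.congr_deriv ?_
    rw [hs, Real.sqrt_sq hr0.le]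
    field_simp
    simp [mul_comm]
  obtain ⟨d, hd⟩ : ∃ d, HasDerivAt (fun μ => dist1 μ z) d 0 :=
    ⟨_, ((analyticAt_dist1 hr hz.2.2.2).differentiableAt.comp (0 : ℝ)
      (f := fun μ : ℝ => (μ, z)) (by fun_prop)).hasDerivAt⟩
  have hd0 : dist0 0 z = radius z := dist0_zero hr
  have h2 := ((((hasDerivAt_id' (0 : ℝ)).const_sub 1).fun_div h0 hz.2.2.1.ne').fun_add
    ((hasDerivAt_id' (0 : ℝ)).fun_div hd hz.2.2.2.ne')).sub_const (1 / radius z)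
  have h3 := h2.const_sub (-1 / (2 * z 0 ^ 2) - z 1)
  refine (h1.unique h3).trans ?_
  have hd1 := hz.2.2.2.ne'
  rw [hd0, pertHam]
  simp only [posX]
  field_simp
  ring

lemma analyticAt_pertHam {z : Fin 4 → ℝ} (hz : z ∈ domain 0) : AnalyticAt ℝ pertHam z := by
  have h : AnalyticAt ℝ (fun z => fderiv ℝ jointHam (0, z) (1, 0)) z :=
    AnalyticAt.fun_comp (f := fun z => ((0 : ℝ), z)) (g := fun v => fderiv ℝ jointHam v (1, 0))
      (analyticAt_fderiv_apply (analyticAt_jointHam hz) _) (analyticAt_const.prod analyticAt_id)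
  refine h.congr ?_
  filter_upwards [(isOpen_domain 0).mem_nhds hz] with y hy
  exact fderiv_jointHam_mass hy

/-- Second derivatives of the first-order perturbation. -/
def pertHess (u w z : Fin 4 → ℝ) : ℝ := fderiv ℝ (fun y => fderiv ℝ pertHam y u) z w

lemma analyticAt_pertHess {z : Fin 4 → ℝ} (hz : z ∈ domain 0) (u w : Fin 4 → ℝ) :
    AnalyticAt ℝ (pertHess u w) z :=
  analyticAt_fderiv_apply (analyticAt_fderiv_apply (analyticAt_pertHam hz) u) w

lemma pertHess_comm {z : Fin 4 → ℝ} (hz : z ∈ domain 0) (u w : Fin 4 → ℝ) :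
    pertHess u w z = pertHess w u z :=
  fderiv_apply_comm (analyticAt_pertHam hz) w u

/-- The mixed derivative `∂_μ ∂_l ∂_l` of the Hamiltonian. -/
lemma fderiv_hess_mass {z : Fin 4 → ℝ} (hz : z ∈ domain 0) (u : Fin 4 → ℝ) :
    fderiv ℝ (fun v => hess v u u) (0, z) (1, 0) = pertHess u u z := by
  have hz' : ((0 : ℝ), z) ∈ fullDomain := hz
  have hA := analyticAt_fderiv_apply (analyticAt_jointHam hz') ((1 : ℝ), (0 : Fin 4 → ℝ))
  have h1 := fderiv_apply_comm (analyticAt_fderiv_apply (analyticAt_jointHam hz')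
    ((0 : ℝ), u)) (1, 0) (0, u)
  change fderiv ℝ (fun y => fderiv ℝ (fun y => fderiv ℝ jointHam y (0, u)) y (0, u)) (0, z) (1, 0)
    = _
  rw [h1]
  have h2 : (fun y => fderiv ℝ (fun y => fderiv ℝ jointHam y (0, u)) y (1, 0)) =ᶠ[𝓝 ((0 : ℝ), z)]
      fun y => fderiv ℝ (fun y => fderiv ℝ jointHam y (1, 0)) y (0, u) := by
    filter_upwards [isOpen_fullDomain.mem_nhds hz'] with y hy
    exact fderiv_apply_comm (analyticAt_jointHam hy) _ _
  rw [h2.fderiv_eq, ← fderiv_slice (analyticAt_fderiv_apply hA (0, u)).differentiableAt, pertHess]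
  congr 1
  refine Filter.EventuallyEq.fderiv_eq ?_
  filter_upwards [(isOpen_domain 0).mem_nhds hz] with y hy
  have hy' : ((0 : ℝ), y) ∈ fullDomain := hy
  rw [← fderiv_slice (analyticAt_fderiv_apply (analyticAt_jointHam hy') _).differentiableAt]
  congr 1
  refine Filter.EventuallyEq.fderiv_eq ?_
  filter_upwards [(isOpen_domain 0).mem_nhds hy] with x hx
  exact fderiv_jointHam_mass hx

/-- The derivative of `-∂²H/∂l²` in `μ` along a curve of states. -/
lemma hasDerivAt_hess_mass {z : Fin 4 → ℝ} (hz : z ∈ domain 0) {c : ℝ → Fin 4 → ℝ}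
    (hc : AnalyticAt ℝ c 0) (hc0 : c 0 = z) :
    HasDerivAt (fun μ => linField (μ, c μ) (Pi.single 2 1) 0)
      (-pertHess (Pi.single 2 1) (Pi.single 2 1) z) 0 := by
  have hz' : ((0 : ℝ), z) ∈ fullDomain := hz
  set e₂ : Fin 4 → ℝ := Pi.single 2 1 with he₂
  have hA : AnalyticAt ℝ (fun v => hess v e₂ e₂) (0, z) :=
    analyticAt_fderiv_apply (analyticAt_fderiv_apply (analyticAt_jointHam hz') _) _
  have hcd := hc.differentiableAt.hasDerivAt
  have h1 : HasDerivAt (fun μ => hess (μ, c μ) e₂ e₂)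
      (fderiv ℝ (fun v => hess v e₂ e₂) (0, z) (1, deriv c 0)) 0 := by
    have h := HasFDerivAt.comp_hasDerivAt_of_eq (f := fun μ => (μ, c μ)) (0 : ℝ)
      hA.differentiableAt.hasFDerivAt ((hasDerivAt_id' (0 : ℝ)).prodMk hcd) (by rw [hc0])
    exact h
  have h2 : fderiv ℝ (fun v => hess v e₂ e₂) (0, z) (1, deriv c 0) = pertHess e₂ e₂ z := by
    rw [show ((1 : ℝ), deriv c 0) = (1, 0) + (0, deriv c 0) by simp, map_add,
      fderiv_hess_mass hz, ← fderiv_slice hA.differentiableAt]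
    have h3 : (fun y => hess ((0 : ℝ), y) e₂ e₂) =ᶠ[𝓝 z] fun _ => 0 := by
      filter_upwards [(isOpen_domain 0).mem_nhds hz] with y hy
      have h4 := congrFun (linField_apply (v := ((0 : ℝ), y)) hy e₂) 0
      rw [linField_zero hy, shear_apply] at h4
      simpa using h4.symm
    rw [h3.fderiv_eq]
    simp
  rw [h2] at h1
  refine h1.fun_neg.congr_of_eventuallyEq ?_
  have hcont : ContinuousAt (fun μ => (μ, c μ)) 0 := continuousAt_id.prodMk hc.continuousAt
  filter_upwards [hcont.preimage_mem_nhds (isOpen_fullDomain.mem_nhds (by rw [hc0]; exact hz'))]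
    with μ hμ
  rw [linField_apply hμ]
  rfl

lemma dist1_zero_eq (z : Fin 4 → ℝ) :
    dist1 0 z = √(1 + radius z ^ 2 - 2 * radius z * Real.cos (polarAngle z)) := by
  rw [dist1]
  congr 1
  have hx : posX z = radius z * Real.cos (polarAngle z) := rfl
  linear_combination posX_sq_add_posY_sq z - 2 * hx

/-- The second derivative of the first-order perturbation in `g`. -/
lemma pertHess_three {z : Fin 4 → ℝ} (hz : z ∈ domain 0) :
    pertHess (Pi.single 3 1) (Pi.single 3 1) z = -(1 / radius z) *
      (iteratedDeriv 2 (rOverDelta1 (radius z)) (polarAngle z)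
        + Real.cos (polarAngle z) / radius z) := by
  have hr := radius_pos (retrograde_of_mem_domain hz)
  set e₃ : Fin 4 → ℝ := Pi.single 3 1 with he₃
  set r := radius z with hr'
  set θ := polarAngle z with hθ
  let c : ℝ → Fin 4 → ℝ := fun s => z + s • e₃
  have hc : ∀ s, HasDerivAt c e₃ s := fun s => by
    exact (((hasDerivAt_id' s).smul_const e₃).const_add z).congr_deriv (one_smul ℝ e₃)
  have hc0 : c 0 = z := by simp [c]
  have hcr : ∀ s, radius (c s) = r := fun s => by
    simp [c, radius, ecc, hr', he₃]
  have hcθ : ∀ s, polarAngle (c s) = θ + s := fun s => by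
    simp [c, polarAngle, ecc, hθ, he₃]
    ring
  have hdom : ∀ᶠ s in 𝓝 (0 : ℝ), c s ∈ domain 0 :=
    (hc 0).continuousAt.preimage_mem_nhds ((isOpen_domain 0).mem_nhds (by rw [hc0]; exact hz))
  have hfun : (fun s => rOverDelta1 r (θ + s)) =
      fun s => 1 + Real.cos (θ + s) / r - r * pertHam (c s) := by
    funext s
    rw [pertHam, dist1_zero_eq, hcr, hcθ, rOverDelta1]
    field_simp
    ring
  have hd1 : ∀ s, c s ∈ domain 0 → HasDerivAt (fun s => pertHam (c s))
      (fderiv ℝ pertHam (c s) e₃) s := fun s hs =>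
    (analyticAt_pertHam hs).differentiableAt.hasFDerivAt.comp_hasDerivAt s (hc s)
  have hd2 : HasDerivAt (fun s => fderiv ℝ pertHam (c s) e₃) (pertHess e₃ e₃ z) 0 := by
    have := HasFDerivAt.comp_hasDerivAt_of_eq (f := c) (0 : ℝ)
      (analyticAt_fderiv_apply (analyticAt_pertHam hz) e₃).differentiableAt.hasFDerivAt (hc 0) hc0.symm
    exact this
  have hcos : ∀ s, HasDerivAt (fun s => Real.cos (θ + s)) (-Real.sin (θ + s)) s := fun s => by
    simpa using ((hasDerivAt_id' s).const_add θ).cos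
  have hsin : HasDerivAt (fun s => Real.sin (θ + s)) (Real.cos θ) 0 := by
    simpa using ((hasDerivAt_id' (0 : ℝ)).const_add θ).sin
  have hderiv : deriv (fun s => rOverDelta1 r (θ + s)) =ᶠ[𝓝 0]
      fun s => -Real.sin (θ + s) / r - r * fderiv ℝ pertHam (c s) e₃ := by
    filter_upwards [hdom] with s hs
    rw [hfun]
    exact ((((hcos s).div_const r).const_add 1).fun_sub ((hd1 s hs).const_mul r)).deriv
  have h2 : iteratedDeriv 2 (fun s => rOverDelta1 r (θ + s)) 0 =
      -Real.cos θ / r - r * pertHess e₃ e₃ z := by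
    rw [iteratedDeriv_succ, iteratedDeriv_one, hderiv.deriv_eq]
    exact ((hsin.fun_neg.div_const r).fun_sub (hd2.const_mul r)).deriv
  rw [iteratedDeriv_comp_const_add 2 (rOverDelta1 r) θ] at h2
  simp only [add_zero] at h2
  rw [h2]
  field_simp
  ring

lemma pertHam_add_angleShift {z : Fin 4 → ℝ} (hz : z ∈ domain 0) (k m : ℤ) :
    pertHam (z + angleShift k m) = pertHam z := by
  have hr := retrograde_of_mem_domain hz
  have hx := posX_add_angleShift hr k m
  have hrad := radius_add_angleShift hr k m
  have h : ∀ z, z ∈ retrograde → Real.cos (polarAngle z) / radius z ^ 2 =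
      posX z / radius z ^ 3 := fun z hz => by
    have := (radius_pos hz).ne'
    rw [posX]; field_simp
  rw [pertHam, pertHam, h z hr, h _ ((add_angleShift_mem_retrograde k m).2 hr), dist1, dist1, hx,
    posY_add_angleShift hr, hrad]

lemma fderiv_pertHam_add_angleShift {z : Fin 4 → ℝ} (hz : z ∈ domain 0) (k m : ℤ) :
    fderiv ℝ pertHam (z + angleShift k m) = fderiv ℝ pertHam z := by
  rw [← fderiv_comp_add_right]
  refine Filter.EventuallyEq.fderiv_eq ?_
  filter_upwards [(isOpen_domain 0).mem_nhds hz] with y hy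
  exact pertHam_add_angleShift hy k m

lemma pertHess_add_angleShift {z : Fin 4 → ℝ} (hz : z ∈ domain 0) (u w : Fin 4 → ℝ) (k m : ℤ) :
    pertHess u w (z + angleShift k m) = pertHess u w z := by
  rw [pertHess, pertHess, ← fderiv_comp_add_right]
  congr 1
  refine Filter.EventuallyEq.fderiv_eq ?_
  filter_upwards [(isOpen_domain 0).mem_nhds hz] with y hy
  rw [fderiv_pertHam_add_angleShift hy]

end FirstOrder

/-! ### Averages over the unperturbed orbit -/

section Averages

variable {p q : ℕ} {e : ℝ} {nl ng : Fin 2}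

lemma unperturbed_add_period (hp : 0 < p) (t : ℝ) : unperturbed p q e nl ng (t + 2 * Real.pi * p) =
    unperturbed p q e nl ng t + angleShift (-q) (-p) := by
  have : (p : ℝ) ≠ 0 := by positivity
  funext i
  fin_cases i <;> simp [unperturbed, angleShift] <;> field_simp <;> ring

/-- Integrals over the unperturbed orbit of total derivatives vanish, which relates the averages of
the second derivatives in `l` and in `g`. -/
lemma integral_pertHess_two (hp : 0 < p) (hq : 0 < q) (he : e ∈ Ioo (0 : ℝ) 1)
    (hnc : NonCollision p q e nl ng) :
    ((q : ℝ) / p) ^ 2 * ∫ t in (0 : ℝ)..(2 * Real.pi * p),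
      pertHess (Pi.single 2 1) (Pi.single 2 1) (unperturbed p q e nl ng t) =
    ∫ t in (0 : ℝ)..(2 * Real.pi * p),
      pertHess (Pi.single 3 1) (Pi.single 3 1) (unperturbed p q e nl ng t) := by
  set e₂ : Fin 4 → ℝ := Pi.single 2 1 with he₂
  set e₃ : Fin 4 → ℝ := Pi.single 3 1 with he₃
  set z := unperturbed p q e nl ng with hz
  have hdom : ∀ t, z t ∈ domain 0 := unperturbed_mem_domain hp hq he hnc
  have hz' : ∀ t, HasDerivAt z (-((q : ℝ) / p) • e₂ + -e₃) t := fun t => by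
    refine (hasDerivAt_unperturbed hp hq he nl ng t).congr_deriv ?_
    rw [vectorField_zero (unperturbed_mem_retrograde hp hq he nl ng t)]
    change ![0, 0, 1 / (-resL p q) ^ 3, -1] = _
    rw [one_div_neg_resL_pow_three]
    funext i
    fin_cases i <;> simp [he₂, he₃]
  have hcont : ∀ u w, Continuous fun t => pertHess u w (z t) := fun u w =>
    continuous_iff_continuousAt.2 fun t =>
      ContinuousAt.comp (analyticAt_pertHess (hdom t) u w).continuousAt (hz' t).continuousAt
  let Ψ : ℝ → ℝ := fun t => fderiv ℝ pertHam (z t) e₃ - q / p * fderiv ℝ pertHam (z t) e₂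
  have hΨ : ∀ t, HasDerivAt Ψ
      (((q : ℝ) / p) ^ 2 * pertHess e₂ e₂ (z t) - pertHess e₃ e₃ (z t)) t := fun t => by
    have h : ∀ u, HasDerivAt (fun t => fderiv ℝ pertHam (z t) u)
        (-((q : ℝ) / p) * pertHess u e₂ (z t) - pertHess u e₃ (z t)) t := fun u => by
      have h1 := (analyticAt_fderiv_apply (analyticAt_pertHam (hdom t))
        u).differentiableAt.hasFDerivAt.comp_hasDerivAt t (hz' t)
      refine h1.congr_deriv ?_
      rw [map_add, map_smul, map_neg, smul_eq_mul]
      rfl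
    refine ((h e₃).fun_sub ((h e₂).const_mul ((q : ℝ) / p))).congr_deriv ?_
    rw [pertHess_comm (hdom t) e₃ e₂]
    ring
  have hcsub : Continuous fun t =>
      ((q : ℝ) / p) ^ 2 * pertHess e₂ e₂ (z t) - pertHess e₃ e₃ (z t) :=
    ((hcont e₂ e₂).const_mul _).sub (hcont e₃ e₃)
  have hint := intervalIntegral.integral_eq_sub_of_hasDerivAt (a := 0) (b := 2 * Real.pi * p)
    (fun t _ => hΨ t) (hcsub.intervalIntegrable _ _)
  have hper : Ψ (2 * Real.pi * p) = Ψ 0 := by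
    have h := unperturbed_add_period (q := q) (e := e) (nl := nl) (ng := ng) hp 0
    rw [zero_add, ← hz] at h
    simp only [Ψ]
    rw [h, fderiv_pertHam_add_angleShift (hdom 0)]
  rw [hper, sub_self, intervalIntegral.integral_sub
    (((hcont e₂ e₂).const_mul _).intervalIntegrable _ _) ((hcont e₃ e₃).intervalIntegrable _ _),
    intervalIntegral.integral_const_mul] at hint
  linarith

lemma resL_sq : resL p q ^ 2 = ((p : ℝ) / q) ^ ((2 : ℝ) / 3) := by
  rw [resL, ← Real.rpow_natCast, ← Real.rpow_mul (by positivity)]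
  norm_num

lemma ecc_unperturbed (hp : 0 < p) (hq : 0 < q) (he : e ∈ Ioo (0 : ℝ) 1) (t : ℝ) :
    ecc (unperturbed p q e nl ng t) = e := by
  have hR := resL_pos hp hq
  have he2 : 0 ≤ 1 - e ^ 2 := by nlinarith [he.1, he.2]
  change √(1 - (-(resL p q * √(1 - e ^ 2))) ^ 2 / (-resL p q) ^ 2) = e
  rw [neg_sq, neg_sq, mul_pow, Real.sq_sqrt he2, mul_div_cancel_left₀ _ (pow_ne_zero 2 hR.ne'),
    sub_sub_cancel, Real.sqrt_sq he.1.le]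

lemma eccAnomaly_orbitTime (hp : 0 < p) (hq : 0 < q) (he : e ∈ Ioo (0 : ℝ) 1) (E : ℝ) :
    eccAnomaly e (unperturbed p q e nl ng (orbitTime p q e nl E) 2) = E := by
  have he' : |e| < 1 := abs_lt.2 ⟨by linarith [he.1], he.2⟩
  rw [eccAnomaly_eq_iff he']
  change _ = (nl : ℕ) * Real.pi - q * orbitTime p q e nl E / p
  rw [orbitTime]
  have hp0 : (p : ℝ) ≠ 0 := by positivity
  have hq0 : (q : ℝ) ≠ 0 := by positivity
  field_simp
  ring

lemma radius_orbitTime (hp : 0 < p) (hq : 0 < q) (he : e ∈ Ioo (0 : ℝ) 1) (E : ℝ) :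
    radius (unperturbed p q e nl ng (orbitTime p q e nl E)) = orbitR p q e E := by
  rw [radius, ecc_unperturbed hp hq he, eccAnomaly_orbitTime hp hq he, orbitR, ← resL_sq]
  change (-resL p q) ^ 2 * _ = _
  rw [neg_sq]

lemma polarAngle_orbitTime (hp : 0 < p) (hq : 0 < q) (he : e ∈ Ioo (0 : ℝ) 1) (E : ℝ) :
    polarAngle (unperturbed p q e nl ng (orbitTime p q e nl E)) = orbitTheta p q e nl ng E := by
  rw [polarAngle, ecc_unperturbed hp hq he, eccAnomaly_orbitTime hp hq he, orbitTheta]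
  rfl

lemma integral_pertHess_three (hp : 0 < p) (hq : 0 < q) (he : e ∈ Ioo (0 : ℝ) 1)
    (hnc : NonCollision p q e nl ng) :
    ∫ t in (0 : ℝ)..(2 * Real.pi * p),
      pertHess (Pi.single 3 1) (Pi.single 3 1) (unperturbed p q e nl ng t) =
    -(p / resL p q ^ 2) * ∫ F in (0 : ℝ)..(2 * Real.pi),
      (iteratedDeriv 2 (rOverDelta1 (orbitR p q e (q * F))) (orbitTheta p q e nl ng (q * F))
        + Real.cos (orbitTheta p q e nl ng (q * F)) / orbitR p q e (q * F)) := by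
  have hR := resL_pos hp hq
  have hdom : ∀ t, unperturbed p q e nl ng t ∈ domain 0 := unperturbed_mem_domain hp hq he hnc
  have hq0 : (q : ℝ) ≠ 0 := by positivity
  set k : ℝ → ℝ := fun t =>
    pertHess (Pi.single 3 1) (Pi.single 3 1) (unperturbed p q e nl ng t) with hk
  have hkc : Continuous k := continuous_iff_continuousAt.2 fun t =>
    ContinuousAt.comp (analyticAt_pertHess (hdom t) _ _).continuousAt
      (hasDerivAt_unperturbed hp hq he nl ng t).continuousAt
  have hkper : Function.Periodic k (2 * Real.pi * p) := fun t => by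
    simp only [hk, unperturbed_add_period hp, pertHess_add_angleShift (hdom t)]
  let τ : ℝ → ℝ := fun F => orbitTime p q e nl (q * F)
  have hτ : ∀ F, HasDerivAt τ (-(p * (1 - e * Real.cos (q * F)))) F := fun F => by
    have h1 := (hasDerivAt_kepler e (q * F)).comp F ((hasDerivAt_id' F).const_mul (q : ℝ))
    refine ((h1.const_sub (((nl : ℕ) : ℝ) * Real.pi)).mul_const ((p : ℝ) / q)).congr_deriv ?_
    field_simp
  have hsub := intervalIntegral.integral_comp_mul_deriv (a := 0) (b := 2 * Real.pi)
    (fun F _ => hτ F) (by fun_prop) hkc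
  have hend : τ (2 * Real.pi) + 2 * Real.pi * p = τ 0 := by
    have : Real.sin (q * (2 * Real.pi)) = 0 := by
      have := Real.sin_nat_mul_pi (q * 2)
      push_cast at this
      rw [← this]
      ring_nf
    simp only [τ, orbitTime, this, mul_zero, Real.sin_zero]
    field_simp
    ring
  rw [intervalIntegral.integral_symm (τ (2 * Real.pi)), ← hend,
    hkper.intervalIntegral_add_eq (τ (2 * Real.pi)) 0, zero_add] at hsub
  rw [← neg_eq_iff_eq_neg.2 hsub, ← intervalIntegral.integral_const_mul,
    ← intervalIntegral.integral_neg]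
  refine intervalIntegral.integral_congr fun F _ => ?_
  simp only [Function.comp_apply, hk, τ]
  rw [pertHess_three (hdom _), radius_orbitTime hp hq he, polarAngle_orbitTime hp hq he]
  have he' : |e| < 1 := abs_lt.2 ⟨by linarith [he.1], he.2⟩
  have hpos := (one_sub_mul_cos_pos he' (q * F)).ne'
  have hr : orbitR p q e (q * F) = resL p q ^ 2 * (1 - e * Real.cos (q * F)) := by
    rw [orbitR, resL_sq]
  rw [hr]
  field_simp

/-- The average of `∂²/∂l²` of the first-order perturbation in terms of the coefficient `C`. -/
lemma Ccoef_eq (hp : 0 < p) (hq : 0 < q) (he : e ∈ Ioo (0 : ℝ) 1)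
    (hnc : NonCollision p q e nl ng) :
    Ccoef p q nl ng e = 2 * Real.pi * p * (3 / resL p q ^ 4) *
      ∫ t in (0 : ℝ)..(2 * Real.pi * p),
        pertHess (Pi.single 2 1) (Pi.single 2 1) (unperturbed p q e nl ng t) := by
  have h2 := integral_pertHess_two hp hq he hnc
  rw [integral_pertHess_three hp hq he hnc] at h2
  have hR := resL_pos hp hq
  have h3 : resL p q ^ 3 = (p : ℝ) / q := resL_pow_three
  have hp0 : (p : ℝ) ≠ 0 := by positivity
  have hq0 : (q : ℝ) ≠ 0 := by positivity
  rw [Ccoef]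
  set I := ∫ F in (0 : ℝ)..(2 * Real.pi),
      (iteratedDeriv 2 (rOverDelta1 (orbitR p q e (q * F))) (orbitTheta p q e nl ng (q * F))
        + Real.cos (orbitTheta p q e nl ng (q * F)) / orbitR p q e (q * F))
  set K := ∫ t in (0 : ℝ)..(2 * Real.pi * p),
        pertHess (Pi.single 2 1) (Pi.single 2 1) (unperturbed p q e nl ng t)
  have hqp : (q : ℝ) / p = (resL p q ^ 3)⁻¹ := by rw [h3, inv_div]
  rw [hqp] at h2
  have hK : K = -(p * resL p q ^ 4) * I := by
    field_simp at h2
    have h4 : K * resL p q ^ 2 = (-(p * resL p q ^ 4) * I) * resL p q ^ 2 := by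
      rw [h2]; ring
    exact mul_right_cancel₀ (pow_ne_zero 2 hR.ne') h4
  rw [hK]
  field_simp
  ring

end Averages

/-! ### Characteristic multipliers -/

section Multipliers

/-- The trace as a continuous linear functional. -/
def traceL : ((Fin 4 → ℝ) →L[ℝ] (Fin 4 → ℝ)) →L[ℝ] ℝ :=
  ∑ i : Fin 4, (ContinuousLinearMap.proj (R := ℝ) (φ := fun _ : Fin 4 => ℝ) i).comp
    (ContinuousLinearMap.apply ℝ (Fin 4 → ℝ) (Pi.single i 1))

lemma traceL_apply (A : (Fin 4 → ℝ) →L[ℝ] (Fin 4 → ℝ)) :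
    traceL A = ∑ i, A (Pi.single i 1) i := by
  simp [traceL]

lemma traceL_eq_matrix (A : (Fin 4 → ℝ) →L[ℝ] (Fin 4 → ℝ)) :
    traceL A = (LinearMap.toMatrix' A.toLinearMap).trace := by
  simp [traceL_apply, Matrix.trace, LinearMap.toMatrix'_apply]

lemma traceL_comp_comm (A B : (Fin 4 → ℝ) →L[ℝ] (Fin 4 → ℝ)) :
    traceL (A.comp B) = traceL (B.comp A) := by
  rw [traceL_eq_matrix, traceL_eq_matrix, ContinuousLinearMap.toLinearMap_comp,
    ContinuousLinearMap.toLinearMap_comp, LinearMap.toMatrix'_comp, LinearMap.toMatrix'_comp,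
    Matrix.trace_mul_comm]

lemma traceL_linField {v : ℝ × (Fin 4 → ℝ)} (hv : v ∈ fullDomain) : traceL (linField v) = 0 := by
  rw [traceL_apply, Fin.sum_univ_four]
  simp only [linField_apply hv, Matrix.cons_val]
  rw [hess_comm hv (Pi.single 0 1), hess_comm hv (Pi.single 1 1)]
  ring

lemma traceL_shear_comp (c : ℝ) (A : (Fin 4 → ℝ) →L[ℝ] (Fin 4 → ℝ)) :
    traceL ((shear c).comp A) = c * A (Pi.single 2 1) 0 := by
  rw [traceL_apply, Fin.sum_univ_four]
  simp [shear_apply]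

lemma traceL_shear (c : ℝ) : traceL (shear c) = 0 := by
  rw [traceL_apply, Fin.sum_univ_four]
  simp [shear_apply]

lemma traceL_id : traceL (ContinuousLinearMap.id ℝ _) = 4 := by
  rw [traceL_apply, Fin.sum_univ_four]
  simp
  norm_num

variable {p q : ℕ} {e : ℝ} {nl ng : Fin 2} {b ε : ℝ} {ζ : ℝ × (ℝ × (Fin 4 → ℝ)) → Fin 4 → ℝ}
  {Y : ℝ × (ℝ × (Fin 4 → ℝ)) → (Fin 4 → ℝ) →L[ℝ] (Fin 4 → ℝ)}
  {δ : ℝ} {γ : ℝ → ℝ → Fin 4 → ℝ} {T L : ℝ → ℝ}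

/-- The fundamental solution for `μ = 0` along the unperturbed orbit is a shear. -/
lemma IsFlowNear.fund_eq_shear
    (hF : IsFlowNear (initialState p q e nl ng (-resL p q)) b ε ζ Y) {t : ℝ}
    (ht : t ∈ Ioo (-b) b) :
    Y (t, ((0 : ℝ), initialState p q e nl ng (-resL p q))) =
      ContinuousLinearMap.id ℝ _ + t • shear (-3 / resL p q ^ 4) := by
  set w : ℝ × (Fin 4 → ℝ) := ((0 : ℝ), initialState p q e nl ng (-resL p q)) with hw
  have h0 : (0 : ℝ) ∈ Ioo (-b) b := ⟨by linarith [ht.1, ht.2], by linarith [ht.1, ht.2]⟩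
  have hs : SolvesOn (vectorField 0) (domain 0) (fun t => ζ (t, w)) (-b) b :=
    hF.solves w hF.base_mem
  have hlin : ∀ s ∈ Ioo (-b) b, linField (0, ζ (s, w)) = shear (-3 / resL p q ^ 4) := by
    intro s hs'
    have h := linField_zero (hs s hs').1
    simp only [hw, hF.eq_unperturbed hs'] at h ⊢
    rw [h]
    change shear (-3 / (-resL p q) ^ 4) = _
    rw [Even.neg_pow ⟨2, rfl⟩]
  refine eqOn_of_variational (ContinuousLinearMap.compL ℝ _ _ _) hs (W₁ := fun t => Y (t, w))
    (W₂ := fun t => ContinuousLinearMap.id ℝ _ + t • shear (-3 / resL p q ^ 4))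
    (hF.fund_deriv w hF.base_mem) (fun s hs' => ?_) h0 ?_ ht
  · refine (((hasDerivAt_id' s).smul_const (shear (-3 / resL p q ^ 4))).const_add
      (ContinuousLinearMap.id ℝ (Fin 4 → ℝ))).congr_deriv ?_
    rw [hlin s hs', ContinuousLinearMap.compL_apply, ContinuousLinearMap.comp_add,
      ContinuousLinearMap.comp_smul, shear_comp_shear]
    simp
  · simp only [hF.fund_zero w hF.base_mem]
    simp

namespace IsFlowFamily

lemma analyticAt_param (hG : IsFlowFamily p q e nl ng b ε ζ δ γ T L) (he : e ∈ Ioo (0 : ℝ) 1)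
    {μ : ℝ} (hμ : μ ∈ Ioo (-δ) δ) :
    AnalyticAt ℝ (fun μ => (μ, initialState p q e nl ng (L μ))) μ :=
  analyticAt_id.prod (hG.analyticAt_initialState he hμ)

lemma analyticAt_fund (hG : IsFlowFamily p q e nl ng b ε ζ δ γ T L)
    (hF : IsFlowNear (initialState p q e nl ng (-resL p q)) b ε ζ Y) (he : e ∈ Ioo (0 : ℝ) 1)
    {μ : ℝ} (hμ : μ ∈ Ioo (-δ) δ) {t : ℝ} (ht : t ∈ Ioo (-b) b) :
    AnalyticAt ℝ (fun v : ℝ × ℝ => Y (v.1, (v.2, initialState p q e nl ng (L v.2)))) (t, μ) :=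
  AnalyticAt.fun_comp (f := fun v : ℝ × ℝ => (v.1, (v.2, initialState p q e nl ng (L v.2))))
    (hF.fund_analytic _ (hG.mem_ball μ hμ) t ht)
    (analyticAt_fst.prod (AnalyticAt.fun_comp (f := fun v : ℝ × ℝ => v.2)
      (g := fun μ => (μ, initialState p q e nl ng (L μ))) (hG.analyticAt_param he hμ)
        analyticAt_snd))

/-- The derivative at `μ = 0` of the trace of the fundamental solution at time `2πp`. The fundamental
solution is multiplied by `1 + (T₀ - t) A₀`, the unperturbed propagator from `t` to `T₀ = 2πp`, so
that its own first variation in `μ`, which is not known explicitly, cancels. -/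
lemma fderiv_trace (hG : IsFlowFamily p q e nl ng b ε ζ δ γ T L)
    (hF : IsFlowNear (initialState p q e nl ng (-resL p q)) b ε ζ Y) (hp : 0 < p) (hq : 0 < q)
    (he : e ∈ Ioo (0 : ℝ) 1) (hnc : NonCollision p q e nl ng) (hb : 2 * Real.pi * p < b) :
    HasDerivAt (fun μ => traceL (Y (2 * Real.pi * p, (μ, initialState p q e nl ng (L μ)))))
      (Ccoef p q nl ng e) 0 := by
  have hT0 : 0 < 2 * Real.pi * p := by positivity
  set T₀ := 2 * Real.pi * p with hT₀
  set c : ℝ := -3 / resL p q ^ 4 with hc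
  set A₀ := shear c with hA₀
  set x : ℝ → Fin 4 → ℝ := fun μ => initialState p q e nl ng (L μ) with hx
  have hx0 : x 0 = initialState p q e nl ng (-resL p q) := by simp only [hx, hG.L_zero]
  have hz0 := hG.zero_mem
  let B : ℝ → (Fin 4 → ℝ) →L[ℝ] (Fin 4 → ℝ) := fun t =>
    ContinuousLinearMap.id ℝ _ + (T₀ - t) • A₀
  have hA00 : A₀.comp A₀ = 0 := shear_comp_shear c c
  have hBA : ∀ t, (B t).comp A₀ = A₀ := fun t => by
    simp only [B, ContinuousLinearMap.add_comp, ContinuousLinearMap.smul_comp, hA00]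
    simp
  let Q : ℝ × ℝ → ℝ := fun v => traceL ((B v.1).comp (Y (v.1, (v.2, x v.2))))
  have hBa : ∀ v : ℝ × ℝ, AnalyticAt ℝ (fun v : ℝ × ℝ => B v.1) v := fun v =>
    analyticAt_const.add ((analyticAt_const.sub analyticAt_fst).smul analyticAt_const)
  have hcompL : ∀ v, AnalyticAt ℝ (fun v : ((Fin 4 → ℝ) →L[ℝ] (Fin 4 → ℝ)) ×
      ((Fin 4 → ℝ) →L[ℝ] (Fin 4 → ℝ)) => v.1.comp v.2) v :=
    fun v => (ContinuousLinearMap.compL ℝ (Fin 4 → ℝ) (Fin 4 → ℝ) (Fin 4 → ℝ)).analyticAt_bilinear v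
  have hQa : ∀ t ∈ Ioo (-b) b, ∀ μ ∈ Ioo (-δ) δ, AnalyticAt ℝ Q (t, μ) := fun t ht μ hμ =>
    (traceL.analyticAt _).fun_comp ((hcompL _).fun_comp
      ((hBa (t, μ)).prod (hG.analyticAt_fund hF he hμ ht)))
  -- the derivative of `Q` in time
  let f : ℝ → ℝ → ℝ := fun t μ => traceL (-(A₀.comp (Y (t, (μ, x μ)))) +
    (B t).comp ((linField (μ, ζ (t, (μ, x μ)))).comp (Y (t, (μ, x μ)))))
  have hBd : ∀ t, HasDerivAt B (-A₀) t := fun t => by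
    refine ((((hasDerivAt_id' t).const_sub T₀).smul_const A₀).const_add
      (ContinuousLinearMap.id ℝ (Fin 4 → ℝ))).congr_deriv ?_
    rw [neg_one_smul]
  have hQt : ∀ t ∈ Ioo (-b) b, ∀ μ ∈ Ioo (-δ) δ, fderiv ℝ Q (t, μ) (1, 0) = f t μ := by
    intro t ht μ hμ
    have h1 : HasDerivAt (fun s => Q (s, μ)) (fderiv ℝ Q (t, μ) (1, 0)) t :=
      HasFDerivAt.comp_hasDerivAt (l := Q) (f := fun s : ℝ => (s, μ)) t
        (hQa t ht μ hμ).differentiableAt.hasFDerivAt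
        ((hasDerivAt_id' t).prodMk (hasDerivAt_const t μ))
    have h2 : HasDerivAt (fun s => Q (s, μ)) (f t μ) t := by
      refine traceL.hasFDerivAt.comp_hasDerivAt t
        (((hBd t).clm_comp (hF.fund_deriv _ (hG.mem_ball μ hμ) t ht)).congr_deriv ?_)
      simp [hx]
    exact h1.unique h2
  -- the mixed second derivative of `Q`
  have hzeta : ∀ t ∈ Ioo (-b) b, AnalyticAt ℝ (fun μ => ζ (t, (μ, x μ))) 0 := fun t ht =>
    AnalyticAt.fun_comp (f := fun μ => (t, (μ, x μ))) (hF.analytic _ (hG.mem_ball 0 hz0) t ht)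
      (analyticAt_const.prod (hG.analyticAt_param he hz0))
  have hzeta0 : ∀ t ∈ Ioo (-b) b, ζ (t, ((0 : ℝ), x 0)) = unperturbed p q e nl ng t :=
    fun t ht => by rw [hx0, hF.eq_unperturbed ht]
  have hdom : ∀ t, unperturbed p q e nl ng t ∈ domain 0 := unperturbed_mem_domain hp hq he hnc
  let k : ℝ → ℝ := fun t => pertHess (Pi.single 2 1) (Pi.single 2 1) (unperturbed p q e nl ng t)
  have hf : ∀ t ∈ Ioo (-b) b, HasDerivAt (f t) (T₀ * c * -k t) 0 := by
    intro t ht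
    have hYa : AnalyticAt ℝ (fun μ => Y (t, (μ, x μ))) 0 :=
      AnalyticAt.fun_comp (f := fun μ : ℝ => (t, μ))
        (g := fun v : ℝ × ℝ => Y (v.1, (v.2, x v.2))) (hG.analyticAt_fund hF he hz0 ht)
        (analyticAt_const.prod analyticAt_id)
    have hdom0 : ((0 : ℝ), ζ (t, ((0 : ℝ), x 0))) ∈ fullDomain := by
      rw [hzeta0 t ht]; exact hdom t
    have hAa : AnalyticAt ℝ (fun μ => linField (μ, ζ (t, (μ, x μ)))) 0 :=
      AnalyticAt.fun_comp (f := fun μ => (μ, ζ (t, (μ, x μ)))) (analyticAt_linField hdom0)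
        (analyticAt_id.prod (hzeta t ht))
    have hY0 : Y (t, ((0 : ℝ), x 0)) = ContinuousLinearMap.id ℝ _ + t • A₀ := by
      rw [hx0, hF.fund_eq_shear ht]
    have hA0 : linField ((0 : ℝ), ζ (t, ((0 : ℝ), x 0))) = A₀ := by
      rw [hzeta0 t ht, linField_zero (hdom t)]
      change shear (-3 / (-resL p q) ^ 4) = _
      rw [Even.neg_pow ⟨2, rfl⟩]
    obtain ⟨Y₁, hY₁⟩ : ∃ Y₁, HasDerivAt (fun μ => Y (t, (μ, x μ))) Y₁ 0 :=
      ⟨_, hYa.differentiableAt.hasDerivAt⟩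
    obtain ⟨A₁, hA₁⟩ : ∃ A₁, HasDerivAt (fun μ => linField (μ, ζ (t, (μ, x μ)))) A₁ 0 :=
      ⟨_, hAa.differentiableAt.hasDerivAt⟩
    have hA₁tr : traceL A₁ = 0 := by
      have h1 : HasDerivAt (fun μ => traceL (linField (μ, ζ (t, (μ, x μ))))) (traceL A₁) 0 :=
        traceL.hasFDerivAt.comp_hasDerivAt (0 : ℝ) hA₁
      have h2 : (fun μ => traceL (linField (μ, ζ (t, (μ, x μ))))) =ᶠ[𝓝 0] fun _ => 0 := by
        filter_upwards [isOpen_Ioo.mem_nhds hz0] with μ hμ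
        exact traceL_linField (hF.solves _ (hG.mem_ball μ hμ) t ht).1
      exact h1.unique ((hasDerivAt_const (0 : ℝ) (0 : ℝ)).congr_of_eventuallyEq h2)
    have hA₁e : A₁ (Pi.single 2 1) 0 = -k t := by
      have h1 := hasDerivAt_pi.1 (hasDerivAt_clm_apply hA₁ (Pi.single 2 1)) 0
      exact h1.unique (hasDerivAt_hess_mass (hdom t) (hzeta t ht) (hzeta0 t ht))
    have h1 := ((hasDerivAt_const (0 : ℝ) A₀).clm_comp hY₁).fun_neg.fun_add
      ((hasDerivAt_const (0 : ℝ) (B t)).clm_comp (hA₁.clm_comp hY₁))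
    have h2 := traceL.hasFDerivAt.comp_hasDerivAt (0 : ℝ) h1
    refine h2.congr_deriv ?_
    simp only [hY0, hA0]
    have e1 : (B t).comp (A₀.comp Y₁) = A₀.comp Y₁ := by
      rw [← ContinuousLinearMap.comp_assoc, hBA]
    have e2 : traceL ((B t).comp (A₁.comp (ContinuousLinearMap.id ℝ _ + t • A₀))) =
        traceL A₁ + T₀ * traceL (A₀.comp A₁) := by
      rw [← ContinuousLinearMap.comp_assoc, traceL_comp_comm, ← ContinuousLinearMap.comp_assoc]
      have e3 : (ContinuousLinearMap.id ℝ _ + t • A₀).comp (B t) =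
          ContinuousLinearMap.id ℝ _ + T₀ • A₀ := by
        simp only [B, ContinuousLinearMap.add_comp, ContinuousLinearMap.comp_add,
          ContinuousLinearMap.smul_comp, ContinuousLinearMap.comp_smul, hA00,
          ContinuousLinearMap.id_comp, ContinuousLinearMap.comp_id]
        module
      rw [e3, ContinuousLinearMap.add_comp, map_add, ContinuousLinearMap.smul_comp, map_smul,
        ContinuousLinearMap.id_comp, smul_eq_mul]
    simp only [ContinuousLinearMap.zero_comp, zero_add, ContinuousLinearMap.comp_add, map_add,
      map_neg, e1] at e2 ⊢
    rw [e2, hA₁tr, traceL_shear_comp c A₁, hA₁e]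
    ring
  -- integrate the mixed derivative over the orbit
  let D : ℝ → ℝ := fun t => fderiv ℝ Q (t, 0) (0, 1)
  have hD : ∀ t ∈ Ioo (-b) b, HasDerivAt D (T₀ * c * -k t) t := by
    intro t ht
    have hQ := hQa t ht 0 hz0
    have h1 : HasDerivAt D (fderiv ℝ (fun y => fderiv ℝ Q y (0, 1)) (t, 0) (1, 0)) t :=
      HasFDerivAt.comp_hasDerivAt (l := fun y => fderiv ℝ Q y (0, 1))
        (f := fun s : ℝ => (s, (0 : ℝ))) t
        (analyticAt_fderiv_apply hQ _).differentiableAt.hasFDerivAt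
        ((hasDerivAt_id' t).prodMk (hasDerivAt_const t 0))
    rw [fderiv_apply_comm hQ] at h1
    have h2 : HasDerivAt (fun μ => fderiv ℝ Q (t, μ) (1, 0))
        (fderiv ℝ (fun y => fderiv ℝ Q y (1, 0)) (t, 0) (0, 1)) 0 :=
      HasFDerivAt.comp_hasDerivAt (l := fun y => fderiv ℝ Q y (1, 0))
        (f := fun μ : ℝ => (t, μ)) (0 : ℝ)
        (analyticAt_fderiv_apply hQ _).differentiableAt.hasFDerivAt
        ((hasDerivAt_const (0 : ℝ) t).prodMk (hasDerivAt_id' 0))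
    have h3 : (fun μ => fderiv ℝ Q (t, μ) (1, 0)) =ᶠ[𝓝 0] f t := by
      filter_upwards [isOpen_Ioo.mem_nhds hz0] with μ hμ
      exact hQt t ht μ hμ
    rw [(h2.congr_of_eventuallyEq h3.symm).unique (hf t ht)] at h1
    exact h1
  have hslice : ∀ t ∈ Ioo (-b) b, HasDerivAt (fun μ => Q (t, μ)) (D t) 0 := fun t ht =>
    HasFDerivAt.comp_hasDerivAt (l := Q) (f := fun μ : ℝ => (t, μ)) (0 : ℝ)
      (hQa t ht 0 hz0).differentiableAt.hasFDerivAt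
      ((hasDerivAt_const (0 : ℝ) t).prodMk (hasDerivAt_id' 0))
  have hb0 : (0 : ℝ) ∈ Ioo (-b) b := ⟨by linarith, by linarith⟩
  have hbT : T₀ ∈ Ioo (-b) b := ⟨by linarith, by linarith⟩
  have hD0 : D 0 = 0 := by
    have h1 : (fun μ => Q (0, μ)) =ᶠ[𝓝 0] fun _ => traceL (B 0) := by
      filter_upwards [isOpen_Ioo.mem_nhds hz0] with μ hμ
      simp only [Q]
      rw [hF.fund_zero _ (hG.mem_ball μ hμ), ContinuousLinearMap.comp_id]
    exact (hslice 0 hb0).unique ((hasDerivAt_const _ _).congr_of_eventuallyEq h1)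
  have hkc : Continuous k := continuous_iff_continuousAt.2 fun t =>
    ContinuousAt.comp (analyticAt_pertHess (hdom t) _ _).continuousAt
      (hasDerivAt_unperturbed hp hq he nl ng t).continuousAt
  have hDT : D T₀ = Ccoef p q nl ng e := by
    have hcont : Continuous fun t => T₀ * c * -k t := continuous_const.mul hkc.neg
    have h := intervalIntegral.integral_eq_sub_of_hasDerivAt (a := 0) (b := T₀) (f := D)
      (fun t ht => hD t ?_) (hcont.intervalIntegrable _ _)
    · rw [hD0, sub_zero] at h
      rw [← h, intervalIntegral.integral_const_mul, intervalIntegral.integral_neg,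
        Ccoef_eq hp hq he hnc, hc]
      ring
    · rw [uIcc_of_le hT0.le] at ht
      exact ⟨by linarith [ht.1], by linarith [ht.2]⟩
  have h := hslice T₀ hbT
  rw [hDT] at h
  refine h.congr_of_eventuallyEq (Eventually.of_forall fun μ => ?_)
  simp [Q, B, x]

/-- The nontrivial multipliers are `h ± √(h² - 1)`, where `2h + 2` is the trace of the monodromy
matrix. The trace is `4 + Cμ + O(μ²)`: the period does not contribute to first order, since for
`μ = 0` the trace of the fundamental solution is constant in time. -/
lemma multipliersAsymptotic (hG : IsFlowFamily p q e nl ng b ε ζ δ γ T L)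
    (hF : IsFlowNear (initialState p q e nl ng (-resL p q)) b ε ζ Y) (hp : 0 < p) (hq : 0 < q)
    (he : e ∈ Ioo (0 : ℝ) 1) (hnc : NonCollision p q e nl ng) (hb : 2 * Real.pi * p < b) :
    MultipliersAsymptotic γ T (Ccoef p q nl ng e) := by
  have hT0 : 0 < 2 * Real.pi * p := by positivity
  have hz0 := hG.zero_mem
  have hb0 : (0 : ℝ) ∈ Ioo (-b) b := ⟨by linarith, by linarith⟩
  have hbT : 2 * Real.pi * p ∈ Ioo (-b) b := ⟨by linarith, by linarith⟩
  let x : ℝ → Fin 4 → ℝ := fun μ => initialState p q e nl ng (L μ)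
  have hx0 : x 0 = initialState p q e nl ng (-resL p q) := by simp only [x, hG.L_zero]
  let Q : ℝ × ℝ → ℝ := fun v => traceL (Y (v.1, (v.2, x v.2)))
  have hQa : ∀ t ∈ Ioo (-b) b, ∀ μ ∈ Ioo (-δ) δ, AnalyticAt ℝ Q (t, μ) := fun t ht μ hμ =>
    (traceL.analyticAt _).fun_comp (hG.analyticAt_fund hF he hμ ht)
  let h : ℝ → ℝ := fun μ => (Q (T μ, μ) - 2) / 2
  have hTQ : AnalyticAt ℝ (fun μ => Q (T μ, μ)) 0 :=
    AnalyticAt.fun_comp (f := fun μ => (T μ, μ)) (hQa _ (by rw [hG.T_zero]; exact hbT) 0 hz0)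
      ((hG.T_analytic 0 hz0).prod analyticAt_id)
  have hQT0 : ∀ t ∈ Ioo (-b) b, Q (t, 0) = 4 := fun t ht => by
    simp only [Q]
    rw [hx0, hF.fund_eq_shear ht, map_add, map_smul, traceL_shear, traceL_id]
    simp
  have hh0 : h 0 = 1 := by
    simp only [h]
    rw [hG.T_zero, hQT0 _ hbT]
    norm_num
  have hh1 : HasDerivAt h (Ccoef p q nl ng e / 2) 0 := by
    have hQd := (hQa _ hbT 0 hz0).differentiableAt.hasFDerivAt
    have h1 : HasDerivAt (fun μ => Q (T μ, μ))
        (fderiv ℝ Q (2 * Real.pi * p, 0) (deriv T 0, 1)) 0 :=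
      HasFDerivAt.comp_hasDerivAt_of_eq (f := fun μ => (T μ, μ)) (0 : ℝ) hQd
        ((hG.T_analytic 0 hz0).differentiableAt.hasDerivAt.prodMk (hasDerivAt_id' 0))
        (by rw [hG.T_zero])
    have h2 : fderiv ℝ Q (2 * Real.pi * p, 0) (0, 1) = Ccoef p q nl ng e := by
      have h3 : HasDerivAt (fun μ => Q (2 * Real.pi * p, μ))
          (fderiv ℝ Q (2 * Real.pi * p, 0) (0, 1)) 0 :=
        HasFDerivAt.comp_hasDerivAt (l := Q) (f := fun μ : ℝ => (2 * Real.pi * p, μ)) (0 : ℝ) hQd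
          ((hasDerivAt_const (0 : ℝ) (2 * Real.pi * p)).prodMk (hasDerivAt_id' 0))
      exact h3.unique (hG.fderiv_trace hF hp hq he hnc hb)
    have h4 : fderiv ℝ Q (2 * Real.pi * p, 0) (1, 0) = 0 := by
      have h3 : HasDerivAt (fun t => Q (t, 0))
          (fderiv ℝ Q (2 * Real.pi * p, 0) (1, 0)) (2 * Real.pi * p) :=
        HasFDerivAt.comp_hasDerivAt (l := Q) (f := fun t : ℝ => (t, (0 : ℝ))) (2 * Real.pi * p) hQd
          ((hasDerivAt_id' (2 * Real.pi * p)).prodMk (hasDerivAt_const (2 * Real.pi * p) (0 : ℝ)))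
      have h5 : (fun t => Q (t, 0)) =ᶠ[𝓝 (2 * Real.pi * p)] fun _ => 4 := by
        filter_upwards [isOpen_Ioo.mem_nhds hbT] with t ht
        exact hQT0 t ht
      exact h3.unique ((hasDerivAt_const _ _).congr_of_eventuallyEq h5)
    have h6 : fderiv ℝ Q (2 * Real.pi * p, 0) (deriv T 0, 1) = Ccoef p q nl ng e := by
      rw [show ((deriv T 0, 1) : ℝ × ℝ) = deriv T 0 • (1, 0) + (0, 1) by simp, map_add, map_smul,
        h4, h2]
      simp
    rw [h6] at h1
    exact (h1.sub_const 2).div_const 2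
  have hha : AnalyticAt ℝ h 0 := (hTQ.sub analyticAt_const).div_const
  refine ⟨fun μ => ((h μ : ℝ) : ℂ) + ((h μ ^ 2 - 1 : ℝ) : ℂ) ^ (1 / 2 : ℂ),
    fun μ => ((h μ : ℝ) : ℂ) - ((h μ ^ 2 - 1 : ℝ) : ℂ) ^ (1 / 2 : ℂ), ?_,
    (isBigO_quadratic_roots hha hh0 hh1).1, (isBigO_quadratic_roots hha hh0 hh1).2⟩
  have hx0d : unperturbed p q e nl ng 0 ∈ domain 0 := unperturbed_mem_domain hp hq he hnc 0
  have hXne : ∀ᶠ μ in 𝓝 (0 : ℝ), vectorField μ (x μ) ≠ 0 := by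
    have hc : ContinuousAt (fun μ => jointField (μ, x μ)) 0 := by
      refine ContinuousAt.comp (f := fun μ => (μ, x μ)) (analyticAt_jointField ?_).continuousAt
        (hG.analyticAt_param he hz0).continuousAt
      rw [hx0, ← unperturbed_zero]
      exact hx0d
    refine hc.eventually_ne ?_
    rw [hx0, ← unperturbed_zero]
    change vectorField 0 _ ≠ 0
    rw [vectorField_zero (retrograde_of_mem_domain hx0d)]
    intro h
    simpa using congrFun h 3
  filter_upwards [hXne, isOpen_Ioo.mem_nhds hz0] with μ hX hμ
  have hTm := hG.T_mem μ hμ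
  have hTb : T μ ∈ Ioo (-b) b := ⟨by linarith [hTm.1, hTm.2], hTm.2⟩
  have hsol := hG.solution μ hμ
  have hinit : γ μ 0 = x μ := hG.init hF (by linarith) hμ
  have hW : IsFundamental μ (γ μ) b (fun t => Y (t, (μ, x μ))) := by
    refine ⟨hF.fund_zero _ (hG.mem_ball μ hμ), fun t ht => ?_⟩
    rw [hG.eq_flow μ hμ t ht]
    exact hF.fund_deriv _ (hG.mem_ball μ hμ) t ht
  refine ⟨_, hW.isMonodromy hsol hTm (hG.periodic μ hμ), ?_⟩
  refine eigenvalueMultiset_of_symplectic isUnit_symplecticJ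
    (hW.symplectic (hsol.solvesOn (-b) b) hTb) (hW.det_eq_one (hsol.solvesOn (-b) b) hTb) hX ?_ ?_ ?_
  · rw [LinearMap.toMatrix'_mulVec]
    have h1 := hW.apply_vectorField (hsol.solvesOn (-b) b) hTb
    have h2 := hG.periodic μ hμ 0
    rw [zero_add] at h2
    rw [h2, vectorField_add_angleShift (retrograde_of_mem_domain (hsol 0).1), hinit] at h1
    exact h1
  · rw [← traceL_eq_matrix]
    simp only [h, Q]
    push_cast
    ring
  · have h1 : (((h μ ^ 2 - 1 : ℝ) : ℂ) ^ (1 / 2 : ℂ)) ^ 2 = ((h μ ^ 2 - 1 : ℝ) : ℂ) := by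
      rw [one_div, ← Nat.cast_ofNat (R := ℂ) (n := 2), Complex.cpow_nat_inv_pow _ two_ne_zero]
    push_cast at h1 ⊢
    linear_combination -h1

end IsFlowFamily

end Multipliers

/-! ### Sums over regular polygons -/

section Quadrature

/-- The trigonometric polynomials of degree at most `n`. -/
def trigPoly (n : ℕ) : Submodule ℂ (ℝ → ℂ) :=
  Submodule.span ℂ ((fun k : ℤ => fun ψ : ℝ => Complex.exp (k * ψ * Complex.I)) '' {k | |k| ≤ n})

lemma exp_mem_trigPoly {n : ℕ} {k : ℤ} (hk : |k| ≤ n) :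
    (fun ψ : ℝ => Complex.exp (k * ψ * Complex.I)) ∈ trigPoly n :=
  Submodule.subset_span ⟨k, hk, rfl⟩

lemma trigPoly_mono {m n : ℕ} (h : m ≤ n) : trigPoly m ≤ trigPoly n :=
  Submodule.span_mono (image_mono fun k (hk : |k| ≤ m) => hk.trans (by exact_mod_cast h))

lemma exp_mul_mem_trigPoly {n : ℕ} {f : ℝ → ℂ} (hf : f ∈ trigPoly n) {k : ℤ} (hk : |k| ≤ 1) :
    (fun ψ : ℝ => Complex.exp (k * ψ * Complex.I) * f ψ) ∈ trigPoly (n + 1) := by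
  induction hf using Submodule.span_induction with
  | mem g hg =>
    obtain ⟨j, hj, rfl⟩ := hg
    have h : (fun ψ : ℝ => Complex.exp (k * ψ * Complex.I) * Complex.exp (j * ψ * Complex.I)) =
        fun ψ : ℝ => Complex.exp ((k + j : ℤ) * ψ * Complex.I) := by
      funext ψ
      rw [← Complex.exp_add]
      push_cast
      ring_nf
    simp only [h]
    refine exp_mem_trigPoly ((abs_add_le k j).trans ?_)
    have hj' : |j| ≤ n := hj
    push_cast
    linarith
  | zero =>
    simp only [Pi.zero_apply, mul_zero]
    exact (trigPoly (n + 1)).zero_mem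
  | add f g _ _ hf hg =>
    have := (trigPoly (n + 1)).add_mem hf hg
    convert this using 1
    funext ψ
    simp only [Pi.add_apply, mul_add]
  | smul c f _ hf =>
    have := (trigPoly (n + 1)).smul_mem c hf
    convert this using 1
    funext ψ
    simp only [Pi.smul_apply, smul_eq_mul]
    ring

lemma cos_mul_mem_trigPoly {n : ℕ} {f : ℝ → ℂ} (hf : f ∈ trigPoly n) :
    (fun ψ : ℝ => (Real.cos ψ : ℂ) * f ψ) ∈ trigPoly (n + 1) := by
  have h1 := exp_mul_mem_trigPoly hf (k := 1) (by simp)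
  have h2 := exp_mul_mem_trigPoly hf (k := -1) (by simp)
  convert (trigPoly (n + 1)).smul_mem (1 / 2 : ℂ) ((trigPoly (n + 1)).add_mem h1 h2) using 1
  funext ψ
  simp only [Pi.smul_apply, Pi.add_apply, smul_eq_mul, Complex.ofReal_cos, Complex.cos]
  push_cast
  ring_nf

lemma sin_mul_mem_trigPoly {n : ℕ} {f : ℝ → ℂ} (hf : f ∈ trigPoly n) :
    (fun ψ : ℝ => (Real.sin ψ : ℂ) * f ψ) ∈ trigPoly (n + 1) := by
  have h1 := exp_mul_mem_trigPoly hf (k := 1) (by simp)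
  have h2 := exp_mul_mem_trigPoly hf (k := -1) (by simp)
  convert (trigPoly (n + 1)).smul_mem (Complex.I / 2 : ℂ) ((trigPoly (n + 1)).sub_mem h2 h1) using 1
  funext ψ
  simp only [Pi.smul_apply, Pi.sub_apply, smul_eq_mul, Complex.ofReal_sin, Complex.sin]
  push_cast
  ring_nf

/-- A real form of degree `n` on the plane is a trigonometric polynomial of degree at most `n` on
every circle about the origin. -/
lemma multilinear_mem_trigPoly (n : ℕ) :
    ∀ (P : ContinuousMultilinearMap ℝ (fun _ : Fin n => ℂ) ℝ) (x : Fin n → ℂ),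
      (fun ψ : ℝ => ((P fun i => x i * Complex.exp (ψ * Complex.I) : ℝ) : ℂ)) ∈ trigPoly n := by
  induction n with
  | zero =>
    intro P x
    have h : (fun ψ : ℝ => ((P fun i => x i * Complex.exp (ψ * Complex.I) : ℝ) : ℂ)) =
        ((P x : ℝ) : ℂ) • fun ψ : ℝ => Complex.exp ((0 : ℤ) * ψ * Complex.I) := by
      funext ψ
      rw [show (fun i => x i * Complex.exp (ψ * Complex.I)) = x from Subsingleton.elim _ _]
      simp
    rw [h]
    exact (trigPoly 0).smul_mem _ (exp_mem_trigPoly (by simp))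
  | succ n ih =>
    intro P x
    have h : (fun ψ : ℝ => ((P fun i => x i * Complex.exp (ψ * Complex.I) : ℝ) : ℂ)) =
        (fun ψ : ℝ => (Real.cos ψ : ℂ) * ((P.curryLeft (x 0) fun i =>
          x i.succ * Complex.exp (ψ * Complex.I) : ℝ) : ℂ)) +
        (fun ψ : ℝ => (Real.sin ψ : ℂ) * ((P.curryLeft (Complex.I * x 0) fun i =>
          x i.succ * Complex.exp (ψ * Complex.I) : ℝ) : ℂ)) := by
      funext ψ
      have h0 : x 0 * Complex.exp (ψ * Complex.I) =
          Real.cos ψ • x 0 + Real.sin ψ • (Complex.I * x 0) := by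
        rw [Complex.exp_mul_I, Complex.real_smul, Complex.real_smul, Complex.ofReal_cos,
          Complex.ofReal_sin]
        ring
      have h1 : (fun i => x i * Complex.exp (ψ * Complex.I)) =
          Fin.cons (x 0 * Complex.exp (ψ * Complex.I))
            (fun i : Fin n => x i.succ * Complex.exp (ψ * Complex.I)) := by
        funext i
        refine Fin.cases ?_ (fun j => ?_) i <;> simp
      simp only [Pi.add_apply]
      rw [h1, ← ContinuousMultilinearMap.curryLeft_apply, h0, map_add, map_smul, map_smul]
      simp
    rw [h]
    exact (trigPoly (n + 1)).add_mem (cos_mul_mem_trigPoly (ih _ _))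
      (sin_mul_mem_trigPoly (ih _ _))

/-- The trapezoidal rule with `M` nodes is exact for trigonometric polynomials of degree `< M`. -/
lemma trapezoidal_exact {n M : ℕ} (hnM : n < M) {f : ℝ → ℂ} (hf : f ∈ trigPoly n) :
    Continuous f ∧ 2 * Real.pi * ∑ m ∈ Finset.range M, f (2 * Real.pi * m / M) =
      M * ∫ ψ in (0 : ℝ)..(2 * Real.pi), f ψ := by
  have hM : M ≠ 0 := by omega
  have hM' : (M : ℂ) ≠ 0 := by exact_mod_cast hM
  induction hf using Submodule.span_induction with
  | mem g hg =>
    obtain ⟨k, hk, rfl⟩ := hg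
    have hk' : |k| < M := lt_of_le_of_lt hk (by exact_mod_cast hnM)
    refine ⟨by fun_prop, ?_⟩
    by_cases hk0 : k = 0
    · subst hk0
      simp
      ring
    · have hI : ∫ ψ in (0 : ℝ)..(2 * Real.pi), Complex.exp (k * ψ * Complex.I) = 0 := by
        have hc : (k : ℂ) * Complex.I ≠ 0 := mul_ne_zero (by exact_mod_cast hk0) Complex.I_ne_zero
        have h1 : ∀ ψ : ℝ, Complex.exp (k * ψ * Complex.I) =
            Complex.exp ((k * Complex.I) * ψ) := fun ψ => by ring_nf
        simp only [h1]
        rw [integral_exp_mul_complex hc]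
        have h2 : (k : ℂ) * Complex.I * ((2 * Real.pi : ℝ) : ℂ) = k * (2 * Real.pi * Complex.I) := by
          push_cast; ring
        rw [h2, Complex.exp_int_mul_two_pi_mul_I]
        simp
      have hS : ∑ m ∈ Finset.range M,
          Complex.exp (k * ((2 * Real.pi * m / M : ℝ) : ℂ) * Complex.I) = 0 := by
        set ζ := Complex.exp (2 * Real.pi * Complex.I / M) with hζ
        have hprim : IsPrimitiveRoot ζ M := Complex.isPrimitiveRoot_exp M hM
        have h1 : ∀ m : ℕ, Complex.exp (k * ((2 * Real.pi * m / M : ℝ) : ℂ) * Complex.I) =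
            (ζ ^ k) ^ m := fun m => by
          rw [hζ, ← Complex.exp_int_mul, ← Complex.exp_nat_mul]
          push_cast
          congr 1
          field_simp
        simp only [h1]
        have hne : ζ ^ k ≠ 1 := fun h => by
          have h2 := (hprim.zpow_eq_one_iff_dvd k).1 h
          exact hk0 (Int.eq_zero_of_abs_lt_dvd h2 hk')
        have h3 : (ζ ^ k) ^ M = 1 := by
          rw [← zpow_natCast, ← zpow_mul, mul_comm, zpow_mul, zpow_natCast, hprim.pow_eq_one,
            one_zpow]
        rw [geom_sum_eq hne, h3, sub_self, zero_div]
      simp only [hI, hS]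
      simp
  | zero => exact ⟨continuous_zero, by simp⟩
  | add f g _ _ hf hg =>
    refine ⟨hf.1.add hg.1, ?_⟩
    simp only [Pi.add_apply, Finset.sum_add_distrib, mul_add]
    rw [hf.2, hg.2, intervalIntegral.integral_add (hf.1.intervalIntegrable _ _)
      (hg.1.intervalIntegrable _ _), mul_add]
  | smul c f _ hf =>
    refine ⟨hf.1.const_smul c, ?_⟩
    simp only [Pi.smul_apply, smul_eq_mul, ← Finset.mul_sum]
    rw [intervalIntegral.integral_const_mul]
    linear_combination c * hf.2

/-- If `f` is real analytic at `0` in the plane and has mean zero over the circles about `0`, then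
the sum of its values over the vertices of a regular `M`-gon about `0` is of order `M` in the
radius. -/
lemma isBigO_sum_polygon {f : ℂ → ℝ} (hf : AnalyticAt ℝ f 0)
    (hmean : ∀ᶠ v in 𝓝 (0 : ℂ), ∫ ψ in (0 : ℝ)..(2 * Real.pi),
      f (v * Complex.exp (ψ * Complex.I)) = 0) {M : ℕ} (hM : M ≠ 0) :
    (fun v => ∑ m ∈ Finset.range M,
      f (v * Complex.exp ((2 * Real.pi * m / M : ℝ) * Complex.I))) =O[𝓝 0]
      fun v => ‖v‖ ^ M := by
  obtain ⟨P, hP⟩ := hf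
  obtain ⟨c, hc⟩ := (hP.isBigO_sub_partialSum_pow M).bound
  let S : ℂ → ℝ := fun v => P.partialSum M v
  have hcont : ∀ᶠ v in 𝓝 (0 : ℂ), ContinuousAt f v :=
    hP.analyticAt.eventually_analyticAt.mono fun v hv => hv.continuousAt
  obtain ⟨ρ, hρ, hball⟩ := Metric.eventually_nhds_iff.1 (hc.and (hcont.and hmean))
  have hS : ∀ v : ℂ, 2 * Real.pi * ∑ m ∈ Finset.range M,
      S (v * Complex.exp ((2 * Real.pi * m / M : ℝ) * Complex.I)) =
        M * ∫ ψ in (0 : ℝ)..(2 * Real.pi), S (v * Complex.exp (ψ * Complex.I)) := by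
    intro v
    have hmem : (fun ψ : ℝ => ((S (v * Complex.exp (ψ * Complex.I)) : ℝ) : ℂ)) ∈
        trigPoly (M - 1) := by
      have : (fun ψ : ℝ => ((S (v * Complex.exp (ψ * Complex.I)) : ℝ) : ℂ)) =
          ∑ n ∈ Finset.range M, fun ψ : ℝ =>
            ((P n fun _ => v * Complex.exp (ψ * Complex.I) : ℝ) : ℂ) := by
        funext ψ
        simp [S, FormalMultilinearSeries.partialSum]
      rw [this]
      refine Submodule.sum_mem _ fun n hn => ?_
      exact trigPoly_mono (by have := Finset.mem_range.1 hn; omega)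
        (multilinear_mem_trigPoly n (P n) fun _ => v)
    have h := (trapezoidal_exact (n := M - 1) (M := M) (by omega) hmem).2
    rw [intervalIntegral.integral_ofReal] at h
    exact_mod_cast h
  have hSc : ∀ v : ℂ, Continuous fun ψ : ℝ => S (v * Complex.exp (ψ * Complex.I)) := by
    intro v
    have : Continuous S := by
      simp only [S, FormalMultilinearSeries.partialSum]
      exact continuous_finsetSum _ fun n _ => (P n).cont.comp (by fun_prop)
    exact this.comp (by fun_prop)
  refine IsBigO.of_bound (2 * M * c) ?_
  filter_upwards [Metric.ball_mem_nhds (0 : ℂ) hρ] with v hv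
  rw [mem_ball_zero_iff] at hv
  have hrot : ∀ ψ : ℝ, ‖v * Complex.exp (ψ * Complex.I)‖ = ‖v‖ := fun ψ => by
    rw [norm_mul, Complex.norm_exp_ofReal_mul_I, mul_one]
  have hR : ∀ ψ : ℝ, |f (v * Complex.exp (ψ * Complex.I)) - S (v * Complex.exp (ψ * Complex.I))| ≤
      c * ‖v‖ ^ M := fun ψ => by
    have h := (hball (y := v * Complex.exp (ψ * Complex.I))
      (by rw [dist_zero_right, hrot]; exact hv)).1
    simpa [S, hrot ψ] using h
  have hfc : Continuous fun ψ : ℝ => f (v * Complex.exp (ψ * Complex.I)) :=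
    continuous_iff_continuousAt.2 fun ψ => ContinuousAt.comp
      (f := fun ψ : ℝ => v * Complex.exp (ψ * Complex.I))
      (hball (y := v * Complex.exp (ψ * Complex.I))
        (by rw [dist_zero_right, hrot]; exact hv)).2.1 (by fun_prop)
  have hint : |∫ ψ in (0 : ℝ)..(2 * Real.pi), S (v * Complex.exp (ψ * Complex.I))| ≤
      c * ‖v‖ ^ M * (2 * Real.pi) := by
    have h1 := intervalIntegral.norm_integral_le_of_norm_le_const (a := 0) (b := 2 * Real.pi)
      (f := fun ψ : ℝ => f (v * Complex.exp (ψ * Complex.I)) - S (v * Complex.exp (ψ * Complex.I)))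
      (C := c * ‖v‖ ^ M) fun ψ _ => hR ψ
    rw [intervalIntegral.integral_sub (hfc.intervalIntegrable _ _)
      ((hSc v).intervalIntegrable _ _),
      (hball (y := v) (by rw [dist_zero_right]; exact hv)).2.2, zero_sub, norm_neg, sub_zero,
      abs_of_pos Real.two_pi_pos] at h1
    exact h1
  have hM0 : (0 : ℝ) ≤ M := Nat.cast_nonneg M
  have hSsum : |∑ m ∈ Finset.range M,
      S (v * Complex.exp ((2 * Real.pi * m / M : ℝ) * Complex.I))| ≤ M * (c * ‖v‖ ^ M) := by
    have h1 := congrArg abs (hS v)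
    rw [abs_mul (2 * Real.pi), abs_of_pos Real.two_pi_pos, abs_mul (M : ℝ), abs_of_nonneg hM0] at h1
    have h2 := mul_le_mul_of_nonneg_left hint hM0
    rw [← h1] at h2
    refine le_of_mul_le_mul_left (h2.trans_eq ?_) Real.two_pi_pos
    ring
  have hRsum : |∑ m ∈ Finset.range M,
      (f (v * Complex.exp ((2 * Real.pi * m / M : ℝ) * Complex.I)) -
      S (v * Complex.exp ((2 * Real.pi * m / M : ℝ) * Complex.I)))| ≤ M * (c * ‖v‖ ^ M) := by
    refine (Finset.abs_sum_le_sum_abs _ _).trans ?_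
    refine (Finset.sum_le_card_nsmul _ _ _ fun m _ => hR _).trans_eq ?_
    simp
  rw [Finset.sum_sub_distrib] at hRsum
  rw [Real.norm_eq_abs, Real.norm_eq_abs, abs_of_nonneg (by positivity : 0 ≤ ‖v‖ ^ M)]
  have h3 := abs_add_le (∑ m ∈ Finset.range M,
      f (v * Complex.exp ((2 * Real.pi * m / M : ℝ) * Complex.I)) - ∑ m ∈ Finset.range M,
      S (v * Complex.exp ((2 * Real.pi * m / M : ℝ) * Complex.I)))
      (∑ m ∈ Finset.range M, S (v * Complex.exp ((2 * Real.pi * m / M : ℝ) * Complex.I)))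
  rw [sub_add_cancel] at h3
  refine h3.trans ((add_le_add hRsum hSsum).trans_eq ?_)
  ring

lemma iteratedDeriv_eq_zero_of_isBigO {f : ℝ → ℝ} (hf : AnalyticAt ℝ f 0) {M : ℕ}
    (h : f =O[𝓝 0] fun x : ℝ => x ^ M) : ∀ n < M, iteratedDeriv n f 0 = 0 := by
  refine (natCast_le_analyticOrderAt_iff_iteratedDeriv_eq_zero hf).1 ?_
  by_contra hlt
  rw [not_le] at hlt
  obtain ⟨k, hk⟩ := ENat.ne_top_iff_exists.1 (ne_top_of_lt hlt)
  rw [← hk] at hlt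
  have hkM : k < M := by exact_mod_cast hlt
  obtain ⟨g, hg, hg0, hfg⟩ := (hf.analyticOrderAt_eq_natCast).1 hk.symm
  obtain ⟨c, hc⟩ := h.bound
  -- dividing by `x ^ k`, `g` would tend to `0`
  have hlim : Tendsto (fun x : ℝ => c * |x| ^ (M - k)) (𝓝[≠] 0) (𝓝 0) := by
    have : Tendsto (fun x : ℝ => c * |x| ^ (M - k)) (𝓝 0) (𝓝 0) :=
      Continuous.tendsto' (by fun_prop) _ _ (by simp [Nat.sub_ne_zero_of_lt hkM])
    exact this.mono_left nhdsWithin_le_nhds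
  have hle : ∀ᶠ x in 𝓝[≠] (0 : ℝ), |g x| ≤ c * |x| ^ (M - k) := by
    filter_upwards [nhdsWithin_le_nhds hc, nhdsWithin_le_nhds hfg, self_mem_nhdsWithin]
      with x h1 h2 h3
    have hx : 0 < |x| ^ k := pow_pos (abs_pos.2 h3) k
    rw [h2, sub_zero, smul_eq_mul, Real.norm_eq_abs, Real.norm_eq_abs, abs_mul, abs_pow, abs_pow,
      ← Nat.sub_add_cancel hkM.le, pow_add] at h1
    refine le_of_mul_le_mul_left (h1.trans_eq ?_) hx
    ring
  have hg' : Tendsto (fun x => |g x|) (𝓝[≠] 0) (𝓝 |g 0|) :=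
    (hg.continuousAt.abs.tendsto).mono_left nhdsWithin_le_nhds
  exact hg0 (abs_nonpos_iff.1 (le_of_tendsto_of_tendsto hg' hlim hle))

end Quadrature

/-! ### The integrand of the coefficient near the circular orbit -/

section SecularIntegral

/-- The factor `exp (i (ν - E - σ e sin E))` as a function of `w = e exp (i E)`, where `ν` is the
true anomaly. In this form it is real analytic at `w = 0`. -/
def anomalyFactor (σ : ℝ) (w : ℂ) : ℂ :=
  (((1 + √(1 - (w.re ^ 2 + w.im ^ 2)) : ℝ) : ℂ) / 2 +
      (starRingEnd ℂ) w ^ 2 / (2 * ((1 + √(1 - (w.re ^ 2 + w.im ^ 2)) : ℝ) : ℂ)) -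
      (starRingEnd ℂ) w) / ((1 - w.re : ℝ) : ℂ) * Complex.exp (((-(σ * w.im) : ℝ) : ℂ) * Complex.I)

lemma one_sub_re_pos {w : ℂ} (hw : w.re ^ 2 + w.im ^ 2 < 1) : 0 < 1 - w.re := by
  nlinarith [sq_nonneg w.im, sq_nonneg (w.re - 1)]

/-- With `u = exp (-i E)` and `s = √(1 - e²)`, the identity rests on
`2 (cos E + i s sin E) u = (1 + s) + (1 - s) u²` and `e² = (1 - s) (1 + s)`. -/
lemma anomalyFactor_polar (σ : ℝ) {e : ℝ} (he : |e| < 1) (E : ℝ) :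
    anomalyFactor σ (e * Complex.exp (E * Complex.I)) =
      Complex.exp ((trueAnomaly e E - E - σ * (e * Real.sin E) : ℝ) * Complex.I) := by
  have hre : ((e : ℂ) * Complex.exp (E * Complex.I)).re = e * Real.cos E := by
    rw [Complex.re_ofReal_mul, Complex.exp_ofReal_mul_I_re]
  have him : ((e : ℂ) * Complex.exp (E * Complex.I)).im = e * Real.sin E := by
    rw [Complex.im_ofReal_mul, Complex.exp_ofReal_mul_I_im]
  have hsq : (e * Real.cos E) ^ 2 + (e * Real.sin E) ^ 2 = e ^ 2 := by
    linear_combination e ^ 2 * Real.sin_sq_add_cos_sq E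
  have hcs : (Real.cos E : ℂ) ^ 2 + (Real.sin E : ℂ) ^ 2 = 1 := by
    exact_mod_cast Real.cos_sq_add_sin_sq E
  have hpos := one_sub_mul_cos_pos he E
  have hpos' : ((1 - e * Real.cos E : ℝ) : ℂ) ≠ 0 := by exact_mod_cast hpos.ne'
  have hs0 : 0 ≤ 1 - e ^ 2 := by
    have := (sq_lt_one_iff_abs_lt_one e).2 he
    linarith
  have h1s : ((1 + √(1 - e ^ 2) : ℝ) : ℂ) ≠ 0 := by
    have : 0 < 1 + √(1 - e ^ 2) := by positivity
    exact_mod_cast this.ne'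
  have hs2 : ((√(1 - e ^ 2) : ℝ) : ℂ) ^ 2 = 1 - (e : ℂ) ^ 2 := by
    exact_mod_cast Real.sq_sqrt hs0
  have hconj : (starRingEnd ℂ) ((e : ℂ) * Complex.exp (E * Complex.I)) =
      e * (Real.cos E - Real.sin E * Complex.I) := by
    rw [Complex.exp_mul_I, ← Complex.ofReal_cos, ← Complex.ofReal_sin, map_mul, map_add, map_mul,
      Complex.conj_ofReal, Complex.conj_ofReal, Complex.conj_ofReal, Complex.conj_I]
    ring
  have hν : Complex.exp ((trueAnomaly e E : ℝ) * Complex.I) =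
      ((Real.cos E - e) + √(1 - e ^ 2) * Real.sin E * Complex.I) /
        ((1 - e * Real.cos E : ℝ) : ℂ) := by
    rw [Complex.exp_mul_I, ← Complex.ofReal_cos, ← Complex.ofReal_sin, cos_trueAnomaly he,
      sin_trueAnomaly he]
    push_cast
    ring
  have hE : Complex.exp (((-E : ℝ) : ℂ) * Complex.I) =
      Real.cos E - Real.sin E * Complex.I := by
    rw [Complex.exp_mul_I, ← Complex.ofReal_cos, ← Complex.ofReal_sin, Real.cos_neg, Real.sin_neg]
    push_cast
    ring
  have hsplit : Complex.exp ((trueAnomaly e E - E - σ * (e * Real.sin E) : ℝ) * Complex.I) =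
      Complex.exp ((trueAnomaly e E : ℝ) * Complex.I) * Complex.exp (((-E : ℝ) : ℂ) * Complex.I) *
        Complex.exp (((-(σ * (e * Real.sin E)) : ℝ) : ℂ) * Complex.I) := by
    rw [← Complex.exp_add, ← Complex.exp_add]
    push_cast
    ring_nf
  rw [hsplit, anomalyFactor, hconj, hre, him, hsq, hν, hE]
  congr 1
  rw [div_mul_eq_mul_div]
  congr 1
  set c : ℂ := (Real.cos E : ℂ)
  set d : ℂ := (Real.sin E : ℂ)
  have hes : (e : ℂ) ^ 2 = (1 - (√(1 - e ^ 2) : ℝ)) * ((1 + √(1 - e ^ 2) : ℝ) : ℂ) := by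
    push_cast
    linear_combination hs2
  rw [mul_pow, hes]
  have : (1 - ((√(1 - e ^ 2) : ℝ) : ℂ)) * ((1 + √(1 - e ^ 2) : ℝ) : ℂ) *
      (c - d * Complex.I) ^ 2 / (2 * ((1 + √(1 - e ^ 2) : ℝ) : ℂ)) =
      (1 - ((√(1 - e ^ 2) : ℝ) : ℂ)) * (c - d * Complex.I) ^ 2 / 2 := by
    field_simp
  rw [this]
  push_cast
  have hI := Complex.I_sq
  set s : ℂ := ((√(1 - e ^ 2) : ℝ) : ℂ)
  linear_combination (-(1 + s) / 2) * hcs + ((1 - s) / 2 * d ^ 2 + s * d ^ 2) * hI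

lemma exists_anomalyFactor_eq (σ : ℝ) {w : ℂ} (hw : w.re ^ 2 + w.im ^ 2 < 1) :
    ∃ β : ℝ, anomalyFactor σ w = Complex.exp (β * Complex.I) := by
  have h1 : |‖w‖| < 1 := by
    rw [abs_norm]
    have : ‖w‖ ^ 2 = w.re ^ 2 + w.im ^ 2 := by
      rw [Complex.sq_norm, Complex.normSq_apply]; ring
    nlinarith [norm_nonneg w]
  have := anomalyFactor_polar σ h1 (Complex.arg w)
  rw [Complex.norm_mul_exp_arg_mul_I] at this
  exact ⟨_, this⟩

lemma analyticAt_anomalyFactor (σ : ℝ) {w : ℂ} (hw : w.re ^ 2 + w.im ^ 2 < 1) :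
    AnalyticAt ℝ (anomalyFactor σ) w := by
  have hre : AnalyticAt ℝ (fun w : ℂ => w.re) w := Complex.reCLM.analyticAt w
  have him : AnalyticAt ℝ (fun w : ℂ => w.im) w := Complex.imCLM.analyticAt w
  have hof : ∀ {f : ℂ → ℝ}, AnalyticAt ℝ f w → AnalyticAt ℝ (fun w => (f w : ℂ)) w :=
    fun {f} hf => (Complex.ofRealCLM.analyticAt (f w)).fun_comp hf
  have hconj : AnalyticAt ℝ (fun w : ℂ => (starRingEnd ℂ) w) w :=
    Complex.conjCLE.toContinuousLinearMap.analyticAt w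
  have hs : AnalyticAt ℝ (fun w : ℂ => 1 + √(1 - (w.re ^ 2 + w.im ^ 2))) w :=
    analyticAt_const.fun_add (analyticAt_sqrt_comp
      (analyticAt_const.fun_sub ((hre.fun_pow 2).fun_add (him.fun_pow 2))) (by linarith))
  have hs0 : ((1 + √(1 - (w.re ^ 2 + w.im ^ 2)) : ℝ) : ℂ) ≠ 0 := by
    have : 0 < 1 + √(1 - (w.re ^ 2 + w.im ^ 2)) := by positivity
    exact_mod_cast this.ne'
  have hexp : AnalyticAt ℝ (fun w : ℂ => Complex.exp (((-(σ * w.im) : ℝ) : ℂ) * Complex.I)) w :=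
    AnalyticAt.fun_comp (g := Complex.exp) (analyticAt_cexp.restrictScalars)
      ((hof (analyticAt_const.fun_mul him).fun_neg).fun_mul analyticAt_const)
  have h1 : ((1 - w.re : ℝ) : ℂ) ≠ 0 := by exact_mod_cast (one_sub_re_pos hw).ne'
  exact (((((hof hs).fun_div analyticAt_const two_ne_zero).fun_add
    ((hconj.fun_pow 2).fun_div (analyticAt_const.fun_mul (hof hs))
      (mul_ne_zero two_ne_zero hs0))).fun_sub hconj).fun_div
      (hof (analyticAt_const.fun_sub hre)) h1).fun_mul hexp

/-- The function `(r / Δ₁)_θθ + cos θ / r` in terms of `r` and `X = exp (i θ)`. -/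
def tidalKernel (r : ℝ) (X : ℂ) : ℝ :=
  -(r ^ 2 * X.re) / √(1 + r ^ 2 - 2 * r * X.re) ^ 3 +
    3 * r ^ 3 * X.im ^ 2 / √(1 + r ^ 2 - 2 * r * X.re) ^ 5 + X.re / r

lemma distSq_pos {r : ℝ} (hr : 0 < r) (hr1 : r ≠ 1) (θ : ℝ) :
    0 < 1 + r ^ 2 - 2 * r * Real.cos θ := by
  have h1 : 0 < (1 - r) ^ 2 := by
    have : 1 - r ≠ 0 := sub_ne_zero.2 (Ne.symm hr1)
    positivity
  nlinarith [mul_nonneg hr.le (sub_nonneg.2 (Real.cos_le_one θ))]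

lemma hasDerivAt_distSq (r θ : ℝ) : HasDerivAt (fun θ => 1 + r ^ 2 - 2 * r * Real.cos θ)
    (2 * r * Real.sin θ) θ :=
  (((Real.hasDerivAt_cos θ).const_mul (2 * r)).const_sub (1 + r ^ 2)).congr_deriv (by ring)

lemma hasDerivAt_rOverDelta1 {r : ℝ} (hr : 0 < r) (hr1 : r ≠ 1) (θ : ℝ) :
    HasDerivAt (rOverDelta1 r)
      (-(r ^ 2 * Real.sin θ) / √(1 + r ^ 2 - 2 * r * Real.cos θ) ^ 3) θ := by
  have hD := distSq_pos hr hr1 θ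
  have hs := (hasDerivAt_distSq r θ).sqrt hD.ne'
  have hΔ := Real.sqrt_pos.2 hD
  refine ((hasDerivAt_const θ r).fun_div hs hΔ.ne').congr_deriv ?_
  field_simp
  ring

lemma hasDerivAt_deriv_rOverDelta1 {r : ℝ} (hr : 0 < r) (hr1 : r ≠ 1) (θ : ℝ) :
    HasDerivAt (fun θ => -(r ^ 2 * Real.sin θ) / √(1 + r ^ 2 - 2 * r * Real.cos θ) ^ 3)
      (-(r ^ 2 * Real.cos θ) / √(1 + r ^ 2 - 2 * r * Real.cos θ) ^ 3 +
        3 * r ^ 3 * Real.sin θ ^ 2 / √(1 + r ^ 2 - 2 * r * Real.cos θ) ^ 5) θ := by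
  have hD := distSq_pos hr hr1 θ
  have hs := (hasDerivAt_distSq r θ).sqrt hD.ne'
  have hΔ := Real.sqrt_pos.2 hD
  refine (((Real.hasDerivAt_sin θ).const_mul (r ^ 2)).fun_neg.fun_div (hs.fun_pow 3)
    (pow_ne_zero 3 hΔ.ne')).congr_deriv ?_
  set Δ := √(1 + r ^ 2 - 2 * r * Real.cos θ)
  clear_value Δ
  field_simp
  push_cast
  ring

lemma tidalKernel_exp {r : ℝ} (hr : 0 < r) (hr1 : r ≠ 1) (θ : ℝ) :
    tidalKernel r (Complex.exp (θ * Complex.I)) =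
      iteratedDeriv 2 (rOverDelta1 r) θ + Real.cos θ / r := by
  have h1 : deriv (rOverDelta1 r) =
      fun θ => -(r ^ 2 * Real.sin θ) / √(1 + r ^ 2 - 2 * r * Real.cos θ) ^ 3 :=
    funext fun θ => (hasDerivAt_rOverDelta1 hr hr1 θ).deriv
  rw [iteratedDeriv_succ, iteratedDeriv_one, h1, (hasDerivAt_deriv_rOverDelta1 hr hr1 θ).deriv,
    tidalKernel, Complex.exp_ofReal_mul_I_re, Complex.exp_ofReal_mul_I_im]

/-- The kernel is a derivative with respect to `θ`, so it has mean zero over the angle. -/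
lemma integral_tidalKernel {r : ℝ} (hr : 0 < r) (hr1 : r ≠ 1) {N : ℕ} (hN : N ≠ 0) (β : ℝ) :
    ∫ F in (0 : ℝ)..(2 * Real.pi),
      tidalKernel r (Complex.exp ((N * F + β : ℝ) * Complex.I)) = 0 := by
  have hN' : (N : ℝ) ≠ 0 := by exact_mod_cast hN
  set A : ℝ → ℝ := fun θ =>
    -(r ^ 2 * Real.sin θ) / √(1 + r ^ 2 - 2 * r * Real.cos θ) ^ 3 + Real.sin θ / r with hA
  have hAd : ∀ θ : ℝ, HasDerivAt A (tidalKernel r (Complex.exp (θ * Complex.I))) θ := fun θ => by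
    refine ((hasDerivAt_deriv_rOverDelta1 hr hr1 θ).fun_add
      ((Real.hasDerivAt_sin θ).div_const r)).congr_deriv ?_
    rw [tidalKernel, Complex.exp_ofReal_mul_I_re, Complex.exp_ofReal_mul_I_im]
  have hc : Continuous fun θ : ℝ => tidalKernel r (Complex.exp (θ * Complex.I)) := by
    simp only [tidalKernel, Complex.exp_ofReal_mul_I_re, Complex.exp_ofReal_mul_I_im]
    have h0 : ∀ θ, √(1 + r ^ 2 - 2 * r * Real.cos θ) ≠ 0 := fun θ =>
      (Real.sqrt_pos.2 (distSq_pos hr hr1 θ)).ne'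
    refine ((Continuous.div (by fun_prop) (by fun_prop) fun θ => pow_ne_zero 3 (h0 θ)).add
      (Continuous.div (by fun_prop) (by fun_prop) fun θ => pow_ne_zero 5 (h0 θ))).add
      (by fun_prop)
  have hd : ∀ F : ℝ, HasDerivAt (fun F : ℝ => A (N * F + β) / N)
      (tidalKernel r (Complex.exp ((N * F + β : ℝ) * Complex.I))) F := fun F => by
    refine (((hAd (N * F + β)).comp F
      (((hasDerivAt_id' F).const_mul (N : ℝ)).add_const β)).div_const (N : ℝ)).congr_deriv ?_
    field_simp
  rw [intervalIntegral.integral_eq_sub_of_hasDerivAt (fun F _ => hd F)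
    (Continuous.intervalIntegrable (hc.comp (by fun_prop)) _ _)]
  have h2 : (N : ℝ) * (2 * Real.pi) + β = β + N * (2 * Real.pi) := by ring
  simp only [hA, h2, Real.sin_add_nat_mul_two_pi, Real.cos_add_nat_mul_two_pi, mul_zero, zero_add,
    sub_self]

lemma analyticAt_tidalKernel {E : Type*} [NormedAddCommGroup E] [NormedSpace ℝ E] {r : E → ℝ}
    {X : E → ℂ} {x : E} (hr : AnalyticAt ℝ r x) (hX : AnalyticAt ℝ X x) (hr0 : r x ≠ 0)
    (hD : 0 < 1 + r x ^ 2 - 2 * r x * (X x).re) :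
    AnalyticAt ℝ (fun y => tidalKernel (r y) (X y)) x := by
  have hre : AnalyticAt ℝ (fun y => (X y).re) x := (Complex.reCLM.analyticAt (X x)).fun_comp hX
  have him : AnalyticAt ℝ (fun y => (X y).im) x := (Complex.imCLM.analyticAt (X x)).fun_comp hX
  have hs : AnalyticAt ℝ (fun y => √(1 + r y ^ 2 - 2 * r y * (X y).re)) x :=
    analyticAt_sqrt_comp ((analyticAt_const.fun_add (hr.fun_pow 2)).fun_sub
      ((analyticAt_const.fun_mul hr).fun_mul hre)) hD.ne'
  have hs0 := (Real.sqrt_pos.2 hD).ne'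
  exact ((((hr.fun_pow 2).fun_mul hre).fun_neg.fun_div (hs.fun_pow 3) (pow_ne_zero 3 hs0)).fun_add
    (((analyticAt_const.fun_mul (hr.fun_pow 3)).fun_mul (him.fun_pow 2)).fun_div (hs.fun_pow 5)
      (pow_ne_zero 5 hs0))).fun_add (hre.fun_div hr hr0)

end SecularIntegral

/-! ### Symmetry of the secular integral -/

section SecularSymmetry

/-- The integrand of `C` as a function of `w = e exp (i E)` and the angle `φ` for which
`θ = φ + ν - E - σ e sin E`; here `a` is the semi-major axis and `σ = p/q`. For fixed `w`, the
distance `r` is fixed and `θ - φ` is constant. -/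
def secularKernel (σ a : ℝ) (w : ℂ) (φ : ℝ) : ℝ :=
  tidalKernel (a * (1 - w.re)) (Complex.exp (φ * Complex.I) * anomalyFactor σ w)

/-- The values of `w = e exp (i E)` for which the orbit is elliptic and does not meet the unit
circle at `E`. -/
def offUnitCircle (a : ℝ) : Set ℂ := {w | w.re ^ 2 + w.im ^ 2 < 1 ∧ a * (1 - w.re) ≠ 1}

variable {σ a : ℝ}

lemma isOpen_offUnitCircle : IsOpen (offUnitCircle a) :=
  (isOpen_lt (f := fun w : ℂ => w.re ^ 2 + w.im ^ 2) (g := fun _ => 1) (by fun_prop)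
    continuous_const).inter
      ((isOpen_ne (x := (1 : ℝ))).preimage (f := fun w : ℂ => a * (1 - w.re)) (by fun_prop))

lemma eventually_circle_subset (ha1 : a ≠ 1) :
    ∀ᶠ v in 𝓝 (0 : ℂ), ∀ ψ : ℝ, v * Complex.exp (ψ * Complex.I) ∈ offUnitCircle a := by
  have h0 : (0 : ℂ) ∈ offUnitCircle a := by simpa [offUnitCircle] using ha1
  obtain ⟨ρ, hρ, hball⟩ := Metric.isOpen_iff.1 isOpen_offUnitCircle 0 h0
  filter_upwards [Metric.ball_mem_nhds (0 : ℂ) hρ] with v hv ψ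
  refine hball ?_
  rw [mem_ball_zero_iff] at hv ⊢
  rwa [norm_mul, Complex.norm_exp_ofReal_mul_I, mul_one]

lemma secularKernel_eq {w : ℂ} (hw : w ∈ offUnitCircle a) :
    ∃ β : ℝ, ∀ φ : ℝ, secularKernel σ a w φ =
      tidalKernel (a * (1 - w.re)) (Complex.exp ((φ + β : ℝ) * Complex.I)) := by
  obtain ⟨β, hβ⟩ := exists_anomalyFactor_eq σ hw.1
  refine ⟨β, fun φ => ?_⟩
  rw [secularKernel, hβ, ← Complex.exp_add]
  push_cast
  ring_nf

lemma analyticAt_secularKernel (ha : 0 < a) {E : Type*} [NormedAddCommGroup E] [NormedSpace ℝ E]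
    {w : E → ℂ} {φ : E → ℝ} {x : E} (hw : AnalyticAt ℝ w x) (hφ : AnalyticAt ℝ φ x)
    (hx : w x ∈ offUnitCircle a) :
    AnalyticAt ℝ (fun y => secularKernel σ a (w y) (φ y)) x := by
  have hre : AnalyticAt ℝ (fun y => (w y).re) x := (Complex.reCLM.analyticAt (w x)).fun_comp hw
  have hr := mul_pos ha (one_sub_re_pos hx.1)
  have hexp : AnalyticAt ℝ (fun y => Complex.exp (φ y * Complex.I)) x :=
    AnalyticAt.fun_comp (g := Complex.exp) (analyticAt_cexp.restrictScalars)
      (((Complex.ofRealCLM.analyticAt (φ x)).fun_comp hφ).fun_mul analyticAt_const)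
  refine analyticAt_tidalKernel (analyticAt_const.fun_mul (analyticAt_const.fun_sub hre))
    (hexp.fun_mul ((analyticAt_anomalyFactor σ hx.1).fun_comp hw)) hr.ne' ?_
  obtain ⟨β, hβ⟩ := exists_anomalyFactor_eq σ hx.1
  rw [hβ, ← Complex.exp_add, ← add_mul, ← Complex.ofReal_add, Complex.exp_ofReal_mul_I_re]
  exact distSq_pos hr hx.2 _

lemma continuous_secularKernel (ha : 0 < a) {X : Type*} [TopologicalSpace X] {w : X → ℂ}
    {φ : X → ℝ} (hw : Continuous w) (hφ : Continuous φ) (h : ∀ x, w x ∈ offUnitCircle a) :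
    Continuous fun x => secularKernel σ a (w x) (φ x) :=
  continuous_iff_continuousAt.2 fun x =>
    ContinuousAt.comp (f := fun x => (w x, φ x))
      (g := fun y : ℂ × ℝ => secularKernel σ a y.1 y.2)
      (analyticAt_secularKernel ha analyticAt_fst analyticAt_snd (h x)).continuousAt
      (hw.prodMk hφ).continuousAt

lemma exp_two_pi_int (k : ℤ) : Complex.exp ((2 * Real.pi * k : ℝ) * Complex.I) = 1 :=
  Complex.exp_eq_one_iff.2 ⟨k, by push_cast; ring⟩

lemma secularKernel_add_two_pi (w : ℂ) (φ : ℝ) (k : ℤ) :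
    secularKernel σ a w (φ + 2 * Real.pi * k) = secularKernel σ a w φ := by
  rw [secularKernel, Complex.ofReal_add, add_mul, Complex.exp_add, exp_two_pi_int, mul_one,
    secularKernel]

variable {p q : ℕ}

/-- The integral in the definition of `C` as a function of `v = e exp (i α)`, where `α` is the
phase determined by `n_l` and `n_g`. -/
def secularIntegral (p q : ℕ) (a : ℝ) (v : ℂ) : ℝ :=
  ∫ F in (0 : ℝ)..(2 * Real.pi),
    secularKernel (p / q) a (v * Complex.exp ((q * F : ℝ) * Complex.I)) ((p + q : ℕ) * F)

lemma analyticAt_secularIntegral (ha : 0 < a) (ha1 : a ≠ 1) :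
    AnalyticAt ℝ (secularIntegral p q a) 0 := by
  refine analyticAt_parametric_integral (E := ℂ) (F := ℝ) (g := fun y : ℂ × ℝ =>
    secularKernel (p / q) a (y.1 * Complex.exp ((q * y.2 : ℝ) * Complex.I)) ((p + q : ℕ) * y.2))
    (fun s => ?_) Real.two_pi_pos.le
  have hexp : AnalyticAt ℝ (fun y : ℂ × ℝ => Complex.exp ((q * y.2 : ℝ) * Complex.I)) (0, s) :=
    AnalyticAt.fun_comp (g := Complex.exp) (analyticAt_cexp.restrictScalars)
      (((Complex.ofRealCLM.analyticAt (q * s)).fun_comp_of_eq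
        (analyticAt_const.fun_mul analyticAt_snd) rfl).fun_mul analyticAt_const)
  refine analyticAt_secularKernel ha (analyticAt_fst.fun_mul hexp)
    (analyticAt_const.fun_mul analyticAt_snd) ?_
  simpa [offUnitCircle] using ha1

/-- Adding a constant to the angle `θ` is equivalent to a rotation of `v`. -/
lemma integral_secularKernel_add (hpq : p + q ≠ 0) (v : ℂ) (β : ℝ) :
    ∫ F in (0 : ℝ)..(2 * Real.pi), secularKernel (p / q) a
      (v * Complex.exp ((q * F : ℝ) * Complex.I)) ((p + q : ℕ) * F + β) =
    secularIntegral p q a (v * Complex.exp ((-(q * β / (p + q : ℕ)) : ℝ) * Complex.I)) := by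
  have hN : ((p + q : ℕ) : ℝ) ≠ 0 := by exact_mod_cast hpq
  set w := v * Complex.exp ((-(q * β / (p + q : ℕ)) : ℝ) * Complex.I) with hw
  let h : ℝ → ℝ := fun F => secularKernel (p / q) a
    (w * Complex.exp ((q * F : ℝ) * Complex.I)) ((p + q : ℕ) * F)
  have hper : Function.Periodic h (2 * Real.pi) := fun F => by
    have h1 : Complex.exp ((q * (F + 2 * Real.pi) : ℝ) * Complex.I) =
        Complex.exp ((q * F : ℝ) * Complex.I) := by
      have h2 : ((q * (F + 2 * Real.pi) : ℝ) : ℂ) * Complex.I =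
          (q * F : ℝ) * Complex.I + (2 * Real.pi * (q : ℤ) : ℝ) * Complex.I := by
        push_cast; ring
      rw [h2, Complex.exp_add, exp_two_pi_int, mul_one]
    have h3 : ((p + q : ℕ) : ℝ) * (F + 2 * Real.pi) =
        (p + q : ℕ) * F + 2 * Real.pi * ((p + q : ℕ) : ℤ) := by
      push_cast; ring
    simp only [h]
    rw [h1, h3, secularKernel_add_two_pi]
  have hshift : ∀ F : ℝ, secularKernel (p / q) a
      (v * Complex.exp ((q * F : ℝ) * Complex.I)) ((p + q : ℕ) * F + β) =
        h (F + β / (p + q : ℕ)) := fun F => by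
    have h1 : w * Complex.exp ((q * (F + β / (p + q : ℕ)) : ℝ) * Complex.I) =
        v * Complex.exp ((q * F : ℝ) * Complex.I) := by
      rw [hw, mul_assoc, ← Complex.exp_add]
      push_cast
      ring_nf
    have h2 : ((p + q : ℕ) : ℝ) * (F + β / (p + q : ℕ)) = (p + q : ℕ) * F + β := by
      field_simp
    simp only [h]
    rw [h1, h2]
  simp only [hshift]
  rw [intervalIntegral.integral_comp_add_right, zero_add, add_comm (2 * Real.pi),
    hper.intervalIntegral_add_eq _ 0, zero_add]
  rfl

/-- The integral is invariant under the rotations of order `p + q`. -/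
lemma secularIntegral_rotate (hp : 0 < p) (hpq : Nat.Coprime p q) (v : ℂ) (k : ℤ) :
    secularIntegral p q a (v * Complex.exp ((2 * Real.pi * k / (p + q : ℕ) : ℝ) * Complex.I)) =
      secularIntegral p q a v := by
  have hN : p + q ≠ 0 := by omega
  have hN' : ((p : ℂ) + q) ≠ 0 := by exact_mod_cast hN
  -- `q j + (p + q) t = 1`
  obtain ⟨j, t, hjt⟩ : IsCoprime (q : ℤ) ((p + q : ℕ) : ℤ) := by
    refine Nat.isCoprime_iff_coprime.2 ?_
    simpa using hpq.symm
  have h := integral_secularKernel_add (a := a) hN v (2 * Real.pi * (-(j * k) : ℤ))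
  simp only [secularKernel_add_two_pi] at h
  have hjt' : (j : ℂ) * q + t * (p + q) = 1 := by exact_mod_cast hjt
  have hexp : Complex.exp ((-(q * (2 * Real.pi * (-(j * k) : ℤ)) / (p + q : ℕ)) : ℝ) * Complex.I) =
      Complex.exp ((2 * Real.pi * k / (p + q : ℕ) : ℝ) * Complex.I) := by
    have : ((2 * Real.pi * k / (p + q : ℕ) : ℝ) : ℂ) * Complex.I =
        (-(q * (2 * Real.pi * (-(j * k) : ℤ)) / (p + q : ℕ)) : ℝ) * Complex.I +
          (2 * Real.pi * (t * k : ℤ) : ℝ) * Complex.I := by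
      push_cast
      field_simp
      linear_combination (-(k : ℂ)) * hjt'
    rw [this, Complex.exp_add, exp_two_pi_int, mul_one]
  rw [hexp] at h
  exact h.symm

/-- By Fubini's theorem and the rotation of `v exp (i ψ)` by `-q F`, the mean over a circle about
`0` is the mean over that circle of integrals over the angle at fixed `w`. These vanish. -/
lemma mean_secularIntegral (ha : 0 < a) (ha1 : a ≠ 1) (hpq : p + q ≠ 0) :
    ∀ᶠ v in 𝓝 (0 : ℂ), ∫ ψ in (0 : ℝ)..(2 * Real.pi),
      secularIntegral p q a (v * Complex.exp (ψ * Complex.I)) = 0 := by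
  filter_upwards [eventually_circle_subset ha1] with v hv
  have hint : ∀ f : ℝ × ℝ → ℝ, Continuous f → MeasureTheory.IntegrableOn f
      (uIoc 0 (2 * Real.pi) ×ˢ uIoc 0 (2 * Real.pi)) := fun f hf =>
    (hf.continuousOn.integrableOn_compact (isCompact_uIcc.prod isCompact_uIcc)).mono_set
      (prod_mono uIoc_subset_uIcc uIoc_subset_uIcc)
  let k : ℝ → ℝ → ℝ := fun ψ F => secularKernel (p / q) a
    (v * Complex.exp (ψ * Complex.I)) ((p + q : ℕ) * F)
  have hk : Continuous (Function.uncurry k) :=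
    continuous_secularKernel ha (by fun_prop) (by fun_prop) fun x => hv x.1
  have hper : ∀ F, Function.Periodic (fun ψ => k ψ F) (2 * Real.pi) := fun F ψ => by
    have : Complex.exp (((ψ + 2 * Real.pi : ℝ) : ℂ) * Complex.I) =
        Complex.exp (ψ * Complex.I) := by
      rw [Complex.ofReal_add, add_mul, Complex.exp_add]
      have := exp_two_pi_int 1
      simp only [Int.cast_one, mul_one] at this
      rw [this, mul_one]
    simp only [k]
    rw [this]
  have hsec : ∀ ψ : ℝ, secularIntegral p q a (v * Complex.exp (ψ * Complex.I)) =
      ∫ F in (0 : ℝ)..(2 * Real.pi), k (ψ + q * F) F := fun ψ => by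
    refine intervalIntegral.integral_congr fun F _ => ?_
    simp only [k]
    rw [Complex.ofReal_add, add_mul, Complex.exp_add, mul_assoc]
  have hzero : ∀ ψ : ℝ, ∫ F in (0 : ℝ)..(2 * Real.pi), k ψ F = 0 := fun ψ => by
    obtain ⟨β, hβ⟩ := secularKernel_eq (σ := p / q) (hv ψ)
    simp only [k, hβ]
    exact integral_tidalKernel (mul_pos ha (one_sub_re_pos (hv ψ).1)) (hv ψ).2 hpq β
  simp only [hsec]
  rw [MeasureTheory.intervalIntegral_intervalIntegral_swap
    (hint (Function.uncurry fun ψ F => k (ψ + q * F) F)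
      (hk.comp (g := Function.uncurry k) (f := fun x : ℝ × ℝ => (x.1 + q * x.2, x.2))
        (by fun_prop)))]
  have hin : ∀ F : ℝ, ∫ ψ in (0 : ℝ)..(2 * Real.pi), k (ψ + q * F) F =
      ∫ ψ in (0 : ℝ)..(2 * Real.pi), k ψ F := fun F => by
    rw [intervalIntegral.integral_comp_add_right (fun ψ => k ψ F), zero_add,
      add_comm (2 * Real.pi), (hper F).intervalIntegral_add_eq _ 0, zero_add]
  simp only [hin]
  rw [← MeasureTheory.intervalIntegral_intervalIntegral_swap (hint _ hk)]
  simp only [hzero, intervalIntegral.integral_zero]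

/-- By the symmetry of order `p + q`, the integral has equal values at the vertices of a regular
polygon. -/
lemma secularIntegral_isBigO (ha : 0 < a) (ha1 : a ≠ 1) (hp : 0 < p) (hpq : Nat.Coprime p q) :
    secularIntegral p q a =O[𝓝 0] fun v => ‖v‖ ^ (p + q) := by
  have hN : p + q ≠ 0 := by omega
  have h := isBigO_sum_polygon (analyticAt_secularIntegral ha ha1)
    (mean_secularIntegral (p := p) (q := q) ha ha1 hN) hN
  have hrot : ∀ v : ℂ, ∀ m : ℕ, secularIntegral p q a
      (v * Complex.exp ((2 * Real.pi * m / (p + q : ℕ) : ℝ) * Complex.I)) =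
        secularIntegral p q a v := fun v m => by
    have := secularIntegral_rotate (a := a) hp hpq v m
    rwa [Int.cast_natCast] at this
  simp only [hrot, Finset.sum_const, Finset.card_range, nsmul_eq_mul] at h
  exact (isBigO_const_mul_left_iff (by exact_mod_cast hN)).1 h

/-- The sum over two points that differ by half the angle of symmetry is of twice the order. -/
lemma secularIntegral_add_isBigO (ha : 0 < a) (ha1 : a ≠ 1) (hp : 0 < p)
    (hpq : Nat.Coprime p q) :
    (fun v => secularIntegral p q a v +
      secularIntegral p q a (v * Complex.exp ((Real.pi / (p + q : ℕ) : ℝ) * Complex.I)))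
      =O[𝓝 0] fun v => ‖v‖ ^ (2 * (p + q)) := by
  have hN : p + q ≠ 0 := by omega
  have hN' : ((p + q : ℕ) : ℝ) ≠ 0 := by exact_mod_cast hN
  have h := isBigO_sum_polygon (analyticAt_secularIntegral ha ha1)
    (mean_secularIntegral (p := p) (q := q) ha ha1 hN) (M := 2 * (p + q)) (by omega)
  have hsum : ∀ (v : ℂ) (n : ℕ), ∑ m ∈ Finset.range (2 * n), secularIntegral p q a
      (v * Complex.exp ((2 * Real.pi * m / (2 * (p + q) : ℕ) : ℝ) * Complex.I)) =
      n * (secularIntegral p q a v + secularIntegral p q a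
        (v * Complex.exp ((Real.pi / (p + q : ℕ) : ℝ) * Complex.I))) := by
    intro v n
    induction n with
    | zero => simp
    | succ n ih =>
      have h1 : (2 * Real.pi * (2 * n : ℕ) / (2 * (p + q) : ℕ) : ℝ) =
          2 * Real.pi * (n : ℤ) / (p + q : ℕ) := by
        rw [Nat.cast_mul 2 (p + q)]
        push_cast
        field_simp
      have h2 : v * Complex.exp ((2 * Real.pi * (2 * n + 1 : ℕ) / (2 * (p + q) : ℕ) : ℝ) *
          Complex.I) = v * Complex.exp ((Real.pi / (p + q : ℕ) : ℝ) * Complex.I) *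
            Complex.exp ((2 * Real.pi * (n : ℤ) / (p + q : ℕ) : ℝ) * Complex.I) := by
        have h3 : (2 * Real.pi * (2 * n + 1 : ℕ) / (2 * (p + q) : ℕ) : ℝ) =
            Real.pi / (p + q : ℕ) + 2 * Real.pi * (n : ℤ) / (p + q : ℕ) := by
          rw [Nat.cast_mul 2 (p + q)]
          push_cast
          field_simp
          ring
        rw [h3, Complex.ofReal_add, add_mul, Complex.exp_add, ← mul_assoc v]
      rw [show 2 * (n + 1) = 2 * n + 1 + 1 from rfl, Finset.sum_range_succ,
        Finset.sum_range_succ, ih, h2, secularIntegral_rotate hp hpq, h1,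
        secularIntegral_rotate hp hpq]
      push_cast
      ring
  simp only [hsum] at h
  exact (isBigO_const_mul_left_iff hN').1 h

end SecularSymmetry

/-! ### The coefficient near the circular orbit -/

section NearCircular

variable {p q : ℕ}

/-- The phase of `v = e exp (i α)` for given `n_l`, `n_g`. -/
def familyPhase (p q : ℕ) (nl ng : Fin 2) : ℝ :=
  Real.pi * ((p * (nl : ℕ) - q * (ng : ℕ) : ℤ) : ℝ) / (p + q : ℕ)

lemma Ccoef_eventuallyEq (hp : 0 < p) (hq : 0 < q) (ha1 : ((p : ℝ) / q) ^ ((2 : ℝ) / 3) ≠ 1)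
    (nl ng : Fin 2) : ∀ᶠ e in 𝓝 (0 : ℝ), Ccoef p q nl ng e =
      -6 * Real.pi * (p : ℝ) ^ 2 * secularIntegral p q (((p : ℝ) / q) ^ ((2 : ℝ) / 3))
        (e * Complex.exp ((familyPhase p q nl ng : ℝ) * Complex.I)) := by
  set a := ((p : ℝ) / q) ^ ((2 : ℝ) / 3) with ha
  have ha0 : 0 < a := by positivity
  have hp0 : (p : ℝ) ≠ 0 := by positivity
  have hq0 : (q : ℝ) ≠ 0 := by positivity
  have hN : p + q ≠ 0 := by omega
  have hof : Tendsto (fun e : ℝ => (e : ℂ)) (𝓝 0) (𝓝 0) :=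
    Complex.continuous_ofReal.tendsto' _ _ Complex.ofReal_zero
  have hlt : ∀ᶠ e in 𝓝 (0 : ℝ), |e| < 1 :=
    continuous_abs.continuousAt.eventually_lt continuousAt_const (by simp)
  filter_upwards [hof.eventually (eventually_circle_subset ha1), hlt] with e hcirc he
  set β : ℝ := (ng : ℕ) * Real.pi - (nl : ℕ) * Real.pi * (p / q) with hβ
  have hphase : -(q * β / (p + q : ℕ)) = familyPhase p q nl ng := by
    rw [familyPhase, hβ]
    push_cast
    field_simp
    ring
  rw [Ccoef, ← hphase, ← integral_secularKernel_add hN]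
  congr 1
  refine intervalIntegral.integral_congr fun F _ => ?_
  have hmem := hcirc (q * F)
  have hre : ((e : ℂ) * Complex.exp ((q * F : ℝ) * Complex.I)).re = e * Real.cos (q * F) := by
    rw [Complex.re_ofReal_mul, Complex.exp_ofReal_mul_I_re]
  have hr : orbitR p q e (q * F) = a * (1 - e * Real.cos (q * F)) := rfl
  have hr0 : 0 < orbitR p q e (q * F) := mul_pos ha0 (one_sub_mul_cos_pos he _)
  have hr1 : orbitR p q e (q * F) ≠ 1 := by
    rw [hr, ← hre]
    exact hmem.2
  have hθ : orbitTheta p q e nl ng (q * F) = ((p + q : ℕ) * F + β) +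
      (trueAnomaly e (q * F) - q * F - p / q * (e * Real.sin (q * F))) := by
    rw [orbitTheta, orbitTime, hβ]
    push_cast
    field_simp
    ring
  rw [← tidalKernel_exp hr0 hr1, secularKernel, anomalyFactor_polar _ he, hre, ← hr,
    ← Complex.exp_add, ← add_mul, ← Complex.ofReal_add, ← hθ]

lemma analyticAt_Ccoef (hp : 0 < p) (hq : 0 < q) (ha1 : ((p : ℝ) / q) ^ ((2 : ℝ) / 3) ≠ 1)
    (nl ng : Fin 2) : AnalyticAt ℝ (Ccoef p q nl ng) 0 := by
  refine AnalyticAt.congr (f := fun e : ℝ => -6 * Real.pi * (p : ℝ) ^ 2 *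
      secularIntegral p q (((p : ℝ) / q) ^ ((2 : ℝ) / 3))
        (e * Complex.exp ((familyPhase p q nl ng : ℝ) * Complex.I))) ?_
    ((Ccoef_eventuallyEq hp hq ha1 nl ng).mono fun e h => h.symm)
  refine analyticAt_const.fun_mul (AnalyticAt.fun_comp_of_eq
    (analyticAt_secularIntegral (by positivity) ha1)
    ((Complex.ofRealCLM.analyticAt 0).fun_mul analyticAt_const) (by simp))

lemma tendsto_ofReal_mul (c : ℂ) : Tendsto (fun e : ℝ => (e : ℂ) * c) (𝓝 0) (𝓝 0) :=
  Continuous.tendsto' (by fun_prop) _ _ (by simp)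

lemma isBigO_comp_ray {f : ℂ → ℝ} {M : ℕ} (h : f =O[𝓝 0] fun v => ‖v‖ ^ M) (α : ℝ) :
    (fun e : ℝ => f (e * Complex.exp (α * Complex.I))) =O[𝓝 0] fun e : ℝ => e ^ M := by
  refine (h.comp_tendsto (tendsto_ofReal_mul (Complex.exp (α * Complex.I)))).trans
    (IsBigO.of_bound 1 (Eventually.of_forall fun e => ?_))
  simp [Complex.norm_exp_ofReal_mul_I]

lemma Ccoef_isBigO (hp : 0 < p) (hq : 0 < q) (hpq : Nat.Coprime p q)
    (ha1 : ((p : ℝ) / q) ^ ((2 : ℝ) / 3) ≠ 1) (nl ng : Fin 2) :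
    Ccoef p q nl ng =O[𝓝 0] fun e : ℝ => e ^ (p + q) :=
  ((isBigO_comp_ray (secularIntegral_isBigO (by positivity) ha1 hp hpq) _).const_mul_left _).congr'
    ((Ccoef_eventuallyEq hp hq ha1 nl ng).mono fun e h => h.symm) EventuallyEq.rfl

/-- The phases of the two representatives differ by an odd multiple of half the angle of
symmetry. -/
lemma familyPhase_rep (hpq : Nat.Coprime p q) :
    familyPhase p q (familyRep p 0).1 (familyRep p 0).2 = 0 ∧ ∃ k : ℤ,
      familyPhase p q (familyRep p 1).1 (familyRep p 1).2 =
        Real.pi / (p + q : ℕ) + 2 * Real.pi * k / (p + q : ℕ) := by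
  by_cases hodd : Odd p
  · obtain ⟨k, hk⟩ := hodd
    have : Odd p := ⟨k, hk⟩
    refine ⟨by simp [familyPhase, familyRep, this], k, ?_⟩
    simp only [familyPhase, familyRep, this, if_true]
    rw [← add_div]
    congr 1
    simp only [Fin.val_one, Fin.val_zero]
    rw [hk]
    push_cast
    ring
  · have hq : Odd q := by
      by_contra h
      have h2 := Nat.dvd_gcd (Nat.not_odd_iff_even.1 hodd).two_dvd
        (Nat.not_odd_iff_even.1 h).two_dvd
      rw [hpq] at h2
      omega
    obtain ⟨k, hk⟩ := hq
    refine ⟨by simp [familyPhase, familyRep, hodd], -(k + 1 : ℤ), ?_⟩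
    simp only [familyPhase, familyRep, hodd, if_false]
    rw [← add_div]
    congr 1
    simp only [Fin.val_one, Fin.val_zero]
    rw [hk]
    push_cast
    ring

lemma powerCoeff_Ccoef_add (hp : 0 < p) (hq : 0 < q) (hpq : Nat.Coprime p q)
    (ha1 : ((p : ℝ) / q) ^ ((2 : ℝ) / 3) ≠ 1) :
    powerCoeff (Ccoef p q (familyRep p 0).1 (familyRep p 0).2) (p + q) +
      powerCoeff (Ccoef p q (familyRep p 1).1 (familyRep p 1).2) (p + q) = 0 := by
  set C₀ := Ccoef p q (familyRep p 0).1 (familyRep p 0).2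
  set C₁ := Ccoef p q (familyRep p 1).1 (familyRep p 1).2
  have h₀ : AnalyticAt ℝ C₀ 0 := analyticAt_Ccoef hp hq ha1 _ _
  have h₁ : AnalyticAt ℝ C₁ 0 := analyticAt_Ccoef hp hq ha1 _ _
  obtain ⟨hα₀, k, hα₁⟩ := familyPhase_rep hpq
  have hbig : (C₀ + C₁) =O[𝓝 0] fun e : ℝ => e ^ (2 * (p + q)) := by
    refine ((isBigO_comp_ray (secularIntegral_add_isBigO (p := p) (q := q)
      (a := ((p : ℝ) / q) ^ ((2 : ℝ) / 3)) (by positivity) ha1 hp hpq) 0).const_mul_left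
        (-6 * Real.pi * (p : ℝ) ^ 2)).congr' ?_ EventuallyEq.rfl
    filter_upwards [Ccoef_eventuallyEq hp hq ha1 (familyRep p 0).1 (familyRep p 0).2,
      Ccoef_eventuallyEq hp hq ha1 (familyRep p 1).1 (familyRep p 1).2] with e he₀ he₁
    change _ = Ccoef p q (familyRep p 0).1 (familyRep p 0).2 e +
      Ccoef p q (familyRep p 1).1 (familyRep p 1).2 e
    rw [he₀, he₁, hα₀, hα₁, Complex.ofReal_add, add_mul, Complex.exp_add,
      ← mul_assoc, secularIntegral_rotate hp hpq]
    simp only [Complex.ofReal_zero, zero_mul, Complex.exp_zero, mul_one]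
    ring
  have hz := iteratedDeriv_eq_zero_of_isBigO (h₀.add h₁) hbig (p + q) (by omega)
  rw [iteratedDeriv_add h₀.contDiffAt h₁.contDiffAt] at hz
  rw [powerCoeff, powerCoeff, ← add_div, hz, zero_div]

lemma semiMajorAxis_ne_one (hp : 0 < p) (hq : 0 < q) (h : (p : ℝ) / q ≠ 1) :
    ((p : ℝ) / q) ^ ((2 : ℝ) / 3) ≠ 1 := by
  have h0 : (0 : ℝ) < (p : ℝ) / q := by positivity
  exact fun h1 => h ((Real.rpow_left_inj h0.le zero_le_one (by norm_num)).1
    (h1.trans (Real.one_rpow _).symm))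

end NearCircular

end R3BP

end

theorem theorem2 (p q : ℕ) (hp : 0 < p) (hq : 0 < q) (hpq : Nat.Coprime p q) :
    -- existence, analyticity, uniqueness, multipliers; only two types of families occur
    (∀ e ∈ Ioo (0 : ℝ) 1, ∀ nl ng : Fin 2, NonCollision p q e nl ng →
      FamilyUnique p q e nl ng ∧
      ∃ (γ : ℝ → ℝ → Fin 4 → ℝ) (T : ℝ → ℝ),
        IsPeriodicFamily p q (fun _ => e) nl ng γ T ∧
        MultipliersAsymptotic γ T (Ccoef p q nl ng e) ∧
        ∃ i : Fin 2, BelongsTo p q e γ T (familyRep p i).1 (familyRep p i).2) ∧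
    -- the two types are distinct
    (∀ e ∈ Ioo (0 : ℝ) 1, ∀ (ε₀ ε₁ : ℝ → ℝ) (γ₀ γ₁ : ℝ → ℝ → Fin 4 → ℝ) (T₀ T₁ : ℝ → ℝ),
      ε₀ 0 = e → ε₁ 0 = e →
      IsPeriodicFamily p q ε₀ (familyRep p 0).1 (familyRep p 0).2 γ₀ T₀ →
      IsPeriodicFamily p q ε₁ (familyRep p 1).1 (familyRep p 1).2 γ₁ T₁ →
      DistinctFamilies γ₀ γ₁) ∧
    -- behaviour of the coefficient `C` at `e = 0`
    ((p : ℝ) / q ≠ 1 →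
      (∀ nl ng : Fin 2, AnalyticAt ℝ (Ccoef p q nl ng) 0 ∧
        Ccoef p q nl ng =O[𝓝 0] fun e : ℝ => e ^ (p + q)) ∧
      powerCoeff (Ccoef p q (familyRep p 0).1 (familyRep p 0).2) (p + q) +
        powerCoeff (Ccoef p q (familyRep p 1).1 (familyRep p 1).2) (p + q) = 0) := by
  refine ⟨fun e he nl ng hnc => ?_, fun e he ε₀ ε₁ γ₀ γ₁ T₀ T₁ hε₀ hε₁ h₀ h₁ =>
    distinctFamilies hp hq hpq he hε₀ hε₁ h₀ h₁, fun hne => ?_⟩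
  · have hb : 2 * Real.pi * (p : ℝ) < 4 * Real.pi * p := by
      have : 0 < Real.pi * (p : ℝ) := mul_pos Real.pi_pos (by exact_mod_cast hp)
      linarith
    have hb0 : 0 < 4 * Real.pi * (p : ℝ) := by positivity
    obtain ⟨ε, ζ, Y, hF⟩ := exists_isFlowNear hp hq he hnc hb0
    obtain ⟨δ, γ, T, L, hG⟩ := exists_isFlowFamily hF hp hq he hb
    exact ⟨familyUnique hp hq he hnc, γ, T, hG.isPeriodicFamily hF he,
      hG.multipliersAsymptotic hF hp hq he hnc hb, hG.belongsTo hF hp hq hpq he⟩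
  · have ha1 := semiMajorAxis_ne_one hp hq hne
    exact ⟨fun nl ng => ⟨analyticAt_Ccoef hp hq ha1 nl ng, Ccoef_isBigO hp hq hpq ha1 nl ng⟩,
      powerCoeff_Ccoef_add hp hq hpq ha1⟩
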